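/- **Setting.** Consider self-similar compressible potential flow in the plane of similarity coordinates $\vec\xi=\vec x/t$: $\nabla\cdot(\rho\nabla\chi)+2\rho=0$, $\chi=\psi-\tfrac12|\vec\xi|^2$, $\vec v=\nabla\psi$, $\pi(\rho)=-\chi-\tfrac12|\nabla\chi|^2$, for a polytropic gas $p(\rho)=\frac{\rho_0c_0^2}{\gamma}(\rho/\rho_0)^\gamma$ with $\gamma\in(1,\infty)$, $\rho_0,c_0>0$, sound speed $c=\sqrt{p'(\rho)}$, $\pi'=c^2/\rho$, $\pi(\rho_0)=0$. Let $\vec z=\vec v-\vec\xi$ and $L=|\vec z|/c$ (pseudo-Mach number). Across shocks, with unit normal $\vec n$ pointing downstream ($\vec z_u\cdot\vec n>0$), $\psi$ (hence the tangential velocity) is continuous, $\rho_u\vec z_u\cdot\vec n=\rho_d\vec z_d\cdot\vec n$, and $\vec z_u\cdot\vec n\ge\vec z_d\cdot\vec n$. At walls $\nabla\chi\cdot\vec n=0$. The gas occupies the sector between the opposite wall $\{(-a,0):a\ge0\}$ and the reflection wall $\{r(\cos\theta,\sin\theta):r\ge0\}$; both are at rest, with the corner at the origin. The parameters are $(M_1,\alpha,\theta)$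 with $\alpha\ge0$, $\theta>0$, $\frac\pi2<\alpha+\theta<\pi$; the density $\rho_1>0$ of the 1-sector is fixed. The incident shock is the half-line from a reflection point $\vec\xi_R=r(\cos\theta,\sin\theta)$, $r>0$, to infinity in direction $(-\cos\alpha,\sin\alpha)$, so that $\alpha$ is the counterclockwise angle from it to the opposite wall. It separates the constant states $1$ (upstream, next to the reflection wall) and $2$ (next to the opposite wall), with $\vec v_1-\vec\xi_R=-M_1c_1(\cos\theta,\sin\theta)$ and $\vec v_2$ parallel to the opposite wall. *Local RR*: a shock of positive strength at $\vec\xi_R$ with upstream state 2 and downstream state $\rho_3,\vec v_3$ such that $\vec v_3$ is parallel to the reflection wall. Where two such reflected shocks exist, the one with smaller $|\vec v_3-\vec\xi_R|$ is called strong-type, the other weak-type. A local RR is transonic if $|\vec v_3-\vec\xi_R|<c_3$. *Angle condition*: the tangent of the strong-type reflected shock at $\vec\xi_R$ forms an angle $\le90^\circ$ on its downstream side with the opposite wall. *Global RR* (transonic or sonic): a flow consisting of the states 1 and 2 separated by the incident shock, and a reflected shock that is a simple regular arc, $C^1$ including its endpoints, from $\vec\xi_R$ through the sector to the opposite wall,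 which it meets in a right angle (at a point other than the corner), and that meets the incident shock only in $\vec\xi_R$. This arc and the two walls bound the 3-sector $\Omega$, on the downstream side of the arc; $\psi\in C^2(\Omega)$ solves the equation in $\Omega$, with $L<1$ in $\Omega$; $\psi,\vec v$ and $\rho>0$ are continuous on $\overline\Omega$; the slip condition holds on both walls, and the shock conditions hold on the reflected shock (2-sector upstream). A *strong-type trivial RR* is a global RR with straight reflected shock and constant state in $\Omega$, whose reflected shock is strong-type at $\vec\xi_R$. Parameters are *structurally stable* if global RR exist for all sufficiently near parameters for which local RR exist. **Corollary.** Strong-type trivial RR is not always structurally stable. More precisely, for every such gas and every $\rho_1>0$: 1. Let $(M_1,\alpha,\theta)$ with $\alpha>0$ be parameters at which there is a strong-type trivial RR and at which the local weak-type RR exists and is transonic. Then there is $\delta_0>0$ such that for all $\delta\in(0,\delta_0)$, at the parameters $(M_1,\alpha-\delta,\theta+\delta)$ local weak-type transonic RR exists, the angle condition is violated, and no global RR (of weak or strong type) exists. In particular $(M_1,\alpha,\theta)$ is not structurally stable. 2. Parameters as in 1 exist; so there are strong-type trivial RR that are not structurally stable. -/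

import Mathlib

open Set Filter Topology

noncomputable section

namespace RegularReflection

/-- The plane of similarity coordinates `ξ = x / t`, with its Euclidean structure. -/
abbrev Plane : Type := EuclideanSpace ℝ (Fin 2)

/-- Euclidean inner product of plane vectors. -/
def dot (a b : Plane) : ℝ := inner ℝ a b

/-- Counterclockwise rotation by a right angle. -/
def rot (a : Plane) : Plane := !₂[-(a 1), a 0]

/-! ## Polytropic gas -/

/-- A polytropic gas: ratio of heats `γ > 1`, reference density `ρ₀` and reference sound speed
`c₀`. -/
structure Gas where
  γ : ℝ
  ρ₀ : ℝ
  c₀ : ℝ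
  one_lt_γ : 1 < γ
  ρ₀_pos : 0 < ρ₀
  c₀_pos : 0 < c₀

namespace Gas

variable (G : Gas)

/-- Equation of state `p(ρ) = (ρ₀ c₀² / γ) (ρ / ρ₀) ^ γ`. -/
def pressure (ρ : ℝ) : ℝ := G.ρ₀ * G.c₀ ^ 2 / G.γ * (ρ / G.ρ₀) ^ G.γ

/-- Sound speed `c(ρ)`, so that `c² = dp/dρ`. -/
def soundSpeed (ρ : ℝ) : ℝ := G.c₀ * (ρ / G.ρ₀) ^ ((G.γ - 1) / 2)

/-- The function `π` with `dπ/dρ = c² / ρ`, normalized by `π(ρ₀) = 0`. -/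
def enthalpy (ρ : ℝ) : ℝ := G.c₀ ^ 2 / (G.γ - 1) * ((ρ / G.ρ₀) ^ (G.γ - 1) - 1)

theorem soundSpeed_sq {ρ : ℝ} (hρ : 0 < ρ) :
    G.soundSpeed ρ ^ 2 = G.c₀ ^ 2 * (ρ / G.ρ₀) ^ (G.γ - 1) := by
  have h : 0 ≤ ρ / G.ρ₀ := (div_pos hρ G.ρ₀_pos).le
  rw [soundSpeed, mul_pow, ← Real.rpow_natCast ((ρ / G.ρ₀) ^ ((G.γ - 1) / 2)) 2,
    ← Real.rpow_mul h]
  congr 2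
  push_cast
  ring

theorem hasDerivAt_pressure {ρ : ℝ} (hρ : 0 < ρ) :
    HasDerivAt G.pressure (G.soundSpeed ρ ^ 2) ρ := by
  have h0 := G.ρ₀_pos.ne'
  have hγ : G.γ ≠ 0 := by have := G.one_lt_γ; positivity
  have h : ρ / G.ρ₀ ≠ 0 := (div_pos hρ G.ρ₀_pos).ne'
  have h1 : HasDerivAt (fun x : ℝ => x / G.ρ₀) (1 / G.ρ₀) ρ := (hasDerivAt_id ρ).div_const _
  have h2 := (h1.rpow_const (p := G.γ) (Or.inl h)).const_mul (G.ρ₀ * G.c₀ ^ 2 / G.γ)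
  rw [soundSpeed_sq G hρ]
  refine h2.congr_deriv ?_
  field_simp

theorem hasDerivAt_enthalpy {ρ : ℝ} (hρ : 0 < ρ) :
    HasDerivAt G.enthalpy (G.soundSpeed ρ ^ 2 / ρ) ρ := by
  have h0 := G.ρ₀_pos.ne'
  have hγ : G.γ - 1 ≠ 0 := by have := G.one_lt_γ; linarith
  have hp : 0 < ρ / G.ρ₀ := div_pos hρ G.ρ₀_pos
  have h1 : HasDerivAt (fun x : ℝ => x / G.ρ₀) (1 / G.ρ₀) ρ := (hasDerivAt_id ρ).div_const _
  have h2 := ((h1.rpow_const (p := G.γ - 1) (Or.inl hp.ne')).sub_const 1).const_mul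
    (G.c₀ ^ 2 / (G.γ - 1))
  rw [soundSpeed_sq G hρ]
  refine h2.congr_deriv ?_
  rw [Real.rpow_sub_one hp.ne' (G.γ - 1)]
  field_simp

end Gas

/-! ## Shock relations at a point -/

/-- A shock of positive strength at a point, with unit normal `n` pointing downstream, upstream
density and pseudo-velocity `ρu, zu`, downstream ones `ρd, zd`: conservation of mass, continuity of
the tangential velocity, Bernoulli's law (continuity of the pseudo-potential `χ`, where
`π(ρ) = -χ - |∇χ|² / 2` on both sides), and admissibility. -/
structure IsShock (G : Gas) (n : Plane) (ρu : ℝ) (zu : Plane) (ρd : ℝ) (zd : Plane) : Prop where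
  unit : ‖n‖ = 1
  density_pos : 0 < ρd
  upstream : 0 < dot zu n
  compressive : dot zd n < dot zu n
  mass : ρu * dot zu n = ρd * dot zd n
  tangential : dot zu (rot n) = dot zd (rot n)
  bernoulli : G.enthalpy ρu + ‖zu‖ ^ 2 / 2 = G.enthalpy ρd + ‖zd‖ ^ 2 / 2

/-! ## The reflection problem

The frame of reference is that of the wall-wall corner, which is the origin. The opposite wall is
the negative horizontal axis; the reflection wall is the ray from the origin in the direction
`(cos θ, sin θ)`. The gas fills the sector of opening `π - θ` between them. -/

/-- Parameters: the Mach number `M₁` of the 1-sector seen from the reflection point, the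
counterclockwise angle `α` from the incident shock to the opposite wall, and `θ` (the walls enclose
the angle `π - θ`). -/
structure Params where
  M₁ : ℝ
  α : ℝ
  θ : ℝ

namespace Params

variable (p : Params)

/-- Direction of the reflection wall, from the corner. -/
def wallDir : Plane := !₂[Real.cos p.θ, Real.sin p.θ]

/-- Unit normal of the reflection wall, pointing into the gas. -/
def wallNormal : Plane := !₂[-Real.sin p.θ, Real.cos p.θ]

/-- The gas domain: the open sector of polar angles in `(θ, π)`. -/
def sector : Set Plane := {ξ | 0 < ξ 1 ∧ 0 < dot ξ p.wallNormal}

/-- Direction of the incident shock, from the reflection point to infinity. -/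
def incidentDir : Plane := !₂[-Real.cos p.α, Real.sin p.α]

/-- Unit normal of the incident shock, from the 1-sector (next to the reflection wall) to the
2-sector (next to the opposite wall). -/
def incidentNormal : Plane := !₂[-Real.sin p.α, -Real.cos p.α]

/-- The incident shock: a straight half-line from the reflection point `ξR` to infinity. -/
def incidentShock (ξR : Plane) : Set Plane := {ξ | ∃ l : ℝ, 0 ≤ l ∧ ξ = ξR + l • p.incidentDir}

/-- Perturbation of the angles to `(α - δ, θ + δ)`, with `M₁` fixed. -/
def perturb (δ : ℝ) : Params := ⟨p.M₁, p.α - δ, p.θ + δ⟩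

end Params

/-- Reflection point and constant states of the 1- and 2-sector (the density of the 1-sector is
given separately). -/
structure Incident where
  ξR : Plane
  v₁ : Plane
  ρ₂ : ℝ
  v₂ : Plane

/-- `I` is the incident part of the flow with 1-sector density `ρ₁` and parameters `p`. The gas of
the 1-sector flows along the reflection wall and that of the 2-sector along the opposite wall; the
two states are connected by the incident shock, which makes an acute angle `π - (α + θ)` with the
reflection wall on the side of the 1-sector. -/
structure IsIncident (G : Gas) (ρ₁ : ℝ) (p : Params) (I : Incident) : Prop where
  α_nonneg : 0 ≤ p.α
  θ_pos : 0 < p.θ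
  acute : Real.pi / 2 < p.α + p.θ
  sum_lt_pi : p.α + p.θ < Real.pi
  ξR_mem : ∃ r : ℝ, 0 < r ∧ I.ξR = r • p.wallDir
  v₁_eq : I.v₁ - I.ξR = -(p.M₁ * G.soundSpeed ρ₁) • p.wallDir
  v₂_slip : I.v₂ 1 = 0
  shock : IsShock G p.incidentNormal ρ₁ (I.v₁ - I.ξR) I.ρ₂ (I.v₂ - I.ξR)

/-! ## Local regular reflection -/

/-- A local reflected shock at the reflection point, with unit downstream normal `n` and downstream
state `ρ₃, v₃` satisfying the slip condition at the reflection wall. -/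
structure IsReflected (G : Gas) (p : Params) (I : Incident) (n : Plane) (ρ₃ : ℝ) (v₃ : Plane) :
    Prop where
  shock : IsShock G n I.ρ₂ (I.v₂ - I.ξR) ρ₃ (v₃ - I.ξR)
  slip : dot v₃ p.wallNormal = 0

/-- Of two different local reflected shocks, the strong-type one has the smaller downstream speed
relative to the reflection point. -/
def IsStrongType (G : Gas) (p : Params) (I : Incident) (n : Plane) (ρ₃ : ℝ) (v₃ : Plane) : Prop :=
  IsReflected G p I n ρ₃ v₃ ∧
    ∃ n' ρ' v', IsReflected G p I n' ρ' v' ∧ ‖v₃ - I.ξR‖ < ‖v' - I.ξR‖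

/-- Of two different local reflected shocks, the weak-type one has the larger downstream speed
relative to the reflection point. -/
def IsWeakType (G : Gas) (p : Params) (I : Incident) (n : Plane) (ρ₃ : ℝ) (v₃ : Plane) : Prop :=
  IsReflected G p I n ρ₃ v₃ ∧
    ∃ n' ρ' v', IsReflected G p I n' ρ' v' ∧ ‖v' - I.ξR‖ < ‖v₃ - I.ξR‖

/-- Local regular reflection (of any type) exists. -/
def HasLocalRR (G : Gas) (ρ₁ : ℝ) (p : Params) : Prop :=
  ∃ I, IsIncident G ρ₁ p I ∧ ∃ n ρ₃ v₃, IsReflected G p I n ρ₃ v₃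

/-- Local weak-type transonic regular reflection exists: the weak-type downstream state has
pseudo-Mach number less than `1` at the reflection point. -/
def HasTransonicWeakLocalRR (G : Gas) (ρ₁ : ℝ) (p : Params) : Prop :=
  ∃ I, IsIncident G ρ₁ p I ∧
    ∃ n ρ₃ v₃, IsWeakType G p I n ρ₃ v₃ ∧ ‖v₃ - I.ξR‖ < G.soundSpeed ρ₃

/-- The angle condition: the tangent of the strong-type reflected shock at the reflection point
forms an angle at most `π / 2`, on its downstream side, with the opposite wall. Seen from the point
where they meet, the downstream part of the opposite wall has direction `(1, 0)` and the tangent has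
direction `rot n`, since the shock leaves the reflection point in the direction `-rot n`. -/
def AngleCondition (G : Gas) (ρ₁ : ℝ) (p : Params) : Prop :=
  ∀ I, IsIncident G ρ₁ p I → ∀ n ρ₃ v₃, IsStrongType G p I n ρ₃ v₃ →
    InnerProductGeometry.angle (rot n) (!₂[1, 0] : Plane) ≤ Real.pi / 2

/-! ## Global regular reflection -/

/-- Divergence of a vector field in the plane. -/
def divergence (F : Plane → Plane) (ξ : Plane) : ℝ :=
  ∑ i : Fin 2, (fderiv ℝ F ξ (EuclideanSpace.single i 1)) i

/-- Velocity potential of the constant state with density `ρ` and velocity `v`. Its additive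
constant is fixed by `π(ρ) = -χ - |∇χ|² / 2`, where `χ = ψ - |ξ|² / 2`. -/
def constPotential (G : Gas) (ρ : ℝ) (v : Plane) (ξ : Plane) : ℝ :=
  dot v ξ - ‖v‖ ^ 2 / 2 - G.enthalpy ρ

/-- The reflected shock, parametrized by `[0, 1]`, and the flow in the 3-sector `Ω`: velocity
potential `ψ`, velocity `v`, density `ρ`. -/
structure ReflectedFlow where
  σ : ℝ → Plane
  Ω : Set Plane
  ψ : Plane → ℝ
  v : Plane → Plane
  ρ : Plane → ℝ

namespace ReflectedFlow

variable (F : ReflectedFlow)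

/-- Tangent of the reflected shock, directed from the reflection point to the opposite wall. -/
def tangent (s : ℝ) : Plane := derivWithin F.σ (Icc 0 1) s

/-- A positive multiple of the downstream unit normal of the reflected shock. -/
def normal (s : ℝ) : Plane := rot (F.tangent s)

/-- Pseudo-velocity `z = ∇χ = v - ξ`. -/
def z (ξ : Plane) : Plane := F.v ξ - ξ

end ReflectedFlow

/-- A transonic (or sonic) global regular reflection: the constant states of the 1- and 2-sector are
those of `I`, separated by the straight incident shock; `F` is the reflected shock and the flow in
the 3-sector. -/
structure IsGlobalRR (G : Gas) (ρ₁ : ℝ) (p : Params) (I : Incident) (F : ReflectedFlow) : Prop where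
  incident : IsIncident G ρ₁ p I
  -- The reflected shock is a simple arc, continuously differentiable including the endpoints.
  shock_C1 : ContDiffOn ℝ 1 F.σ (Icc 0 1)
  shock_regular : ∀ s ∈ Icc (0 : ℝ) 1, F.tangent s ≠ 0
  shock_simple : InjOn F.σ (Icc 0 1)
  -- It runs from the reflection point through the gas to the opposite wall, which it meets in a
  -- right angle; it meets the incident shock only in the reflection point.
  shock_start : F.σ 0 = I.ξR
  shock_inside : ∀ s ∈ Ioo (0 : ℝ) 1, F.σ s ∈ p.sector
  shock_end : ∃ a : ℝ, 0 < a ∧ F.σ 1 = !₂[-a, 0]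
  shock_right_angle : F.tangent 1 0 = 0
  shock_incident : ∀ s ∈ Ioc (0 : ℝ) 1, F.σ s ∉ p.incidentShock I.ξR
  -- The 3-sector is the bounded domain enclosed by the reflected shock and the two walls; it is on
  -- the downstream side of the shock.
  Ω_open : IsOpen F.Ω
  Ω_connected : IsConnected F.Ω
  Ω_bounded : Bornology.IsBounded F.Ω
  Ω_sector : F.Ω ⊆ p.sector
  Ω_frontier : frontier F.Ω = F.σ '' Icc 0 1 ∪ segment ℝ (F.σ 1) 0 ∪ segment ℝ 0 I.ξR
  Ω_downstream : ∀ s ∈ Ioo (0 : ℝ) 1, ∀ᶠ h : ℝ in 𝓝[>] 0, F.σ s + h • F.normal s ∈ F.Ω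
  -- Fluid variables are continuous up to the boundary; `v = ∇ψ` and `π(ρ) = -χ - |∇χ|² / 2`.
  ψ_continuous : ContinuousOn F.ψ (closure F.Ω)
  v_continuous : ContinuousOn F.v (closure F.Ω)
  ρ_continuous : ContinuousOn F.ρ (closure F.Ω)
  ρ_pos : ∀ ξ ∈ closure F.Ω, 0 < F.ρ ξ
  ψ_C2 : ContDiffOn ℝ 2 F.ψ F.Ω
  ψ_gradient : ∀ ξ ∈ F.Ω, HasGradientAt F.ψ (F.v ξ) ξ
  bernoulli : ∀ ξ ∈ closure F.Ω,
    G.enthalpy (F.ρ ξ) = -(F.ψ ξ - ‖ξ‖ ^ 2 / 2) - ‖F.z ξ‖ ^ 2 / 2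
  -- Self-similar potential flow `div (ρ ∇χ) + 2 ρ = 0`, elliptic in the interior.
  potential_flow : ∀ ξ ∈ F.Ω, divergence (fun η => F.ρ η • F.z η) ξ + 2 * F.ρ ξ = 0
  elliptic : ∀ ξ ∈ F.Ω, ‖F.z ξ‖ < G.soundSpeed (F.ρ ξ)
  -- Slip condition on the opposite wall and on the reflection wall.
  slip_opposite : ∀ ξ ∈ openSegment ℝ (F.σ 1) 0, F.v ξ 1 = 0
  slip_reflection : ∀ ξ ∈ openSegment ℝ 0 I.ξR, dot (F.v ξ) p.wallNormal = 0
  -- Shock conditions between the 2-sector (upstream) and the 3-sector (downstream).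
  shock_potential : ∀ s ∈ Icc (0 : ℝ) 1, F.ψ (F.σ s) = constPotential G I.ρ₂ I.v₂ (F.σ s)
  shock_mass : ∀ s ∈ Icc (0 : ℝ) 1,
    I.ρ₂ * dot (I.v₂ - F.σ s) (F.normal s) = F.ρ (F.σ s) * dot (F.z (F.σ s)) (F.normal s)
  shock_tangential : ∀ s ∈ Icc (0 : ℝ) 1,
    dot (I.v₂ - F.σ s) (F.tangent s) = dot (F.z (F.σ s)) (F.tangent s)
  shock_upstream : ∀ s ∈ Icc (0 : ℝ) 1, 0 < dot (I.v₂ - F.σ s) (F.normal s)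
  shock_admissible : ∀ s ∈ Icc (0 : ℝ) 1,
    dot (F.z (F.σ s)) (F.normal s) ≤ dot (I.v₂ - F.σ s) (F.normal s)

/-- A transonic (or sonic) global regular reflection exists, of whichever type. -/
def HasGlobalRR (G : Gas) (ρ₁ : ℝ) (p : Params) : Prop := ∃ I F, IsGlobalRR G ρ₁ p I F

/-- At the parameters `p` there is a strong-type trivial regular reflection: a global regular
reflection whose reflected shock is straight (hence perpendicular to the opposite wall), of strong
type at the reflection point, with a constant state in the 3-sector. -/
def HasStrongTypeTrivialRR (G : Gas) (ρ₁ : ℝ) (p : Params) : Prop :=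
  ∃ I F, IsGlobalRR G ρ₁ p I F ∧
    F.σ '' Icc 0 1 = segment ℝ I.ξR (F.σ 1) ∧
    ∃ n ρ₃ v₃, IsStrongType G p I n ρ₃ v₃ ∧ ∀ ξ ∈ closure F.Ω, F.ρ ξ = ρ₃ ∧ F.v ξ = v₃

/-- Structural stability at the parameters `p`: global regular reflections exist for all nearby
parameters for which local regular reflections exist. -/
def StructurallyStable (G : Gas) (ρ₁ : ℝ) (p : Params) : Prop :=
  ∃ ε > 0, ∀ q : Params, |q.M₁ - p.M₁| < ε → |q.α - p.α| < ε → |q.θ - p.θ| < ε →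
    HasLocalRR G ρ₁ q → HasGlobalRR G ρ₁ q

end RegularReflection

end

noncomputable section

namespace RegularReflection

/-! ## Coordinates -/

/-! Instability. The slip conditions on the two walls force `v = 0` at the corner, so a trivial
reflection has gas at rest behind a vertical reflected shock. Passing to `(α - δ, θ + δ)` keeps `M₁`
and `α + θ`, hence only rotates by `δ` the local picture seen from the reflection point
(`IsIncident.perturb_eq`). The opposite wall does not rotate with it, so the reflection point moves
and the velocity of the 2-sector relative to the corner changes.

Locally, reflected shocks correspond to zeros of a strictly convex function `polar` of the
downstream speed `q` at the reflection point. There are at most two zeros, and the strong-type one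
is the smaller, with negative slope. At the resting state `q = ‖ξR‖`, and negative slope becomes an
algebraic inequality (`polarDeriv_neg_iff`). For small `δ > 0` two things follow
(`RestingReflection.eventually_perturb`). The reflection point comes closer to the corner while
every admissible `q` stays at least the old `‖ξR‖`, so the gas there moves along the wall towards
the corner. And a vertical shock at the reflection point, or to the right of it, is too weak to stop
the gas of the 2-sector; to first order in `δ` this is exactly the strong-type inequality
(`RestingReflection.eventually_exists_ratio`).

A global reflection is then impossible (`IsGlobalRR.false_of_weakVerticalShock`). The equation is
elliptic with slip conditions at the walls, so `ψ` attains its maximum over the closed 3-sector on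
the shock (`IsGlobalRR.exists_shock_ge`). There `ψ` equals the affine potential of the 2-sector,
whose gradient points to the right, so the maximum sits at a rightmost point of the shock. If this
is the reflection point, `ψ` increases from it along the wall. Otherwise the shock is vertical
there, the gas behind it still moves to the right, and `ψ` increases into the 3-sector or along the
opposite wall. Either way the maximum is contradicted.

Existence. A trivial reflection is determined by the two density ratios and `α`, subject to one
closing equation. At `α = 0` that equation says that the ratios agree, and the strong-type
inequality becomes `0 < strongExcess`. At a zero of `strongExcess` the polar has slope zero at the
resting state, so by convexity it is positive at slightly larger, still subsonic speeds. Moving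
slightly to the side where `strongExcess` is positive creates a second, weak-type transonic zero.
All these conditions are open, and the closing equation is solved for small `α > 0` by the
intermediate value theorem. -/

theorem dot_eq (a b : Plane) : dot a b = a 0 * b 0 + a 1 * b 1 := by
  simp [dot, PiLp.inner_apply, Fin.sum_univ_two]; ring

theorem norm_sq_eq (a : Plane) : ‖a‖ ^ 2 = a 0 ^ 2 + a 1 ^ 2 := by
  simp [EuclideanSpace.norm_sq_eq, Fin.sum_univ_two]

@[simp] theorem rot_zero (a : Plane) : rot a 0 = -(a 1) := rfl

@[simp] theorem rot_one (a : Plane) : rot a 1 = a 0 := rfl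

@[simp] theorem vec_zero (x y : ℝ) : (!₂[x, y] : Plane) 0 = x := rfl

@[simp] theorem vec_one (x y : ℝ) : (!₂[x, y] : Plane) 1 = y := rfl

theorem plane_ext {a b : Plane} (h0 : a 0 = b 0) (h1 : a 1 = b 1) : a = b := by
  ext i
  fin_cases i
  · exact h0
  · exact h1

/-- A plane vector is determined by its components along a unit vector and its rotation. -/
theorem eq_dot_smul_add {n : Plane} (hn : ‖n‖ = 1) (a : Plane) :
    a = dot a n • n + dot a (rot n) • rot n := by
  have h := norm_sq_eq n
  rw [hn] at h
  apply plane_ext <;> simp [dot_eq]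
  · linear_combination a 0 * h
  · linear_combination a 1 * h

/-! ## Polytropic gas -/

namespace Gas

variable (G : Gas)

theorem soundSpeed_pos {ρ : ℝ} (hρ : 0 < ρ) : 0 < G.soundSpeed ρ := by
  have := G.c₀_pos
  have := G.ρ₀_pos
  unfold soundSpeed
  positivity

theorem soundSpeed_sq_eq {ρu ρd : ℝ} (hu : 0 < ρu) (hd : 0 < ρd) :
    G.soundSpeed ρd ^ 2 = G.soundSpeed ρu ^ 2 * (ρd / ρu) ^ (G.γ - 1) := by
  have h0 := G.ρ₀_pos
  rw [G.soundSpeed_sq hu, G.soundSpeed_sq hd, mul_assoc,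
    ← Real.mul_rpow (by positivity) (by positivity)]
  congr 2
  field_simp

theorem enthalpy_eq {ρ : ℝ} (hρ : 0 < ρ) :
    G.enthalpy ρ = (G.soundSpeed ρ ^ 2 - G.c₀ ^ 2) / (G.γ - 1) := by
  rw [G.soundSpeed_sq hρ, enthalpy]
  ring

end Gas

/-! ## Normal shocks -/

/-- Square of the downstream normal Mach number, relative to the upstream sound speed, of a shock
with density ratio `R`; here `g = γ - 1`. -/
def downstreamSq (g R : ℝ) : ℝ := 2 / g * ((R ^ g - 1) / (R ^ 2 - 1))

theorem downstreamSq_pos {g R : ℝ} (hg : 0 < g) (hR : 1 < R) : 0 < downstreamSq g R := by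
  have h1 : 1 < R ^ g := Real.one_lt_rpow hR hg
  have h2 : 1 < R ^ 2 := by nlinarith
  have h3 : 0 < R ^ g - 1 := by linarith
  have h4 : 0 < R ^ 2 - 1 := by linarith
  unfold downstreamSq
  positivity

/-- Up to an affine change, the function is the secant slope from `1` to `R ^ 2` of the strictly
convex power `x ^ (1 + g / 2)`. It is the squared upstream normal Mach number, so the upstream speed
determines the density ratio. -/
theorem strictMonoOn_upstreamSq {g : ℝ} (hg : 0 < g) :
    StrictMonoOn (fun R => R ^ 2 * downstreamSq g R) (Ioi 1) := by
  intro x hx y hy hxy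
  simp only [mem_Ioi] at hx hy
  have hx2 : 1 < x ^ 2 := by nlinarith
  have hy2 : 1 < y ^ 2 := by nlinarith
  have hxy2 : x ^ 2 < y ^ 2 := by nlinarith
  have h := (strictConvexOn_rpow (p := 1 + g / 2) (by linarith)).secant_strict_mono
    (a := 1) (x := x ^ 2) (y := y ^ 2) (by simp) (by simp; positivity) (by simp; positivity)
    hx2.ne' hy2.ne' hxy2
  have key : ∀ z : ℝ, 1 < z → z ^ 2 * downstreamSq g z =
      2 / g * (((z ^ 2) ^ (1 + g / 2) - 1 ^ (1 + g / 2)) / (z ^ 2 - 1) - 1) := by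
    intro z hz
    have hz0 : 0 < z := by linarith
    have hz2 : z ^ 2 - 1 ≠ 0 := by nlinarith
    have : (z ^ 2) ^ (1 + g / 2) = z ^ 2 * z ^ g := by
      rw [← Real.rpow_natCast z 2, ← Real.rpow_mul hz0.le, ← Real.rpow_add hz0]
      congr 1
      push_cast
      ring
    rw [this, Real.one_rpow, downstreamSq]
    field_simp
    ring
  simp only
  rw [key x hx, key y hy]
  have : 0 < 2 / g := by positivity
  gcongr

/-- After cancelling `R - 1` it is a product of two positive increasing factors. It measures the
squared drop of normal velocity across the shock, in units of the upstream sound speed. -/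
theorem strictMonoOn_strengthSq {g : ℝ} (hg : 0 < g) :
    StrictMonoOn (fun R => (R - 1) ^ 2 * downstreamSq g R) (Ioi 1) := by
  intro x hx y hy hxy
  simp only [mem_Ioi] at hx hy
  have key : ∀ z : ℝ, 1 < z → (z - 1) ^ 2 * downstreamSq g z =
      2 / g * ((z ^ g - 1) * (1 - 2 / (z + 1))) := by
    intro z hz
    have hz2 : z - 1 ≠ 0 := by linarith
    have hz3 : z + 1 ≠ 0 := by linarith
    have : z ^ 2 - 1 = (z - 1) * (z + 1) := by ring
    rw [downstreamSq, this]
    field_simp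
    ring
  simp only
  rw [key x hx, key y hy]
  have h1 : 1 < x ^ g := Real.one_lt_rpow hx hg
  have h2 : x ^ g < y ^ g := Real.rpow_lt_rpow (by linarith) hxy hg
  have h3 : 2 / (y + 1) < 2 / (x + 1) := by
    apply div_lt_div_of_pos_left <;> linarith
  have h4 : 2 / (x + 1) < 1 := by
    rw [div_lt_one] <;> linarith
  have h5 : 0 < 2 / g := by positivity
  have h6 : (x ^ g - 1) * (1 - 2 / (x + 1)) < (y ^ g - 1) * (1 - 2 / (y + 1)) := by
    apply mul_lt_mul'' <;> linarith
  gcongr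

/-- Downstream and upstream normal speeds of a shock, from the density ratio. -/
theorem normal_speeds {G : Gas} {ρu ρd D w : ℝ} (hu : 0 < ρu) (hd : 0 < ρd) (hD : 0 < D)
    (hw : w < D) (hm : ρu * D = ρd * w)
    (hb : G.enthalpy ρu + D ^ 2 / 2 = G.enthalpy ρd + w ^ 2 / 2) :
    1 < ρd / ρu ∧ 0 < w ∧ D = ρd / ρu * w ∧
      w ^ 2 = G.soundSpeed ρu ^ 2 * downstreamSq (G.γ - 1) (ρd / ρu) := by
  have hw0 : 0 < w := by
    have : 0 < ρd * w := by rw [← hm]; positivity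
    exact (mul_pos_iff_of_pos_left hd).1 this
  have hlt : ρu < ρd := by
    by_contra hcon
    push Not at hcon
    have : ρd * w < ρu * D := by nlinarith
    linarith
  have hR : 1 < ρd / ρu := by rwa [one_lt_div hu]
  have hDR : D = ρd / ρu * w := by field_simp; linarith
  refine ⟨hR, hw0, hDR, ?_⟩
  have hg : 0 < G.γ - 1 := by linarith [G.one_lt_γ]
  have hc := G.soundSpeed_sq_eq hu hd
  rw [G.enthalpy_eq hu, G.enthalpy_eq hd, hc, hDR] at hb
  have h2 : (ρd / ρu) ^ 2 - 1 ≠ 0 := by nlinarith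
  generalize (ρd / ρu) = R at *
  rw [downstreamSq]
  field_simp at hb ⊢
  linarith

/-- Existence of a normal shock with given upstream density and density ratio. -/
theorem normal_speeds_bernoulli {G : Gas} {ρu R w : ℝ} (hu : 0 < ρu) (hR : 1 < R)
    (hw : w ^ 2 = G.soundSpeed ρu ^ 2 * downstreamSq (G.γ - 1) R) :
    G.enthalpy ρu + (R * w) ^ 2 / 2 = G.enthalpy (R * ρu) + w ^ 2 / 2 := by
  have hg : 0 < G.γ - 1 := by linarith [G.one_lt_γ]
  have hRu : 0 < R * ρu := by positivity
  have hc := G.soundSpeed_sq_eq hu hRu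
  rw [mul_div_assoc, div_self hu.ne', mul_one] at hc
  have h2 : R ^ 2 - 1 ≠ 0 := by nlinarith
  rw [G.enthalpy_eq hu, G.enthalpy_eq hRu, hc, mul_pow, hw, downstreamSq]
  field_simp
  ring

/-- Continuity of the tangential velocity makes the velocity jump purely normal. -/
theorem IsShock.sub_eq {G : Gas} {n zu zd : Plane} {ρu ρd : ℝ} (h : IsShock G n ρu zu ρd zd) :
    zu - zd = (dot zu n - dot zd n) • n := by
  conv_lhs => rw [eq_dot_smul_add h.unit zu, eq_dot_smul_add h.unit zd, h.tangential]
  module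

theorem IsShock.bernoulli_normal {G : Gas} {n zu zd : Plane} {ρu ρd : ℝ}
    (h : IsShock G n ρu zu ρd zd) :
    G.enthalpy ρu + dot zu n ^ 2 / 2 = G.enthalpy ρd + dot zd n ^ 2 / 2 := by
  have hn : ∀ z : Plane, ‖z‖ ^ 2 = dot z n ^ 2 + dot z (rot n) ^ 2 := by
    intro z
    have h1 := norm_sq_eq n
    rw [h.unit] at h1
    rw [norm_sq_eq, dot_eq, dot_eq]
    simp only [rot_zero, rot_one]
    linear_combination (z 0 ^ 2 + z 1 ^ 2) * h1
  have hb := h.bernoulli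
  rw [hn, hn, h.tangential] at hb
  linarith

theorem IsShock.normal_speeds {G : Gas} {n zu zd : Plane} {ρu ρd : ℝ} (hu : 0 < ρu)
    (h : IsShock G n ρu zu ρd zd) :
    1 < ρd / ρu ∧ 0 < dot zd n ∧ dot zu n = ρd / ρu * dot zd n ∧
      dot zd n ^ 2 = G.soundSpeed ρu ^ 2 * downstreamSq (G.γ - 1) (ρd / ρu) :=
  RegularReflection.normal_speeds hu h.density_pos h.upstream h.compressive h.mass
    h.bernoulli_normal

/-- The upstream normal speed determines the downstream density and normal speed. -/
theorem IsShock.unique {G : Gas} {n zu zd n' zu' zd' : Plane} {ρu ρd ρd' : ℝ} (hu : 0 < ρu)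
    (h : IsShock G n ρu zu ρd zd) (h' : IsShock G n' ρu zu' ρd' zd')
    (he : dot zu n = dot zu' n') : ρd = ρd' ∧ dot zd n = dot zd' n' := by
  obtain ⟨hR, hw, hD, hs⟩ := h.normal_speeds hu
  obtain ⟨hR', hw', hD', hs'⟩ := h'.normal_speeds hu
  have hg : 0 < G.γ - 1 := by linarith [G.one_lt_γ]
  have hc := G.soundSpeed_pos hu
  have e1 : ρd / ρu = ρd' / ρu := by
    apply (strictMonoOn_upstreamSq hg).injOn hR hR'
    have h1 : dot zu n ^ 2 = dot zu' n' ^ 2 := by rw [he]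
    rw [hD, hD', mul_pow, mul_pow, hs, hs'] at h1
    have h2 : G.soundSpeed ρu ^ 2 ≠ 0 := by positivity
    apply mul_left_cancel₀ h2
    simp only
    linarith
  have e2 : ρd = ρd' := by field_simp at e1; exact e1
  refine ⟨e2, ?_⟩
  have h3 := h.mass
  rw [he, h'.mass, ← e2] at h3
  exact (mul_left_cancel₀ h.density_pos.ne' h3).symm

/-! ## The polar of the reflected shock

For a shock from the upstream pseudo-velocity `z` to the downstream one `-q • d`, with `d` a unit
vector, put `Z = ‖z‖²`, `m = -z · d`, and let `C` be the square of the upstream sound speed. -/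

/-- Logarithm of the ratio of upstream to downstream mass flux. -/
def polar (g C Z m q : ℝ) : ℝ :=
  Real.log (Z - q * m) - Real.log q - Real.log (m - q) -
    (Real.log (C + g * (Z - q ^ 2) / 2) - Real.log C) / g

/-- Derivative of `polar`. -/
def polarDeriv (g C Z m q : ℝ) : ℝ :=
  -m / (Z - q * m) - 1 / q + 1 / (m - q) + q / (C + g * (Z - q ^ 2) / 2)

section polar

variable {g C Z m : ℝ}

theorem polar_pos_aux (hg : 0 < g) (hC : 0 < C) (hZ : m ^ 2 ≤ Z) {q : ℝ} (h0 : 0 < q)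
    (hq : q < m) : 0 < Z - q * m ∧ 0 < C + g * (Z - q ^ 2) / 2 := by
  have h1 : q ^ 2 < Z := by nlinarith
  constructor
  · nlinarith
  · have : 0 < Z - q ^ 2 := by linarith
    positivity

theorem hasDerivAt_polar (hg : 0 < g) (hC : 0 < C) (hZ : m ^ 2 ≤ Z) {q : ℝ} (h0 : 0 < q)
    (hq : q < m) : HasDerivAt (polar g C Z m) (polarDeriv g C Z m q) q := by
  obtain ⟨h1, h2⟩ := polar_pos_aux hg hC hZ h0 hq
  have h3 : m - q ≠ 0 := by linarith
  have i := hasDerivAt_id q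
  have d1 := ((i.mul_const m).const_sub Z).log h1.ne'
  have d2 := i.log h0.ne'
  have d3 := (i.const_sub m).log h3
  have d4 := (((((i.pow 2).const_sub Z).const_mul g).div_const 2).const_add C).log h2.ne'
  have := ((d1.sub d2).sub d3).sub ((d4.sub_const (Real.log C)).div_const g)
  refine this.congr_deriv ?_
  simp only [polarDeriv, id, Pi.pow_apply, Nat.cast_ofNat]
  generalize C + g * (Z - q ^ 2) / 2 = c at *
  field_simp
  ring

/-- Strict convexity of the polar, which limits it to two zeros and makes the sign of the slope tell
strong type from weak type. -/
theorem polarDeriv_lt (hg : 0 < g) (hC : 0 < C) (hZ : m ^ 2 ≤ Z) {q q' : ℝ} (h0 : 0 < q)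
    (hqq : q < q') (hq : q' < m) : polarDeriv g C Z m q < polarDeriv g C Z m q' := by
  obtain ⟨h1, h2⟩ := polar_pos_aux hg hC hZ h0 (hqq.trans hq)
  obtain ⟨h3, h4⟩ := polar_pos_aux hg hC hZ (h0.trans hqq) hq
  have e1 : 1 / q' < 1 / q := one_div_lt_one_div_of_lt h0 hqq
  have e2 : q / (C + g * (Z - q ^ 2) / 2) < q' / (C + g * (Z - q' ^ 2) / 2) := by
    have : q ^ 2 < q' ^ 2 := by nlinarith
    have : g * (Z - q' ^ 2) < g * (Z - q ^ 2) := by gcongr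
    rw [div_lt_div_iff₀ h2 h4]
    nlinarith
  have h5 : 0 < m - q := by linarith
  have h6 : 0 < m - q' := by linarith
  have hm : 0 < m := by linarith
  -- The first term alone decreases; paired with `1 / (m - q)` it becomes a nonnegative constant
  -- over a decreasing positive product, thanks to `m ^ 2 ≤ Z`.
  have e3 : -m / (Z - q * m) + 1 / (m - q) ≤ -m / (Z - q' * m) + 1 / (m - q') := by
    have k : ∀ x, 0 < Z - x * m → 0 < m - x →
        -m / (Z - x * m) + 1 / (m - x) = (Z - m ^ 2) / ((Z - x * m) * (m - x)) := by
      intro x hx hx'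
      rw [div_add_div _ _ hx.ne' hx'.ne']
      congr 1
      ring
    rw [k q h1 h5, k q' h3 h6]
    apply div_le_div_of_nonneg_left (by linarith) (by positivity)
    apply mul_le_mul <;> nlinarith
  unfold polarDeriv
  linarith

theorem continuousOn_polar (hg : 0 < g) (hC : 0 < C) (hZ : m ^ 2 ≤ Z) :
    ContinuousOn (polar g C Z m) (Ioo 0 m) := fun _ hq =>
  (hasDerivAt_polar hg hC hZ hq.1 hq.2).continuousAt.continuousWithinAt

theorem exists_polarDeriv_eq_zero (hg : 0 < g) (hC : 0 < C) (hZ : m ^ 2 ≤ Z) {q q' : ℝ}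
    (h0 : 0 < q) (hqq : q < q') (hq : q' < m) (he : polar g C Z m q = polar g C Z m q') :
    ∃ x ∈ Ioo q q', polarDeriv g C Z m x = 0 := by
  refine exists_hasDerivAt_eq_zero hqq ?_ he ?_
  · refine (continuousOn_polar hg hC hZ).mono fun x hx => ⟨?_, ?_⟩
    · exact h0.trans_le hx.1
    · exact hx.2.trans_lt hq
  · intro x hx
    exact hasDerivAt_polar hg hC hZ (h0.trans hx.1) (hx.2.trans hq)

/-- Rolle gives a critical point between the two points of equal value, and the derivative is
strictly increasing. Applied to two zeros, this is the negative slope at the strong-type one. -/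
theorem polarDeriv_neg_of_lt (hg : 0 < g) (hC : 0 < C) (hZ : m ^ 2 ≤ Z) {q q' : ℝ}
    (h0 : 0 < q) (hqq : q < q') (hq : q' < m) (he : polar g C Z m q = polar g C Z m q') :
    polarDeriv g C Z m q < 0 := by
  obtain ⟨x, hx, h⟩ := exists_polarDeriv_eq_zero hg hC hZ h0 hqq hq he
  rw [← h]
  exact polarDeriv_lt hg hC hZ h0 hx.1 (hx.2.trans hq)

/-- The polar has at most two zeros. -/
theorem polar_le_of_eq (hg : 0 < g) (hC : 0 < C) (hZ : m ^ 2 ≤ Z) {q q' x : ℝ}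
    (h0 : 0 < x) (hqq : q < q') (hq : q' < m) (he : polar g C Z m q = polar g C Z m q')
    (hx : polar g C Z m x = polar g C Z m q) : q ≤ x := by
  by_contra hcon
  push Not at hcon
  have h1 := polarDeriv_neg_of_lt hg hC hZ (h0.trans hcon) hqq hq he
  -- A further point of the same level to the left of `q` would produce a critical point there,
  -- although the increasing derivative is still negative at `q`.
  obtain ⟨y, hy, h⟩ := exists_polarDeriv_eq_zero hg hC hZ h0 hcon (hqq.trans hq) hx
  have h2 := polarDeriv_lt hg hC hZ (h0.trans hy.1) hy.2 (hqq.trans hq)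
  linarith

/-- If the polar vanishes at `q` with negative slope and is positive at `q₁ > q`, it has a zero
in between. -/
theorem exists_polar_eq_zero (hg : 0 < g) (hC : 0 < C) (hZ : m ^ 2 ≤ Z) {q q₁ : ℝ}
    (h0 : 0 < q) (hqq : q < q₁) (hq : q₁ < m) (hz : polar g C Z m q = 0)
    (hd : polarDeriv g C Z m q < 0) (h1 : 0 < polar g C Z m q₁) :
    ∃ x ∈ Ioo q q₁, polar g C Z m x = 0 := by
  have hev : ∀ᶠ x in 𝓝[>] q, polar g C Z m x < 0 := by
    have hs := (hasDerivAt_iff_tendsto_slope.1 (hasDerivAt_polar hg hC hZ h0 (hqq.trans hq))).mono_left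
      (nhdsWithin_mono q (fun x (hx : q < x) => hx.ne' : Ioi q ⊆ {q}ᶜ))
    filter_upwards [hs.eventually_lt_const hd, self_mem_nhdsWithin] with x hx (hx' : q < x)
    rw [slope_def_field, hz, sub_zero] at hx
    by_contra hcon
    push Not at hcon
    have : 0 ≤ polar g C Z m x / (x - q) := div_nonneg hcon (by linarith)
    linarith
  obtain ⟨x, hx, hxq⟩ := (hev.and (Ioo_mem_nhdsGT hqq)).exists
  have hcont : ContinuousOn (polar g C Z m) (Icc x q₁) :=
    (continuousOn_polar hg hC hZ).mono fun y hy => ⟨(h0.trans hxq.1).trans_le hy.1, hy.2.trans_lt hq⟩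
  obtain ⟨y, hy, hy0⟩ := intermediate_value_Ioo hxq.2.le hcont (⟨hx, h1⟩ : (0 : ℝ) ∈ Ioo _ _)
  exact ⟨y, ⟨hxq.1.trans hy.1, hy.2⟩, hy0⟩

/-- The polar vanishes exactly where mass is conserved. -/
theorem polar_eq_zero_iff (hg : 0 < g) (hC : 0 < C) (hZ : m ^ 2 ≤ Z) {q : ℝ} (h0 : 0 < q)
    (hq : q < m) : polar g C Z m q = 0 ↔
      Z - q * m = ((C + g * (Z - q ^ 2) / 2) / C) ^ (1 / g) * (q * (m - q)) := by
  obtain ⟨h1, h2⟩ := polar_pos_aux hg hC hZ h0 hq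
  have h3 : 0 < m - q := by linarith
  rw [← Real.log_injOn_pos.eq_iff (show Z - q * m ∈ Ioi 0 from h1) (show _ ∈ Ioi (0:ℝ) by
      simp only [mem_Ioi]; positivity), Real.log_mul (by positivity) (by positivity),
    Real.log_rpow (by positivity), Real.log_div h2.ne' hC.ne', Real.log_mul h0.ne' h3.ne', polar]
  constructor <;> intro h
  · linear_combination h
  · linear_combination h

end polar

/-- A shock with upstream pseudo-velocity `z` and downstream one `-q • d` gives a zero of the
polar. -/
theorem IsShock.polar_eq_zero {G : Gas} {n z d : Plane} {ρu ρd q : ℝ} (hu : 0 < ρu)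
    (hd : ‖d‖ = 1) (hm : 0 < -dot z d) (h : IsShock G n ρu z ρd (-(q • d))) :
    0 < q ∧ q < -dot z d ∧
      polar (G.γ - 1) (G.soundSpeed ρu ^ 2) (‖z‖ ^ 2) (-dot z d) q = 0 ∧
      G.soundSpeed ρd ^ 2 = G.soundSpeed ρu ^ 2 + (G.γ - 1) * (‖z‖ ^ 2 - q ^ 2) / 2 := by
  have hg : 0 < G.γ - 1 := by linarith [G.one_lt_γ]
  have hC : 0 < G.soundSpeed ρu ^ 2 := by have := G.soundSpeed_pos hu; positivity
  have hd2 := norm_sq_eq d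
  rw [hd] at hd2
  obtain ⟨hR, hw, -, -⟩ := h.normal_speeds hu
  have hsub := h.sub_eq
  -- The jump `z + q • d` equals `κ • n`. Hence `κ` times the upstream and downstream normal speeds
  -- are `Z - q * m` and `q * (m - q)`, and their quotient is the density ratio.
  set κ := dot z n - dot (-(q • d)) n with hκ
  have hκ0 : 0 < κ := by rw [hκ]; linarith [h.compressive]
  have c0 : z 0 + q * d 0 = κ * n 0 := by
    have := congrArg (fun a : Plane => a 0) hsub
    simpa using this
  have c1 : z 1 + q * d 1 = κ * n 1 := by
    have := congrArg (fun a : Plane => a 1) hsub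
    simpa using this
  have hmass := h.mass
  have hup := h.upstream
  have hnz := norm_sq_eq z
  have hb := h.bernoulli
  have hnq : ‖-(q • d)‖ ^ 2 = q ^ 2 := by
    rw [norm_neg, norm_smul, hd, mul_one, Real.norm_eq_abs, sq_abs]
  have hZ : (-dot z d) ^ 2 ≤ ‖z‖ ^ 2 := by
    rw [hnz, dot_eq]
    nlinarith [sq_nonneg (z 0 * d 1 - z 1 * d 0)]
  have hwn : κ * dot (-(q • d)) n = q * (-dot z d - q) := by
    simp only [dot_eq, PiLp.neg_apply, PiLp.smul_apply, smul_eq_mul]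
    linear_combination q * d 0 * c0 + q * d 1 * c1 + q ^ 2 * hd2
  have hDn : κ * dot z n = ‖z‖ ^ 2 - q * (-dot z d) := by
    rw [hnz]
    simp only [dot_eq]
    linear_combination - z 0 * c0 - z 1 * c1
  have hprod : 0 < q * (-dot z d - q) := by rw [← hwn]; positivity
  have hq0 : 0 < q := by
    by_contra hcon
    push Not at hcon
    nlinarith
  have hqm : q < -dot z d := by
    have := (mul_pos_iff_of_pos_left hq0).1 hprod
    linarith
  have hc : G.soundSpeed ρd ^ 2 = G.soundSpeed ρu ^ 2 + (G.γ - 1) * (‖z‖ ^ 2 - q ^ 2) / 2 := by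
    rw [hnq, G.enthalpy_eq hu, G.enthalpy_eq h.density_pos] at hb
    field_simp at hb
    linarith
  refine ⟨hq0, hqm, ?_, hc⟩
  rw [polar_eq_zero_iff hg hC hZ hq0 hqm, ← hc, G.soundSpeed_sq_eq hu h.density_pos,
    mul_div_cancel_left₀ _ hC.ne', ← Real.rpow_mul (by linarith), mul_one_div_cancel hg.ne',
    Real.rpow_one, ← hDn, ← hwn]
  field_simp
  linear_combination hmass

/-- A zero of the polar gives a shock. -/
theorem exists_isShock_of_polar {G : Gas} {z d : Plane} {ρu q : ℝ} (hu : 0 < ρu)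
    (hd : ‖d‖ = 1) (h0 : 0 < q) (hq : q < -dot z d)
    (h : polar (G.γ - 1) (G.soundSpeed ρu ^ 2) (‖z‖ ^ 2) (-dot z d) q = 0) :
    ∃ n ρd, IsShock G n ρu z ρd (-(q • d)) ∧
      G.soundSpeed ρd ^ 2 = G.soundSpeed ρu ^ 2 + (G.γ - 1) * (‖z‖ ^ 2 - q ^ 2) / 2 := by
  have hg : 0 < G.γ - 1 := by linarith [G.one_lt_γ]
  have hC : 0 < G.soundSpeed ρu ^ 2 := by have := G.soundSpeed_pos hu; positivity
  have hd2 := norm_sq_eq d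
  rw [hd] at hd2
  have hnz := norm_sq_eq z
  have hZ : (-dot z d) ^ 2 ≤ ‖z‖ ^ 2 := by
    rw [hnz, dot_eq]
    nlinarith [sq_nonneg (z 0 * d 1 - z 1 * d 0)]
  obtain ⟨h1, h2⟩ := polar_pos_aux hg hC hZ h0 hq
  rw [polar_eq_zero_iff hg hC hZ h0 hq] at h
  -- The density ratio is read off from Bernoulli's law, and the vanishing of the polar then is
  -- conservation of mass. The normal has to be parallel to the jump `y` below.
  set R := ((G.soundSpeed ρu ^ 2 + (G.γ - 1) * (‖z‖ ^ 2 - q ^ 2) / 2) /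
    G.soundSpeed ρu ^ 2) ^ (1 / (G.γ - 1)) with hRdef
  have hR0 : 0 < R := by positivity
  have hRg : G.soundSpeed ρu ^ 2 * R ^ (G.γ - 1) =
      G.soundSpeed ρu ^ 2 + (G.γ - 1) * (‖z‖ ^ 2 - q ^ 2) / 2 := by
    rw [hRdef, ← Real.rpow_mul (by positivity), one_div_mul_cancel hg.ne', Real.rpow_one,
      mul_div_cancel₀ _ hC.ne']
  have hRu : 0 < R * ρu := by positivity
  have hc : G.soundSpeed (R * ρu) ^ 2 =
      G.soundSpeed ρu ^ 2 + (G.γ - 1) * (‖z‖ ^ 2 - q ^ 2) / 2 := by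
    rw [G.soundSpeed_sq_eq hu hRu, mul_div_assoc, div_self hu.ne', mul_one, hRg]
  set y := z + q • d with hy
  have hy2 : ‖y‖ ^ 2 = ‖z‖ ^ 2 - 2 * q * (-dot z d) + q ^ 2 := by
    rw [norm_sq_eq, hnz, hy, dot_eq]
    simp only [PiLp.add_apply, PiLp.smul_apply, smul_eq_mul]
    linear_combination -q ^ 2 * hd2
  have hypos : 0 < ‖y‖ := by
    have : 0 < ‖y‖ ^ 2 := by nlinarith
    exact lt_of_le_of_ne (norm_nonneg _) (by rintro h; rw [← h] at this; simp at this)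
  have hDn : dot z (‖y‖⁻¹ • y) = ‖y‖⁻¹ * (‖z‖ ^ 2 - q * (-dot z d)) := by
    rw [hnz, hy]
    simp only [dot_eq, PiLp.add_apply, PiLp.smul_apply, smul_eq_mul]
    ring
  have hwn : dot (-(q • d)) (‖y‖⁻¹ • y) = ‖y‖⁻¹ * (q * (-dot z d - q)) := by
    rw [hy]
    simp only [dot_eq, PiLp.add_apply, PiLp.smul_apply, PiLp.neg_apply, smul_eq_mul]
    linear_combination ‖z + q • d‖⁻¹ * q ^ 2 * hd2
  refine ⟨‖y‖⁻¹ • y, R * ρu, ⟨?_, hRu, ?_, ?_, ?_, ?_, ?_⟩, hc⟩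
  · rw [norm_smul, norm_inv, norm_norm, inv_mul_cancel₀ hypos.ne']
  · rw [hDn]; positivity
  · rw [hDn, hwn]
    have : q * (-dot z d - q) < ‖z‖ ^ 2 - q * (-dot z d) := by nlinarith
    gcongr
  · rw [hDn, hwn, h]
    ring
  · rw [hy]
    simp only [dot_eq, PiLp.add_apply, PiLp.smul_apply, PiLp.neg_apply, smul_eq_mul, rot_zero,
      rot_one]
    ring
  · have hnq : ‖-(q • d)‖ ^ 2 = q ^ 2 := by
      rw [norm_neg, norm_smul, hd, mul_one, Real.norm_eq_abs, sq_abs]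
    rw [hnq, G.enthalpy_eq hu, G.enthalpy_eq hRu, hc]
    field_simp
    ring

/-! ## Rotations -/

/-- Counterclockwise rotation by the angle `δ`. -/
def rotate (δ : ℝ) (a : Plane) : Plane :=
  !₂[Real.cos δ * a 0 - Real.sin δ * a 1, Real.sin δ * a 0 + Real.cos δ * a 1]

@[simp] theorem rotate_apply_zero (δ : ℝ) (a : Plane) :
    rotate δ a 0 = Real.cos δ * a 0 - Real.sin δ * a 1 := rfl

@[simp] theorem rotate_apply_one (δ : ℝ) (a : Plane) :
    rotate δ a 1 = Real.sin δ * a 0 + Real.cos δ * a 1 := rfl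

theorem dot_rotate (δ : ℝ) (a b : Plane) : dot (rotate δ a) (rotate δ b) = dot a b := by
  rw [dot_eq, dot_eq]
  simp only [rotate_apply_zero, rotate_apply_one]
  linear_combination (a 0 * b 0 + a 1 * b 1) * Real.sin_sq_add_cos_sq δ

theorem norm_rotate (δ : ℝ) (a : Plane) : ‖rotate δ a‖ = ‖a‖ := by
  have h : ‖rotate δ a‖ ^ 2 = ‖a‖ ^ 2 := by
    rw [norm_sq_eq, norm_sq_eq, rotate_apply_zero, rotate_apply_one]
    linear_combination (a 0 ^ 2 + a 1 ^ 2) * Real.sin_sq_add_cos_sq δ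
  exact (pow_left_inj₀ (norm_nonneg _) (norm_nonneg _) two_ne_zero).1 h

theorem rotate_rot (δ : ℝ) (a : Plane) : rotate δ (rot a) = rot (rotate δ a) := by
  apply plane_ext <;> simp <;> ring

theorem rotate_sub (δ : ℝ) (a b : Plane) : rotate δ (a - b) = rotate δ a - rotate δ b := by
  apply plane_ext <;> simp <;> ring

theorem rotate_smul (δ t : ℝ) (a : Plane) : rotate δ (t • a) = t • rotate δ a := by
  apply plane_ext <;> simp <;> ring

theorem rotate_zero_left (a : Plane) : rotate 0 a = a := by
  apply plane_ext <;> simp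

theorem IsShock.rotate {G : Gas} {n zu zd : Plane} {ρu ρd : ℝ} (h : IsShock G n ρu zu ρd zd)
    (δ : ℝ) : IsShock G (rotate δ n) ρu (rotate δ zu) ρd (rotate δ zd) := by
  obtain ⟨h1, h2, h3, h4, h5, h6, h7⟩ := h
  refine ⟨?_, h2, ?_, ?_, ?_, ?_, ?_⟩
  · rwa [norm_rotate]
  · rwa [dot_rotate]
  · rwa [dot_rotate, dot_rotate]
  · rwa [dot_rotate, dot_rotate]
  · rwa [← rotate_rot, dot_rotate, dot_rotate]
  · rwa [norm_rotate, norm_rotate]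

namespace Params

variable (p : Params) (δ : ℝ)

@[simp] theorem wallDir_zero : p.wallDir 0 = Real.cos p.θ := rfl
@[simp] theorem wallDir_one : p.wallDir 1 = Real.sin p.θ := rfl
@[simp] theorem wallNormal_zero : p.wallNormal 0 = -Real.sin p.θ := rfl
@[simp] theorem wallNormal_one : p.wallNormal 1 = Real.cos p.θ := rfl
@[simp] theorem incidentNormal_zero : p.incidentNormal 0 = -Real.sin p.α := rfl
@[simp] theorem incidentNormal_one : p.incidentNormal 1 = -Real.cos p.α := rfl

theorem norm_wallDir : ‖p.wallDir‖ = 1 := by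
  have h : ‖p.wallDir‖ ^ 2 = 1 := by
    rw [norm_sq_eq, wallDir_zero, wallDir_one, add_comm, Real.sin_sq_add_cos_sq]
  nlinarith [norm_nonneg p.wallDir]

theorem dot_wallDir_wallNormal : dot p.wallDir p.wallNormal = 0 := by
  simp [dot_eq]
  ring

/-- Since `α` decreases as `θ` increases, the reflection wall and the incident shock turn by the
same angle `δ`; this and the two lemmas below make the perturbation a rigid rotation at the
reflection point. -/
theorem wallDir_perturb : (p.perturb δ).wallDir = rotate δ p.wallDir := by
  apply plane_ext <;> simp [perturb, Real.cos_add, Real.sin_add] <;> ring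

theorem wallNormal_perturb : (p.perturb δ).wallNormal = rotate δ p.wallNormal := by
  apply plane_ext <;> simp [perturb, Real.cos_add, Real.sin_add] <;> ring

theorem incidentNormal_perturb : (p.perturb δ).incidentNormal = rotate δ p.incidentNormal := by
  apply plane_ext <;> simp [perturb, Real.cos_sub, Real.sin_sub] <;> ring

theorem perturb_zero : p.perturb 0 = p := by
  simp [perturb]

/-- A vector perpendicular to the wall normal is parallel to the wall. -/
theorem eq_smul_wallDir {a : Plane} (h : dot a p.wallNormal = 0) :
    a = dot a p.wallDir • p.wallDir := by
  have hr : p.wallNormal = rot p.wallDir := by apply plane_ext <;> simp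
  rw [hr] at h
  conv_lhs => rw [eq_dot_smul_add p.norm_wallDir a, h, zero_smul, add_zero]

end Params

/-! ## The incident shock -/

namespace IsIncident

variable {G : Gas} {ρ₁ : ℝ} {p : Params} {I : Incident}

theorem sin_pos (h : IsIncident G ρ₁ p I) : 0 < Real.sin p.θ :=
  Real.sin_pos_of_pos_of_lt_pi h.θ_pos (by linarith [h.α_nonneg, h.sum_lt_pi])

theorem ρ₂_pos (h : IsIncident G ρ₁ p I) : 0 < I.ρ₂ := h.shock.density_pos

theorem dot_ξR (h : IsIncident G ρ₁ p I) : dot I.ξR p.wallNormal = 0 := by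
  obtain ⟨r, -, hr⟩ := h.ξR_mem
  have := p.dot_wallDir_wallNormal
  rw [hr]
  simp only [dot_eq, PiLp.smul_apply, smul_eq_mul] at this ⊢
  linear_combination r * this

theorem ξR_one (h : IsIncident G ρ₁ p I) : I.ξR 1 = -(I.v₂ - I.ξR) 1 := by
  simp [h.v₂_slip]

theorem ξR_one_pos (h : IsIncident G ρ₁ p I) : 0 < I.ξR 1 := by
  obtain ⟨r, hr0, hr⟩ := h.ξR_mem
  have := h.sin_pos
  rw [hr]
  simp only [PiLp.smul_apply, smul_eq_mul, Params.wallDir_one]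
  positivity

theorem ξR_eq_norm_smul (h : IsIncident G ρ₁ p I) : I.ξR = ‖I.ξR‖ • p.wallDir := by
  obtain ⟨r, hr0, hr⟩ := h.ξR_mem
  have : ‖I.ξR‖ = r := by
    rw [hr, norm_smul, p.norm_wallDir, mul_one, Real.norm_eq_abs, abs_of_pos hr0]
  rw [this]
  exact hr

/-- The gas behind the incident shock moves towards the corner. -/
theorem v₂_zero_pos (h : IsIncident G ρ₁ p I) : 0 < I.v₂ 0 := by
  have hsub := h.shock.sub_eq
  have hlt := h.shock.compressive
  set κ := dot (I.v₁ - I.ξR) p.incidentNormal - dot (I.v₂ - I.ξR) p.incidentNormal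
  have hκ : 0 < κ := by simp only [κ]; linarith
  rw [h.v₁_eq] at hsub
  have e0 := congrArg (fun a : Plane => a 0) hsub
  have e1 := congrArg (fun a : Plane => a 1) hsub
  have eξ := h.dot_ξR
  simp only [dot_eq, PiLp.sub_apply, PiLp.smul_apply, smul_eq_mul, Params.wallDir_zero,
    Params.wallDir_one, Params.incidentNormal_zero, Params.incidentNormal_one, h.v₂_slip,
    Params.wallNormal_zero, Params.wallNormal_one] at e0 e1 eξ
  have hc : Real.cos (p.α + p.θ) < 0 :=
    Real.cos_neg_of_pi_div_two_lt_of_lt h.acute (by linarith [h.sum_lt_pi, Real.pi_pos])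
  -- Component of the velocity jump across the incident shock along the normal of the reflection
  -- wall, where `v₁` does not contribute.
  have key : I.v₂ 0 * Real.sin p.θ = κ * -Real.cos (p.α + p.θ) := by
    rw [Real.cos_add]
    linear_combination (-Real.sin p.θ) * e0 + Real.cos p.θ * e1 - eξ
  have hpos : 0 < I.v₂ 0 * Real.sin p.θ := by
    rw [key]
    have : 0 < -Real.cos (p.α + p.θ) := by linarith
    positivity
  exact (mul_pos_iff_of_pos_right h.sin_pos).1 hpos

/-- The angles enter the upstream normal speed only through `α + θ`, which `Params.perturb`
preserves; therefore the strength of the incident shock does not change. -/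
theorem dot_v₁ (h : IsIncident G ρ₁ p I) : dot (I.v₁ - I.ξR) p.incidentNormal =
    p.M₁ * G.soundSpeed ρ₁ * Real.sin (p.α + p.θ) := by
  rw [h.v₁_eq, Real.sin_add, dot_eq]
  simp
  ring

/-- Rotation of the walls leaves the flow near the reflection point unchanged, up to rotation. -/
theorem perturb_eq {J : Incident} {δ : ℝ} (hρ₁ : 0 < ρ₁) (h : IsIncident G ρ₁ p I)
    (hJ : IsIncident G ρ₁ (p.perturb δ) J) :
    J.ρ₂ = I.ρ₂ ∧ J.v₂ - J.ξR = rotate δ (I.v₂ - I.ξR) := by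
  have e : dot (I.v₁ - I.ξR) p.incidentNormal =
      dot (J.v₁ - J.ξR) (p.perturb δ).incidentNormal := by
    rw [h.dot_v₁, hJ.dot_v₁]
    simp only [Params.perturb]
    congr 2
    ring
  obtain ⟨e1, e2⟩ := h.shock.unique hρ₁ hJ.shock e
  refine ⟨e1.symm, ?_⟩
  have s1 := h.shock.sub_eq
  have s2 := hJ.shock.sub_eq
  rw [← e, ← e2, p.incidentNormal_perturb, ← rotate_smul, ← s1, rotate_sub, hJ.v₁_eq, h.v₁_eq,
    p.wallDir_perturb, rotate_smul] at s2
  exact sub_right_injective s2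

theorem unique {J : Incident} (hρ₁ : 0 < ρ₁) (h : IsIncident G ρ₁ p I)
    (hJ : IsIncident G ρ₁ p J) : J = I := by
  have hJ' : IsIncident G ρ₁ (p.perturb 0) J := by rwa [p.perturb_zero]
  obtain ⟨e1, e2⟩ := h.perturb_eq hρ₁ hJ'
  rw [rotate_zero_left] at e2
  -- Slip of `v₂` at the opposite wall fixes the height of the reflection point, and with `sin θ ≠
  -- 0` its position on the wall.
  have e3 : J.ξR = I.ξR := by
    obtain ⟨r, -, hr⟩ := h.ξR_mem
    obtain ⟨r', -, hr'⟩ := hJ.ξR_mem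
    have h1 := h.ξR_one
    have h2 := hJ.ξR_one
    rw [e2, ← h1, hr, hr'] at h2
    simp only [PiLp.smul_apply, smul_eq_mul, Params.wallDir_one] at h2
    rw [hr, hr', mul_right_cancel₀ h.sin_pos.ne' h2]
  have e4 : J.v₂ = I.v₂ := by rw [e3] at e2; exact sub_left_injective e2
  have e5 : J.v₁ = I.v₁ := by
    have h1 := hJ.v₁_eq
    rw [← h.v₁_eq, e3] at h1
    exact sub_left_injective h1
  cases I
  cases J
  simp_all

/-- The rotated flow near the reflection point is kept, and the reflection point is placed on the
new wall at the height that makes `v₂` horizontal. The hypothesis `hpos` says that this height is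
positive. -/
theorem exists_perturb {δ : ℝ} (h : IsIncident G ρ₁ p I) (h0 : 0 ≤ δ) (hα : δ ≤ p.α)
    (hpos : rotate δ (I.v₂ - I.ξR) 1 < 0) : ∃ J, IsIncident G ρ₁ (p.perturb δ) J := by
  have hs : 0 < Real.sin (p.θ + δ) :=
    Real.sin_pos_of_pos_of_lt_pi (by linarith [h.θ_pos]) (by linarith [h.sum_lt_pi])
  have hsum : (p.perturb δ).α + (p.perturb δ).θ = p.α + p.θ := by
    simp only [Params.perturb]
    ring
  set r := -(rotate δ (I.v₂ - I.ξR) 1) / Real.sin (p.θ + δ) with hr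
  have hr0 : 0 < r := div_pos (by linarith) hs
  set w := r • (p.perturb δ).wallDir with hw
  refine ⟨⟨w, w + rotate δ (I.v₁ - I.ξR), I.ρ₂, w + rotate δ (I.v₂ - I.ξR)⟩,
    ⟨?_, ?_, ?_, ?_, ⟨r, hr0, rfl⟩, ?_, ?_, ?_⟩⟩
  · simp only [Params.perturb]; linarith
  · simp only [Params.perturb]; linarith [h.θ_pos]
  · rw [hsum]; exact h.acute
  · rw [hsum]; exact h.sum_lt_pi
  · simp only
    rw [add_sub_cancel_left, h.v₁_eq, rotate_smul, p.wallDir_perturb]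
    rfl
  · have : (p.perturb δ).θ = p.θ + δ := rfl
    simp only [PiLp.add_apply, hw, PiLp.smul_apply, Params.wallDir_one, smul_eq_mul, this]
    rw [hr, div_mul_cancel₀ _ hs.ne']
    ring
  · simp only [add_sub_cancel_left]
    rw [p.incidentNormal_perturb]
    exact h.shock.rotate δ

end IsIncident

/-! ## The reflected shock at the reflection point -/

section reflected

variable {G : Gas} {ρ₁ : ℝ} {p : Params} {I J : Incident}

theorem IsReflected.dot_eq_zero {n v₃ : Plane} {ρ₃ : ℝ} (hI : IsIncident G ρ₁ p I)
    (h : IsReflected G p I n ρ₃ v₃) : dot (v₃ - I.ξR) p.wallNormal = 0 := by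
  have h1 := h.slip
  have h2 := hI.dot_ξR
  simp only [dot_eq, PiLp.sub_apply] at *
  linarith

/-- Local reflected shocks rotate with the walls. -/
theorem IsReflected.perturb {n v₃ : Plane} {ρ₃ δ : ℝ} (hρ₁ : 0 < ρ₁) (hI : IsIncident G ρ₁ p I)
    (hJ : IsIncident G ρ₁ (p.perturb δ) J) (h : IsReflected G p I n ρ₃ v₃) :
    IsReflected G (p.perturb δ) J (rotate δ n) ρ₃ (J.ξR + rotate δ (v₃ - I.ξR)) := by
  obtain ⟨e1, e2⟩ := hI.perturb_eq hρ₁ hJ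
  refine ⟨?_, ?_⟩
  · rw [e1, e2, add_sub_cancel_left]
    exact h.shock.rotate δ
  · have h1 := hJ.dot_ξR
    have h2 : dot (rotate δ (v₃ - I.ξR)) (p.perturb δ).wallNormal = 0 := by
      rw [p.wallNormal_perturb, dot_rotate]
      exact h.dot_eq_zero hI
    simp only [dot_eq, PiLp.add_apply] at *
    linarith

theorem IsWeakType.perturb {n v₃ : Plane} {ρ₃ δ : ℝ} (hρ₁ : 0 < ρ₁) (hI : IsIncident G ρ₁ p I)
    (hJ : IsIncident G ρ₁ (p.perturb δ) J) (h : IsWeakType G p I n ρ₃ v₃) :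
    IsWeakType G (p.perturb δ) J (rotate δ n) ρ₃ (J.ξR + rotate δ (v₃ - I.ξR)) := by
  obtain ⟨h1, n', ρ', v', h2, h3⟩ := h
  refine ⟨h1.perturb hρ₁ hI hJ, _, _, _, h2.perturb hρ₁ hI hJ, ?_⟩
  rwa [add_sub_cancel_left, add_sub_cancel_left, norm_rotate, norm_rotate]

theorem IsStrongType.perturb {n v₃ : Plane} {ρ₃ δ : ℝ} (hρ₁ : 0 < ρ₁) (hI : IsIncident G ρ₁ p I)
    (hJ : IsIncident G ρ₁ (p.perturb δ) J) (h : IsStrongType G p I n ρ₃ v₃) :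
    IsStrongType G (p.perturb δ) J (rotate δ n) ρ₃ (J.ξR + rotate δ (v₃ - I.ξR)) := by
  obtain ⟨h1, n', ρ', v', h2, h3⟩ := h
  refine ⟨h1.perturb hρ₁ hI hJ, _, _, _, h2.perturb hρ₁ hI hJ, ?_⟩
  rwa [add_sub_cancel_left, add_sub_cancel_left, norm_rotate, norm_rotate]

end reflected

/-! ## Strong-type reflection with gas at rest behind the reflected shock -/

/-- The reflection point is `(-a, h)`, the gas of the 2-sector moves with pseudo-velocity `(D, -h)`
there, and the gas behind the vertical reflected shock, of density ratio `R`, is at rest. The last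
condition says that the reflected shock is of strong type. -/
structure RestingReflection (G : Gas) (I : Incident) (D h a R : ℝ) : Prop where
  z_zero : (I.v₂ - I.ξR) 0 = D
  z_one : (I.v₂ - I.ξR) 1 = -h
  ξR_zero : I.ξR 0 = -a
  ξR_one : I.ξR 1 = h
  h_pos : 0 < h
  a_pos : 0 < a
  one_lt_R : 1 < R
  D_eq : D = R * a
  a_sq : a ^ 2 = G.soundSpeed I.ρ₂ ^ 2 * downstreamSq (G.γ - 1) R
  strong : h ^ 2 * (G.soundSpeed I.ρ₂ ^ 2 * R ^ (G.γ - 1) + a * D) <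
    a * D * (G.soundSpeed I.ρ₂ ^ 2 * R ^ (G.γ - 1) - a ^ 2)

variable {G : Gas} {ρ₁ : ℝ} {p : Params} {I : Incident}

theorem IsReflected.exists_polar {n v₃ : Plane} {ρ₃ : ℝ} (hI : IsIncident G ρ₁ p I)
    (hm : 0 < -dot (I.v₂ - I.ξR) p.wallDir) (h : IsReflected G p I n ρ₃ v₃) :
    ∃ q, v₃ - I.ξR = -(q • p.wallDir) ∧ ‖v₃ - I.ξR‖ = q ∧ 0 < q ∧
      q < -dot (I.v₂ - I.ξR) p.wallDir ∧
      polar (G.γ - 1) (G.soundSpeed I.ρ₂ ^ 2) (‖I.v₂ - I.ξR‖ ^ 2)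
        (-dot (I.v₂ - I.ξR) p.wallDir) q = 0 ∧
      G.soundSpeed ρ₃ ^ 2 =
        G.soundSpeed I.ρ₂ ^ 2 + (G.γ - 1) * (‖I.v₂ - I.ξR‖ ^ 2 - q ^ 2) / 2 := by
  have e := p.eq_smul_wallDir (h.dot_eq_zero hI)
  set q := -dot (v₃ - I.ξR) p.wallDir with hq
  have e' : v₃ - I.ξR = -(q • p.wallDir) := by
    conv_lhs => rw [e]
    rw [hq, neg_smul, neg_neg]
  have hs := h.shock
  rw [e'] at hs
  obtain ⟨h1, h2, h3, h4⟩ := hs.polar_eq_zero hI.ρ₂_pos p.norm_wallDir hm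
  refine ⟨q, e', ?_, h1, h2, h3, h4⟩
  rw [e', norm_neg, norm_smul, p.norm_wallDir, mul_one, Real.norm_eq_abs, abs_of_pos h1]

theorem polar_sq_le (z : Plane) {d : Plane} (hd : ‖d‖ = 1) : (-dot z d) ^ 2 ≤ ‖z‖ ^ 2 := by
  have hd2 := norm_sq_eq d
  rw [hd] at hd2
  rw [norm_sq_eq, dot_eq]
  nlinarith [sq_nonneg (z 0 * d 1 - z 1 * d 0)]

/-- The slope of the polar at the resting state, in terms of coordinates. -/
theorem polarDeriv_resting {g C D h a r c : ℝ} (ha : 0 < a) (haD : a < D)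
    (hr : 0 < r) (hr2 : r ^ 2 = a ^ 2 + h ^ 2) (hc : 0 < c)
    (hce : C + g * (D ^ 2 + h ^ 2 - r ^ 2) / 2 = c) :
    polarDeriv g C (D ^ 2 + h ^ 2) ((D * a + h ^ 2) / r) r * (a * D * c * r) =
      h ^ 2 * (c + a * D) - a * D * (c - a ^ 2) := by
  have hD : 0 < D := ha.trans haD
  have hv : D - a ≠ 0 := by linarith
  have e1 : D ^ 2 + h ^ 2 - r * ((D * a + h ^ 2) / r) = D * (D - a) := by
    field_simp
    ring
  have e2 : (D * a + h ^ 2) / r - r = a * (D - a) / r := by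
    field_simp
    rw [hr2]
    ring
  rw [polarDeriv, e1, e2, hce]
  field_simp
  rw [hr2]
  ring

/-- In terms of coordinates, the polar has negative slope at the resting state if and only if the
reflected shock is of strong type. -/
theorem polarDeriv_neg_iff {g C D h a r c : ℝ} (ha : 0 < a) (haD : a < D)
    (hr : 0 < r) (hr2 : r ^ 2 = a ^ 2 + h ^ 2) (hc : 0 < c)
    (hce : C + g * (D ^ 2 + h ^ 2 - r ^ 2) / 2 = c) :
    polarDeriv g C (D ^ 2 + h ^ 2) ((D * a + h ^ 2) / r) r < 0 ↔
      h ^ 2 * (c + a * D) < a * D * (c - a ^ 2) := by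
  have hD : 0 < D := ha.trans haD
  have hp : 0 < a * D * c * r := by positivity
  rw [← sub_neg (a := h ^ 2 * _), ← polarDeriv_resting ha haD hr hr2 hc hce]
  exact ⟨fun h1 => mul_neg_of_neg_of_pos h1 hp,
    fun h1 => by_contra fun h2 => h1.not_ge (mul_nonneg (not_lt.1 h2) hp.le)⟩

/-- Local analysis of a strong-type reflection with gas at rest behind the reflected shock. -/
theorem IsStrongType.restingReflection {n : Plane} {ρ₃ : ℝ} (hρ₁ : 0 < ρ₁)
    (hI : IsIncident G ρ₁ p I) (h : IsStrongType G p I n ρ₃ 0) :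
    n = !₂[1, 0] ∧ (∃ D h a R, RestingReflection G I D h a R) ∧
    ∀ δ J n' ρ' v', IsIncident G ρ₁ (p.perturb δ) J → IsReflected G (p.perturb δ) J n' ρ' v' →
      ∃ q, ‖I.ξR‖ ≤ q ∧ v' - J.ξR = -(q • (p.perturb δ).wallDir) := by
  obtain ⟨hr, n₁, ρ', v', hr', hlt⟩ := h
  have hg : 0 < G.γ - 1 := by linarith [G.one_lt_γ]
  have hc2 := G.soundSpeed_pos hI.ρ₂_pos
  have hC : 0 < G.soundSpeed I.ρ₂ ^ 2 := by positivity
  have hv := hI.v₂_zero_pos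
  have hrn := hI.ξR_eq_norm_smul
  have hh := hI.ξR_one_pos
  have hr0 : 0 < ‖I.ξR‖ := norm_pos_iff.2 (by rintro h0; simp [h0] at hh)
  have hsub := hr.shock.sub_eq
  have hlt1 := hr.shock.compressive
  obtain ⟨hR, hw, hD, hw2⟩ := hr.shock.normal_speeds hI.ρ₂_pos
  set κ := dot (I.v₂ - I.ξR) n - dot (0 - I.ξR) n with hκ
  have hκ0 : 0 < κ := by rw [hκ]; linarith
  have e0 := congrArg (fun a : Plane => a 0) hsub
  have e1 := congrArg (fun a : Plane => a 1) hsub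
  simp only [PiLp.sub_apply, PiLp.smul_apply, PiLp.zero_apply, smul_eq_mul, hI.v₂_slip] at e0 e1
  -- The velocities `v₂` and `0` on the two sides are both horizontal, hence so is the normal.
  have hn1 : n 1 = 0 := by
    have : κ * n 1 = 0 := by linarith
    exact (mul_eq_zero.1 this).resolve_left hκ0.ne'
  have hn0 : n 0 = 1 := by
    have h1 := norm_sq_eq n
    rw [hr.shock.unit, hn1] at h1
    have h2 : 0 < n 0 := by
      have : 0 < κ * n 0 := by linarith
      exact (mul_pos_iff_of_pos_left hκ0).1 this
    nlinarith
  have hn : n = !₂[1, 0] := plane_ext (by simp [hn0]) (by simp [hn1])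
  have hw' : dot (0 - I.ξR) n = -(I.ξR 0) := by simp [hn, dot_eq]
  have hD' : dot (I.v₂ - I.ξR) n = (I.v₂ - I.ξR) 0 := by simp [hn, dot_eq]
  rw [hw'] at hw hw2 hD
  rw [hD'] at hD
  set a := -(I.ξR 0) with ha
  set D := (I.v₂ - I.ξR) 0 with hDdef
  set R := ρ₃ / I.ρ₂ with hRdef
  have haD : a < D := by rw [hD]; nlinarith
  have hξ0 : I.ξR 0 = ‖I.ξR‖ * Real.cos p.θ := by
    conv_lhs => rw [hrn]
    simp
  have hξ1 : I.ξR 1 = ‖I.ξR‖ * Real.sin p.θ := by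
    conv_lhs => rw [hrn]
    simp
  have hz1 : (I.v₂ - I.ξR) 1 = -(I.ξR 1) := by simp [hI.v₂_slip]
  have hr2 : ‖I.ξR‖ ^ 2 = a ^ 2 + I.ξR 1 ^ 2 := by rw [norm_sq_eq, ha]; ring
  have hmeq : -dot (I.v₂ - I.ξR) p.wallDir = (D * a + I.ξR 1 ^ 2) / ‖I.ξR‖ := by
    rw [eq_div_iff hr0.ne', dot_eq, hz1, Params.wallDir_zero, Params.wallDir_one, ← hDdef]
    linear_combination D * hξ0 - I.ξR 1 * hξ1 + D * ha
  have hZeq : ‖I.v₂ - I.ξR‖ ^ 2 = D ^ 2 + I.ξR 1 ^ 2 := by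
    rw [norm_sq_eq, hz1]
    ring
  have hm : 0 < -dot (I.v₂ - I.ξR) p.wallDir := by
    rw [hmeq]
    have : 0 < D := by linarith
    positivity
  have hZ := polar_sq_le (I.v₂ - I.ξR) p.norm_wallDir
  obtain ⟨q, -, hqn, hq0, hqm, hq, hqc⟩ := hr.exists_polar hI hm
  obtain ⟨q', -, hqn', hq0', hqm', hq', -⟩ := hr'.exists_polar hI hm
  rw [zero_sub, norm_neg] at hqn
  rw [hqn', zero_sub, norm_neg] at hlt
  rw [← hqn] at hq hqc
  have hρ₃ := hr.shock.density_pos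
  have hcR := G.soundSpeed_sq_eq hI.ρ₂_pos hρ₃
  rw [← hRdef] at hcR
  refine ⟨hn, ⟨D, I.ξR 1, a, R, ⟨rfl, hz1, by rw [ha, neg_neg], rfl, hh, hw, hR, hD, hw2, ?_⟩⟩, ?_⟩
  · have hneg := polarDeriv_neg_of_lt hg hC hZ hr0 hlt hqm' (hq.trans hq'.symm)
    rw [hmeq, hZeq] at hneg
    have hc3 : 0 < G.soundSpeed I.ρ₂ ^ 2 * R ^ (G.γ - 1) := by
      rw [← hcR]
      have := G.soundSpeed_pos hρ₃
      positivity
    rw [hcR, hZeq] at hqc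
    exact (polarDeriv_neg_iff hw haD hr0 hr2 hc3 hqc.symm).1 hneg
  · intro δ J n' ρ' v' hJ hrJ
    obtain ⟨f1, f2⟩ := hI.perturb_eq hρ₁ hJ
    have f3 : -dot (J.v₂ - J.ξR) (p.perturb δ).wallDir = -dot (I.v₂ - I.ξR) p.wallDir := by
      rw [f2, p.wallDir_perturb, dot_rotate]
    obtain ⟨x, hx, -, hx0, -, hxz, -⟩ := hrJ.exists_polar hJ (by rwa [f3])
    rw [f3, f1, f2, norm_rotate] at hxz
    -- Rotation does not change the polar, and `‖I.ξR‖` is its smaller zero.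
    exact ⟨x, polar_le_of_eq hg hC hZ hx0 hlt hqm' (hq.trans hq'.symm) (hxz.trans hq.symm), hx⟩

/-! ## Small rotations of the walls -/

theorem hasDerivAt_downstreamSq {g R : ℝ} (hR : 1 < R) :
    HasDerivAt (downstreamSq g) (2 / g * ((g * R ^ (g - 1) * (R ^ 2 - 1) -
      (R ^ g - 1) * (2 * R)) / (R ^ 2 - 1) ^ 2)) R := by
  have h2 : R ^ 2 - 1 ≠ 0 := by nlinarith
  have d1 : HasDerivAt (fun x : ℝ => x ^ g - 1) (g * R ^ (g - 1)) R :=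
    (Real.hasDerivAt_rpow_const (Or.inl (by linarith))).sub_const 1
  have d2 : HasDerivAt (fun x : ℝ => x ^ 2 - 1) (2 * R) R := by
    simpa using (hasDerivAt_pow 2 R).sub_const 1
  exact (d1.fun_div d2 h2).const_mul (2 / g)

/-- Written in terms of `R ^ g` and `downstreamSq`, so that the strong-type inequality is
recognizable when this derivative is compared with that of `hasDerivAt_strengthSq`. -/
theorem hasDerivAt_upstreamSq {g R : ℝ} (hg : 0 < g) (hR : 1 < R) :
    HasDerivAt (fun x => x ^ 2 * downstreamSq g x)
      (2 * R * (R ^ g - downstreamSq g R) / (R ^ 2 - 1)) R := by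
  have h2 : R ^ 2 - 1 ≠ 0 := by nlinarith
  have hR0 : R ≠ 0 := by linarith
  have d := (hasDerivAt_pow 2 R).fun_mul (hasDerivAt_downstreamSq (g := g) hR)
  refine d.congr_deriv ?_
  rw [Real.rpow_sub_one hR0, downstreamSq]
  field_simp
  push_cast
  ring

theorem hasDerivAt_strengthSq {g R : ℝ} (hg : 0 < g) (hR : 1 < R) :
    HasDerivAt (fun x => (x - 1) ^ 2 * downstreamSq g x)
      (2 * (R ^ g + R * downstreamSq g R) * (R - 1) / (R * (R + 1))) R := by
  have h2 : R ^ 2 - 1 = (R - 1) * (R + 1) := by ring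
  have h3 : R - 1 ≠ 0 := by linarith
  have h4 : R + 1 ≠ 0 := by linarith
  have hR0 : R ≠ 0 := by linarith
  have d := (((hasDerivAt_id R).sub_const 1).fun_pow 2).fun_mul
    (hasDerivAt_downstreamSq (g := g) hR)
  refine d.congr_deriv ?_
  simp only [id]
  rw [Real.rpow_sub_one hR0, downstreamSq, h2]
  field_simp
  push_cast
  ring

theorem eventually_pos_of_hasDerivAt {f : ℝ → ℝ} {f' : ℝ} (hf : HasDerivAt f f' 0) (h0 : f 0 = 0)
    (hpos : 0 < f') : ∀ᶠ x in 𝓝[>] (0 : ℝ), 0 < f x := by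
  have hs := (hasDerivAt_iff_tendsto_slope.1 hf).mono_left
    (nhdsWithin_mono 0 (fun x (hx : 0 < x) => hx.ne' : Ioi (0 : ℝ) ⊆ {0}ᶜ))
  filter_upwards [hs.eventually_const_lt hpos, self_mem_nhdsWithin] with x hx (hx' : 0 < x)
  rw [slope_def_field, h0, sub_zero, sub_zero] at hx
  exact (div_pos_iff_of_pos_right hx').1 hx

/-- A vertical shock through the reflection point or further right is too weak to stop the gas of
the 2-sector. -/
def WeakVerticalShock (G : Gas) (J : Incident) : Prop :=
  ∃ R, 1 < R ∧ (J.v₂ - J.ξR) 0 ^ 2 <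
      G.soundSpeed J.ρ₂ ^ 2 * (R ^ 2 * downstreamSq (G.γ - 1) R) ∧
    G.soundSpeed J.ρ₂ ^ 2 * ((R - 1) ^ 2 * downstreamSq (G.γ - 1) R) < J.v₂ 0 ^ 2

namespace RestingReflection

variable {G : Gas} {ρ₁ : ℝ} {p : Params} {I J : Incident} {D h a R : ℝ}

theorem a_lt_D (T : RestingReflection G I D h a R) : a < D := by
  rw [T.D_eq]
  nlinarith [T.a_pos, T.one_lt_R]

/-- For the ratio `R` at `δ = 0` both inequalities are equalities. With `R' = R + δ * l` they hold
to first order when `l` lies strictly between two bounds, and the interval between these is nonempty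
because the shock is of strong type. -/
theorem eventually_exists_ratio (T : RestingReflection G I D h a R) (hρ₂ : 0 < I.ρ₂) :
    ∀ᶠ δ in 𝓝[>] (0 : ℝ), ∃ R', 1 < R' ∧
      (D * Real.cos δ + h * Real.sin δ) ^ 2 <
        G.soundSpeed I.ρ₂ ^ 2 * (R' ^ 2 * downstreamSq (G.γ - 1) R') ∧
      G.soundSpeed I.ρ₂ ^ 2 * ((R' - 1) ^ 2 * downstreamSq (G.γ - 1) R') <
        ((D - a) * h / (h * Real.cos δ - a * Real.sin δ)) ^ 2 := by
  have hg : 0 < G.γ - 1 := by linarith [G.one_lt_γ]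
  have hC : 0 < G.soundSpeed I.ρ₂ ^ 2 := by have := G.soundSpeed_pos hρ₂; positivity
  have hs := T.strong
  have hR := T.one_lt_R
  have hh := T.h_pos
  have ha := T.a_pos
  have haω := T.a_sq
  have hDe := T.D_eq
  have d1 := hasDerivAt_upstreamSq hg hR
  have d2 := hasDerivAt_strengthSq hg hR
  have hy : 0 < R ^ (G.γ - 1) := by positivity
  have hω := downstreamSq_pos hg hR
  set C := G.soundSpeed I.ρ₂ ^ 2 with hCdef
  set g := G.γ - 1 with hgdef
  set y := R ^ g with hydef
  set ω := downstreamSq g R with hωdef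
  -- The strong-type inequality with `D` and `a ^ 2` eliminated and one factor `C` cancelled.
  have hs' : h ^ 2 * (y + R * ω) < R * a ^ 2 * (y - ω) := by
    rw [hDe] at hs
    have e1 : h ^ 2 * (C * y + a * (R * a)) = C * (h ^ 2 * (y + R * ω)) := by
      linear_combination h ^ 2 * R * haω
    have e2 : a * (R * a) * (C * y - a ^ 2) = C * (R * a ^ 2 * (y - ω)) := by
      linear_combination (-a ^ 2 * R) * haω
    rw [e1, e2] at hs
    exact lt_of_mul_lt_mul_left hs hC.le
  have hR0 : 0 < R := by linarith
  have hR1 : 0 < R - 1 := by linarith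
  have hyω : 0 < y - ω := by
    have h1 : 0 < h ^ 2 * (y + R * ω) := by positivity
    have h2 : 0 < R * a ^ 2 * (y - ω) := h1.trans hs'
    exact (mul_pos_iff_of_pos_left (by positivity)).1 h2
  -- The lower bound comes from the growth `2 * D * h` of the squared horizontal pseudo-speed at the
  -- reflection point, the upper one from the growth `2 * (D - a) ^ 2 * a / h` of the squared
  -- velocity of the 2-sector.
  obtain ⟨l, hl1, hl2⟩ : ∃ l, D * h * (R ^ 2 - 1) / (C * R * (y - ω)) < l ∧
      l < (D - a) ^ 2 * a * (R * (R + 1)) / (h * C * (y + R * ω) * (R - 1)) := by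
    apply exists_between
    rw [div_lt_div_iff₀ (by positivity) (by positivity), hDe]
    have : 0 < a * R * (R - 1) ^ 2 * (R + 1) * C := by positivity
    nlinarith
  have i := hasDerivAt_id (0 : ℝ)
  have hcos : HasDerivAt Real.cos 0 0 := by simpa using Real.hasDerivAt_cos 0
  have hsin : HasDerivAt Real.sin 1 0 := by simpa using Real.hasDerivAt_sin 0
  have hlin : HasDerivAt (fun δ => R + δ * l) l 0 := by
    simpa using (i.mul_const l).const_add R
  have c1 : HasDerivAt (fun δ => C * ((R + δ * l) ^ 2 * downstreamSq g (R + δ * l)))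
      (C * (2 * R * (y - ω) / (R ^ 2 - 1) * l)) 0 := by
    refine (HasDerivAt.comp (0 : ℝ) (h₂ := fun x => x ^ 2 * downstreamSq g x) ?_ hlin).const_mul C
    simpa using d1
  have c2 : HasDerivAt (fun δ => C * ((R + δ * l - 1) ^ 2 * downstreamSq g (R + δ * l)))
      (C * (2 * (y + R * ω) * (R - 1) / (R * (R + 1)) * l)) 0 := by
    refine (HasDerivAt.comp (0 : ℝ) (h₂ := fun x => (x - 1) ^ 2 * downstreamSq g x)
      ?_ hlin).const_mul C
    simpa using d2
  have c3 : HasDerivAt (fun δ => (D * Real.cos δ + h * Real.sin δ) ^ 2) (2 * D * h) 0 := by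
    have := ((hcos.const_mul D).add (hsin.const_mul h)).fun_pow 2
    simpa using this
  have c4 : HasDerivAt (fun δ => ((D - a) * h / (h * Real.cos δ - a * Real.sin δ)) ^ 2)
      (2 * (D - a) ^ 2 * a / h) 0 := by
    have hd := (hcos.const_mul h).sub (hsin.const_mul a)
    have := (((hasDerivAt_const (0 : ℝ) ((D - a) * h)).fun_div hd (by simp [hh.ne'])).fun_pow 2)
    refine this.congr_deriv ?_
    simp
    field_simp
  have f1 := eventually_pos_of_hasDerivAt (c1.sub c3) (by
      simp [hDe, mul_pow, haω]; ring) (by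
      rw [div_lt_iff₀ (by positivity)] at hl1
      have h2 : 0 < R ^ 2 - 1 := by nlinarith
      have : C * (2 * R * (y - ω) / (R ^ 2 - 1) * l) - 2 * D * h =
          2 * (l * (C * R * (y - ω)) - D * h * (R ^ 2 - 1)) / (R ^ 2 - 1) := by
        field_simp
      rw [this]
      apply div_pos _ h2
      linarith)
  have f2 := eventually_pos_of_hasDerivAt (c4.sub c2) (by
      simp only [Pi.sub_apply, Real.cos_zero, Real.sin_zero, zero_mul, add_zero, mul_one, mul_zero,
        sub_zero]
      rw [mul_div_cancel_right₀ _ hh.ne', hDe, ← hωdef]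
      linear_combination (R - 1) ^ 2 * haω) (by
      rw [lt_div_iff₀ (by positivity)] at hl2
      have : 2 * (D - a) ^ 2 * a / h - C * (2 * (y + R * ω) * (R - 1) / (R * (R + 1)) * l) =
          2 * ((D - a) ^ 2 * a * (R * (R + 1)) - l * (h * C * (y + R * ω) * (R - 1))) /
            (h * (R * (R + 1))) := by
        field_simp
      rw [this]
      apply div_pos _ (by positivity)
      linarith)
  have f3 : ∀ᶠ δ in 𝓝[>] (0 : ℝ), 1 < R + δ * l := by
    have : Tendsto (fun δ => R + δ * l) (𝓝[>] 0) (𝓝 R) := by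
      have := hlin.continuousAt.tendsto
      simp only [zero_mul, add_zero] at this
      exact this.mono_left nhdsWithin_le_nhds
    exact this.eventually_const_lt hR
  filter_upwards [f1, f2, f3] with δ g1 g2 g3
  refine ⟨_, g3, ?_, ?_⟩
  · simpa using g1
  · simpa using g2

theorem eventually_rotate_neg (T : RestingReflection G I D h a R) :
    ∀ᶠ δ in 𝓝[>] (0 : ℝ), rotate δ (I.v₂ - I.ξR) 1 < 0 := by
  have hc : Continuous fun δ => rotate δ (I.v₂ - I.ξR) 1 := by
    simp only [rotate_apply_one]
    fun_prop
  have : Tendsto (fun δ => rotate δ (I.v₂ - I.ξR) 1) (𝓝[>] 0) (𝓝 (-h)) := by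
    have := hc.tendsto 0
    rw [rotate_zero_left, T.z_one] at this
    exact this.mono_left nhdsWithin_le_nhds
  exact this.eventually_lt_const (by linarith [T.h_pos])

/-- Both reflection points are expressed on the same rotated wall: rotating the old one gives height
`h cos δ - a sin δ`, while slip of the new `v₂` requires height `h cos δ - D sin δ`. -/
theorem perturb_eqs (T : RestingReflection G I D h a R) (hρ₁ : 0 < ρ₁)
    (hI : IsIncident G ρ₁ p I) {δ : ℝ} (hJ : IsIncident G ρ₁ (p.perturb δ) J) :
    0 < h * Real.cos δ - D * Real.sin δ ∧ (J.v₂ - J.ξR) 0 = D * Real.cos δ + h * Real.sin δ ∧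
    ‖I.ξR‖ * Real.sin (p.θ + δ) = h * Real.cos δ - a * Real.sin δ ∧
    ‖I.ξR‖ * Real.cos (p.θ + δ) = -(a * Real.cos δ + h * Real.sin δ) ∧
    ‖J.ξR‖ * Real.sin (p.θ + δ) = h * Real.cos δ - D * Real.sin δ ∧
    0 < Real.sin (p.θ + δ) ∧
    J.v₂ 0 = (D - a) * h / (h * Real.cos δ - a * Real.sin δ) := by
  obtain ⟨f1, f2⟩ := hI.perturb_eq hρ₁ hJ
  have hs := hJ.sin_pos
  have hJξ := hJ.ξR_eq_norm_smul
  have hIξ := hI.ξR_eq_norm_smul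
  have e0 := T.ξR_zero
  have e1 := T.ξR_one
  have hpos := hJ.ξR_one_pos
  have hJ1 := hJ.ξR_one
  have hJ0 : (J.v₂ - J.ξR) 0 = D * Real.cos δ + h * Real.sin δ := by
    rw [f2, rotate_apply_zero, T.z_zero, T.z_one]
    ring
  rw [f2, rotate_apply_one, T.z_zero, T.z_one] at hJ1
  have hθ : (p.perturb δ).θ = p.θ + δ := rfl
  rw [hθ] at hs
  rw [hIξ] at e0 e1
  simp only [PiLp.smul_apply, smul_eq_mul, Params.wallDir_zero, Params.wallDir_one] at e0 e1
  have g1 : ‖I.ξR‖ * Real.sin (p.θ + δ) = h * Real.cos δ - a * Real.sin δ := by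
    rw [Real.sin_add]
    linear_combination Real.sin δ * e0 + Real.cos δ * e1
  have g2 : ‖I.ξR‖ * Real.cos (p.θ + δ) = -(a * Real.cos δ + h * Real.sin δ) := by
    rw [Real.cos_add]
    linear_combination Real.cos δ * e0 - Real.sin δ * e1
  have k0 := congrArg (fun a : Plane => a 0) hJξ
  have k1 := congrArg (fun a : Plane => a 1) hJξ
  simp only [PiLp.smul_apply, smul_eq_mul, Params.wallDir_zero, Params.wallDir_one, hθ] at k0 k1
  have g3 : ‖J.ξR‖ * Real.sin (p.θ + δ) = h * Real.cos δ - D * Real.sin δ := by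
    rw [← k1, hJ1]
    ring
  have hIpos : 0 < ‖I.ξR‖ := by
    have := hI.ξR_one_pos
    exact norm_pos_iff.2 (by rintro h0; simp [h0] at this)
  have hd : 0 < h * Real.cos δ - a * Real.sin δ := by rw [← g1]; positivity
  refine ⟨by linarith, hJ0, g1, g2, g3, hs, ?_⟩
  rw [eq_div_iff hd.ne']
  have : J.v₂ 0 = D * Real.cos δ + h * Real.sin δ + ‖J.ξR‖ * Real.cos (p.θ + δ) := by
    rw [← hJ0, ← k0]
    simp
  rw [this]
  have e : ‖J.ξR‖ * Real.cos (p.θ + δ) * (h * Real.cos δ - a * Real.sin δ) =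
      -(h * Real.cos δ - D * Real.sin δ) * (a * Real.cos δ + h * Real.sin δ) := by
    rw [← g3, ← g1]
    linear_combination ‖J.ξR‖ * Real.sin (p.θ + δ) * g2
  linear_combination e + (D - a) * h * Real.sin_sq_add_cos_sq δ

/-- Effect of a small counterclockwise rotation of the reflection wall. -/
theorem eventually_perturb (T : RestingReflection G I D h a R) (hρ₁ : 0 < ρ₁)
    (hI : IsIncident G ρ₁ p I) : ∀ᶠ δ in 𝓝[>] (0 : ℝ), ∀ J, IsIncident G ρ₁ (p.perturb δ) J →
      ‖J.ξR‖ < ‖I.ξR‖ ∧ J.ξR 0 < 0 ∧ WeakVerticalShock G J := by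
  have hsmall : ∀ᶠ δ in 𝓝[>] (0 : ℝ), 0 < δ ∧ δ < Real.pi / 2 :=
    Ioo_mem_nhdsGT (by linarith [Real.pi_pos])
  filter_upwards [T.eventually_exists_ratio hI.ρ₂_pos, hsmall] with δ ⟨R', hR', h1, h2⟩ ⟨hδ, hδ'⟩ J hJ
  obtain ⟨k0, k1, k2, k3, k4, k5, k6⟩ := T.perturb_eqs hρ₁ hI hJ
  have hsin : 0 < Real.sin δ := Real.sin_pos_of_pos_of_lt_pi hδ (by linarith [Real.pi_pos])
  have hcos : 0 < Real.cos δ := Real.cos_pos_of_mem_Ioo ⟨by linarith, hδ'⟩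
  have hIpos : 0 < ‖I.ξR‖ := by
    have := hI.ξR_one_pos
    exact norm_pos_iff.2 (by rintro h0; simp [h0] at this)
  refine ⟨?_, ?_, R', hR', ?_, ?_⟩
  -- The new point is closer to the corner because `a < D`: the gas of the 2-sector moves to the
  -- right.
  · have : ‖J.ξR‖ * Real.sin (p.θ + δ) < ‖I.ξR‖ * Real.sin (p.θ + δ) := by
      rw [k4, k2]
      nlinarith [T.a_lt_D]
    exact lt_of_mul_lt_mul_right this k5.le
  · have hJpos : 0 < ‖J.ξR‖ := by
      have := hJ.ξR_one_pos
      exact norm_pos_iff.2 (by rintro h0; simp [h0] at this)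
    have hc : Real.cos (p.θ + δ) < 0 := by
      have ha := T.a_pos
      have hh := T.h_pos
      by_contra hcon
      push Not at hcon
      have : 0 ≤ ‖I.ξR‖ * Real.cos (p.θ + δ) := by positivity
      rw [k3] at this
      have : 0 < a * Real.cos δ + h * Real.sin δ := by positivity
      linarith
    rw [hJ.ξR_eq_norm_smul]
    exact mul_neg_of_pos_of_neg hJpos hc
  · rw [k1, (hI.perturb_eq hρ₁ hJ).1]
    exact h1
  · rw [k6, (hI.perturb_eq hρ₁ hJ).1]
    exact h2

end RestingReflection

/-! ## Interior maximum principle -/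

/-- If `c` were positive, `f'` would be positive just to the right of `0`, where `f` would then
increase strictly. -/
theorem second_deriv_nonpos_of_isLocalMax {f f' : ℝ → ℝ} {c : ℝ} (hmax : IsLocalMax f 0)
    (hf : ∀ᶠ t in 𝓝 (0 : ℝ), HasDerivAt f (f' t) t) (hf' : HasDerivAt f' c 0) : c ≤ 0 := by
  by_contra hcon
  push Not at hcon
  have h0 : f' 0 = 0 := hmax.hasDerivAt_eq_zero hf.self_of_nhds
  have hpos := eventually_pos_of_hasDerivAt hf' h0 hcon
  have h1 : ∀ᶠ t in 𝓝[>] (0 : ℝ), ∀ x ∈ Icc 0 t, HasDerivAt f (f' x) x ∧ f x ≤ f 0 := by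
    obtain ⟨ε, hε, hb⟩ := Metric.eventually_nhds_iff.1 (hf.and hmax)
    filter_upwards [Ioo_mem_nhdsGT hε] with t ht x hx
    apply hb
    rw [Real.dist_eq, sub_zero, abs_of_nonneg hx.1]
    exact hx.2.trans_lt ht.2
  obtain ⟨ε, hε, hb⟩ := mem_nhdsGT_iff_exists_Ioo_subset.1 hpos
  obtain ⟨t, ht, htε⟩ := (h1.and (Ioo_mem_nhdsGT hε)).exists
  have hm : StrictMonoOn f (Icc 0 t) := by
    apply strictMonoOn_of_deriv_pos (convex_Icc 0 t)
    · exact fun x hx => (ht x hx).1.continuousAt.continuousWithinAt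
    · intro x hx
      rw [interior_Icc] at hx
      rw [(ht x ⟨hx.1.le, hx.2.le⟩).1.deriv]
      exact hb ⟨hx.1, hx.2.trans htε.2⟩
  have := hm (left_mem_Icc.2 htε.1.le) (right_mem_Icc.2 htε.1.le) htε.1
  linarith [(ht t (right_mem_Icc.2 htε.1.le)).2]

/-- Density as a function of enthalpy. -/
def Gas.densityOf (G : Gas) (e : ℝ) : ℝ :=
  G.ρ₀ * (1 + (G.γ - 1) * e / G.c₀ ^ 2) ^ (1 / (G.γ - 1))

theorem Gas.densityOf_enthalpy (G : Gas) {ρ : ℝ} (hρ : 0 < ρ) : G.densityOf (G.enthalpy ρ) = ρ := by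
  have hg : 0 < G.γ - 1 := by linarith [G.one_lt_γ]
  have h0 := G.ρ₀_pos
  have h1 := G.c₀_pos
  have e : 1 + (G.γ - 1) * G.enthalpy ρ / G.c₀ ^ 2 = (ρ / G.ρ₀) ^ (G.γ - 1) := by
    rw [enthalpy]
    field_simp
    ring
  rw [densityOf, e, ← Real.rpow_mul (by positivity), mul_one_div_cancel hg.ne', Real.rpow_one,
    mul_div_cancel₀ _ h0.ne']

theorem Gas.differentiableAt_densityOf (G : Gas) {ρ : ℝ} (hρ : 0 < ρ) :
    DifferentiableAt ℝ G.densityOf (G.enthalpy ρ) := by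
  have h0 := G.ρ₀_pos
  have h1 := G.c₀_pos
  have hg : 0 < G.γ - 1 := by linarith [G.one_lt_γ]
  have e : 1 + (G.γ - 1) * G.enthalpy ρ / G.c₀ ^ 2 = (ρ / G.ρ₀) ^ (G.γ - 1) := by
    rw [enthalpy]
    field_simp
    ring
  have hne : 1 + (G.γ - 1) * G.enthalpy ρ / G.c₀ ^ 2 ≠ 0 := by
    rw [e]
    positivity
  have d : DifferentiableAt ℝ (fun e : ℝ => 1 + (G.γ - 1) * e / G.c₀ ^ 2) (G.enthalpy ρ) := by
    fun_prop
  exact (d.rpow_const (Or.inl hne)).const_mul G.ρ₀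

namespace IsGlobalRR

variable {G : Gas} {ρ₁ : ℝ} {p : Params} {I : Incident} {F : ReflectedFlow}

theorem differentiableAt_v (h : IsGlobalRR G ρ₁ p I F) {ξ : Plane} (hξ : ξ ∈ F.Ω) :
    DifferentiableAt ℝ F.v ξ := by
  have hn := h.Ω_open.mem_nhds hξ
  have h1 : DifferentiableAt ℝ (fderiv ℝ F.ψ) ξ :=
    ((h.ψ_C2.contDiffAt hn).fderiv_right (m := 1) (by norm_num)).differentiableAt (by norm_num)
  have h2 : F.v =ᶠ[𝓝 ξ] fun y => (InnerProductSpace.toDual ℝ Plane).symm (fderiv ℝ F.ψ y) := by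
    filter_upwards [hn] with y hy
    rw [(h.ψ_gradient y hy).hasFDerivAt.fderiv, LinearIsometryEquiv.symm_apply_apply]
  refine DifferentiableAt.congr_of_eventuallyEq ?_ h2
  exact ((InnerProductSpace.toDual ℝ Plane).symm.toContinuousLinearEquiv.differentiableAt).comp
    ξ h1

/-- The equation in nondivergence form: `c² Δψ = D²ψ(z, z)`. -/
theorem nondivergence (h : IsGlobalRR G ρ₁ p I F) {ξ : Plane} (hξ : ξ ∈ F.Ω) :
    G.soundSpeed (F.ρ ξ) ^ 2 * (fderiv ℝ F.v ξ !₂[1, 0] 0 + fderiv ℝ F.v ξ !₂[0, 1] 1) =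
      dot (fderiv ℝ F.v ξ (F.z ξ)) (F.z ξ) := by
  have hn := h.Ω_open.mem_nhds hξ
  have hcl := subset_closure hξ
  have hρ := h.ρ_pos ξ hcl
  have hv := (h.differentiableAt_v hξ).hasFDerivAt
  set M := fderiv ℝ F.v ξ with hM
  have hz : HasFDerivAt F.z (M - ContinuousLinearMap.id ℝ Plane) ξ := hv.sub (hasFDerivAt_id ξ)
  have hψ := (h.ψ_gradient ξ hξ).hasFDerivAt
  have hid : HasFDerivAt (fun y : Plane => ‖y‖ ^ 2) (2 • innerSL ℝ ξ) ξ :=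
    (hasStrictFDerivAt_norm_sq ξ).hasFDerivAt
  have hzz : HasFDerivAt (fun y => ‖F.z y‖ ^ 2)
      ((2 • innerSL ℝ (F.z ξ)).comp (M - ContinuousLinearMap.id ℝ Plane)) ξ := by
    have := (hasStrictFDerivAt_norm_sq (F.z ξ)).hasFDerivAt
    exact HasFDerivAt.comp ξ (g := fun y : Plane => ‖y‖ ^ 2) this hz
  have hB := ((hψ.sub (hid.mul_const (2⁻¹ : ℝ))).neg).sub (hzz.mul_const (2⁻¹ : ℝ))
  have hev : (fun y => G.enthalpy (F.ρ y)) =ᶠ[𝓝 ξ]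
      fun y => -(F.ψ y - ‖y‖ ^ 2 * 2⁻¹) - ‖F.z y‖ ^ 2 * 2⁻¹ := by
    filter_upwards [hn] with y hy
    rw [h.bernoulli y (subset_closure hy)]
    ring
  have hE := hB.congr_of_eventuallyEq hev
  -- Differentiability of the density is recovered by inverting the enthalpy in Bernoulli's law.
  have hρd : DifferentiableAt ℝ F.ρ ξ := by
    have h1 : F.ρ =ᶠ[𝓝 ξ] fun y => G.densityOf (G.enthalpy (F.ρ y)) := by
      filter_upwards [hn] with y hy
      rw [G.densityOf_enthalpy (h.ρ_pos y (subset_closure hy))]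
    refine DifferentiableAt.congr_of_eventuallyEq ?_ h1
    exact DifferentiableAt.comp (g := G.densityOf) ξ (G.differentiableAt_densityOf hρ)
      hE.differentiableAt
  have hρf := hρd.hasFDerivAt
  set L := fderiv ℝ F.ρ ξ with hL
  have hE' := (G.hasDerivAt_enthalpy hρ).comp_hasFDerivAt ξ hρf
  have hLz := DFunLike.congr_fun (hE'.unique hE) (F.z ξ)
  have hdiv := h.potential_flow ξ hξ
  have hprod := hρf.smul hz
  have hfd : fderiv ℝ (fun η => F.ρ η • F.z η) ξ = _ := hprod.fderiv
  rw [divergence, hfd] at hdiv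
  have hz01 : F.z ξ = F.z ξ 0 • (!₂[1, 0] : Plane) + F.z ξ 1 • (!₂[0, 1] : Plane) := by
    apply plane_ext <;> simp
  have s0 : (EuclideanSpace.single 0 1 : Plane) = !₂[1, 0] := by apply plane_ext <;> simp
  have s1 : (EuclideanSpace.single 1 1 : Plane) = !₂[0, 1] := by apply plane_ext <;> simp
  have hLz2 : L (F.z ξ) = F.z ξ 0 * L !₂[1, 0] + F.z ξ 1 * L !₂[0, 1] := by
    conv_lhs => rw [hz01]
    rw [map_add, map_smul, map_smul, smul_eq_mul, smul_eq_mul]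
  rw [Fin.sum_univ_two, s0, s1] at hdiv
  simp only [_root_.add_apply, _root_.smul_apply,
    _root_.sub_apply, ContinuousLinearMap.smulRight_apply, PiLp.add_apply,
    PiLp.smul_apply, PiLp.sub_apply, ContinuousLinearMap.id_apply, smul_eq_mul,
    Matrix.cons_val_zero, Matrix.cons_val_one] at hdiv
  simp only [_root_.smul_apply, _root_.sub_apply,
    _root_.neg_apply, ContinuousLinearMap.comp_apply, smul_eq_mul,
    InnerProductSpace.toDual_apply_apply, innerSL_apply_apply, ContinuousLinearMap.id_apply, nsmul_eq_mul,
    inner_sub_right, Nat.cast_ofNat] at hLz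
  have hzv : inner ℝ (F.v ξ) (F.z ξ) - inner ℝ ξ (F.z ξ) = inner ℝ (F.z ξ) (F.z ξ) := by
    rw [← inner_sub_left]
    rfl
  -- Differentiation of Bernoulli's law along `z`; the terms without second derivatives of `ψ`
  -- cancel by `v - ξ = z`.
  have hLz3 : G.soundSpeed (F.ρ ξ) ^ 2 * L (F.z ξ) = -F.ρ ξ * dot (M (F.z ξ)) (F.z ξ) := by
    have e : dot (M (F.z ξ)) (F.z ξ) = inner ℝ (F.z ξ) (M (F.z ξ)) := real_inner_comm _ _
    rw [e]
    field_simp at hLz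
    linear_combination hLz - F.ρ ξ * hzv
  rw [hLz2] at hLz3
  apply mul_left_cancel₀ hρ.ne'
  linear_combination G.soundSpeed (F.ρ ξ) ^ 2 * hdiv - hLz3

/-- Addition of a strictly convex quadratic function excludes interior maxima. -/
theorem not_isLocalMax (h : IsGlobalRR G ρ₁ p I F) {ξ : Plane} (hξ : ξ ∈ F.Ω) (b : Plane) {ε : ℝ}
    (hε : 0 < ε) : ¬ IsLocalMax (fun y => F.ψ y + ε * ‖y - b‖ ^ 2) ξ := by
  intro hmax
  have hn := h.Ω_open.mem_nhds hξ
  have hv := (h.differentiableAt_v hξ).hasFDerivAt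
  have hnd := h.nondivergence hξ
  have hell := h.elliptic ξ hξ
  set M := fderiv ℝ F.v ξ with hM
  -- Second derivative test along every line through `ξ`: the Hessian of `ψ` is at most `-2 * ε`.
  have hneg : ∀ e : Plane, dot (M e) e + 2 * ε * ‖e‖ ^ 2 ≤ 0 := by
    intro e
    have hline : ∀ t : ℝ, HasDerivAt (fun t : ℝ => ξ + t • e) e t := by
      intro t
      simpa using ((hasDerivAt_id t).smul_const e).const_add ξ
    have hcont : Tendsto (fun t : ℝ => ξ + t • e) (𝓝 0) (𝓝 ξ) := by
      simpa using (hline 0).continuousAt.tendsto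
    refine second_deriv_nonpos_of_isLocalMax
      (f := fun t => F.ψ (ξ + t • e) + ε * ‖ξ + t • e - b‖ ^ 2)
      (f' := fun t => inner ℝ (F.v (ξ + t • e)) e + ε * (2 * inner ℝ (ξ + t • e - b) e)) ?_ ?_ ?_
    · filter_upwards [hcont.eventually hmax] with t ht
      simpa using ht
    · filter_upwards [hcont.eventually hn] with t ht
      have d1 := (h.ψ_gradient _ ht).hasFDerivAt.comp_hasDerivAt t (hline t)
      have d2 := ((hline t).sub_const b).norm_sq
      exact (d1.add (d2.const_mul ε))
    · have hv0 : HasFDerivAt F.v M (ξ + (0 : ℝ) • e) := by simpa using hv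
      have d1 := hv0.comp_hasDerivAt (0 : ℝ) (hline 0)
      have d2 := (hline 0).sub_const b
      have d3 := (d1.inner ℝ (hasDerivAt_const (0 : ℝ) e)).add
        (((d2.inner ℝ (hasDerivAt_const (0 : ℝ) e)).const_mul 2).const_mul ε)
      refine d3.congr_deriv ?_
      simp [dot]
      ring
  have k0 := hneg !₂[1, 0]
  have k1 := hneg !₂[0, 1]
  -- The forms at `z` and `rot z` add up to `‖z‖ ^ 2` times the trace. So the equation reads `(c ^ 2
  -- - ‖z‖ ^ 2) Δψ + D²ψ(rot z, rot z) = 0`, whose first term is negative and whose second is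
  -- nonpositive.
  have k2 := hneg (rot (F.z ξ))
  have hzz := norm_sq_eq (F.z ξ)
  have hz01 : ∀ x y : ℝ, M !₂[x, y] = x • M !₂[1, 0] + y • M !₂[0, 1] := by
    intro x y
    rw [← map_smul, ← map_smul, ← map_add]
    congr 1
    apply plane_ext <;> simp
  have hz0 : F.z ξ = !₂[F.z ξ 0, F.z ξ 1] := by apply plane_ext <;> simp
  have e1 := hz01 (F.z ξ 0) (F.z ξ 1)
  rw [← hz0] at e1
  have e2 : M (rot (F.z ξ)) = _ := hz01 (-(F.z ξ 1)) (F.z ξ 0)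
  rw [e1] at hnd
  rw [e2] at k2
  simp only [dot_eq, norm_sq_eq, PiLp.add_apply, PiLp.smul_apply, smul_eq_mul, rot_zero, rot_one,
    Matrix.cons_val_zero, Matrix.cons_val_one] at k0 k1 k2 hnd
  have hc : ‖F.z ξ‖ ^ 2 < G.soundSpeed (F.ρ ξ) ^ 2 := by
    have := norm_nonneg (F.z ξ)
    gcongr
  rw [hzz] at hc
  generalize G.soundSpeed (F.ρ ξ) ^ 2 = c at *
  generalize F.z ξ 0 = x at *
  generalize F.z ξ 1 = y at *
  generalize (M !₂[1, 0]) 0 = m00 at *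
  generalize (M !₂[1, 0]) 1 = m10 at *
  generalize (M !₂[0, 1]) 0 = m01 at *
  generalize (M !₂[0, 1]) 1 = m11 at *
  have t1 : m00 + m11 < 0 := by linarith
  have t2 : (c - (x ^ 2 + y ^ 2)) * (m00 + m11) < 0 := mul_neg_of_pos_of_neg (by linarith) t1
  have t3 : 0 ≤ 2 * ε * ((-y) ^ 2 + x ^ 2) := by positivity
  linarith

end IsGlobalRR

/-! ## Behaviour at the walls and the maximum principle -/

theorem dot_smul_left' (t : ℝ) (a b : Plane) : dot (t • a) b = t * dot a b :=
  real_inner_smul_left _ _ _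

theorem dot_add_left (a b c : Plane) : dot (a + b) c = dot a c + dot b c := inner_add_left _ _ _

theorem continuous_dot_left (b : Plane) : Continuous fun a => dot a b := by
  unfold dot
  fun_prop

theorem continuous_apply_plane (i : Fin 2) : Continuous fun a : Plane => a i := by fun_prop

namespace Params

variable (p : Params)

/-- The sector together with its walls. -/
def closedSector : Set Plane := {ξ | 0 ≤ ξ 1 ∧ 0 ≤ dot ξ p.wallNormal}

theorem isOpen_sector : IsOpen p.sector :=
  (isOpen_lt continuous_const (continuous_apply_plane 1)).inter
    (isOpen_lt continuous_const (continuous_dot_left _))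

theorem isClosed_closedSector : IsClosed p.closedSector :=
  (isClosed_le continuous_const (continuous_apply_plane 1)).inter
    (isClosed_le continuous_const (continuous_dot_left _))

theorem sector_subset : p.sector ⊆ p.closedSector := fun _ h => ⟨h.1.le, h.2.le⟩

theorem convex_sector : Convex ℝ p.sector := by
  intro x hx y hy s t hs ht hst
  refine ⟨?_, ?_⟩
  · have h1 := hx.1
    have h2 := hy.1
    simp only [PiLp.add_apply, PiLp.smul_apply, smul_eq_mul]
    rcases hs.eq_or_lt with rfl | hs
    · have : t = 1 := by linarith
      subst this
      linarith
    · positivity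
  · have h1 := hx.2
    have h2 := hy.2
    rw [dot_add_left, dot_smul_left', dot_smul_left']
    rcases hs.eq_or_lt with rfl | hs
    · have : t = 1 := by linarith
      subst this
      linarith
    · positivity

/-- A direction pointing into the sector from both walls. -/
def inward : Plane := !₂[0, 1] + p.wallNormal

theorem inward_one : p.inward 1 = 1 + Real.cos p.θ := by simp [inward]

theorem dot_inward : dot p.inward p.wallNormal = 1 + Real.cos p.θ := by
  simp [inward, dot_eq]
  linear_combination Real.sin_sq_add_cos_sq p.θ

/-- A shift along `inward` moves off both walls at once. -/
theorem closedSector_subset_closure (hp : 0 < 1 + Real.cos p.θ) :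
    p.closedSector ⊆ closure p.sector := by
  intro x hx
  have hc : Tendsto (fun t : ℝ => x + t • p.inward) (𝓝[>] 0) (𝓝 x) := by
    have : Continuous fun t : ℝ => x + t • p.inward := by fun_prop
    simpa using (this.tendsto 0).mono_left nhdsWithin_le_nhds
  refine mem_closure_of_tendsto hc ?_
  filter_upwards [self_mem_nhdsWithin] with t (ht : 0 < t)
  have h1 := hx.1
  have h2 := hx.2
  refine ⟨?_, ?_⟩
  · simp only [PiLp.add_apply, PiLp.smul_apply, smul_eq_mul, inward_one]
    positivity
  · rw [dot_add_left, dot_smul_left', dot_inward]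
    positivity

end Params

theorem IsIncident.one_add_cos_pos {G : Gas} {ρ₁ : ℝ} {p : Params} {I : Incident}
    (h : IsIncident G ρ₁ p I) : 0 < 1 + Real.cos p.θ := by
  have h1 := h.sin_pos
  have h2 := Real.sin_sq_add_cos_sq p.θ
  by_contra hcon
  push Not at hcon
  nlinarith

namespace IsGlobalRR

variable {G : Gas} {ρ₁ : ℝ} {p : Params} {I : Incident} {F : ReflectedFlow}

/-! ### The 3-sector near its walls -/

theorem isCompact_closure (h : IsGlobalRR G ρ₁ p I F) : IsCompact (closure F.Ω) :=
  h.Ω_bounded.isCompact_closure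

theorem isCompact_shock (h : IsGlobalRR G ρ₁ p I F) : IsCompact (F.σ '' Icc 0 1) :=
  isCompact_Icc.image_of_continuousOn h.shock_C1.continuousOn

theorem closure_subset (h : IsGlobalRR G ρ₁ p I F) : closure F.Ω ⊆ p.closedSector :=
  closure_minimal (h.Ω_sector.trans p.sector_subset) p.isClosed_closedSector

theorem shock_subset (h : IsGlobalRR G ρ₁ p I F) {s : ℝ} (hs : s ∈ Icc (0 : ℝ) 1) :
    F.σ s ∈ closure F.Ω := by
  apply frontier_subset_closure
  rw [h.Ω_frontier]
  exact Or.inl (Or.inl (mem_image_of_mem _ hs))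

theorem opposite_subset (h : IsGlobalRR G ρ₁ p I F) : segment ℝ (F.σ 1) 0 ⊆ frontier F.Ω := by
  rw [h.Ω_frontier]
  exact fun x hx => Or.inl (Or.inr hx)

theorem reflection_subset (h : IsGlobalRR G ρ₁ p I F) : segment ℝ 0 I.ξR ⊆ frontier F.Ω := by
  rw [h.Ω_frontier]
  exact fun x hx => Or.inr hx

theorem opposite_eq (h : IsGlobalRR G ρ₁ p I F) {ξ : Plane} (hξ : ξ ∈ segment ℝ (F.σ 1) 0) :
    ξ 1 = 0 := by
  obtain ⟨a, -, ha⟩ := h.shock_end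
  obtain ⟨s, t, -, -, -, rfl⟩ := hξ
  simp [ha]

theorem reflection_eq (h : IsGlobalRR G ρ₁ p I F) {ξ : Plane} (hξ : ξ ∈ segment ℝ 0 I.ξR) :
    dot ξ p.wallNormal = 0 := by
  obtain ⟨s, t, -, -, -, rfl⟩ := hξ
  rw [smul_zero, zero_add, dot_smul_left', h.incident.dot_ξR, mul_zero]

theorem frontier_inter_sector (h : IsGlobalRR G ρ₁ p I F) {ξ : Plane} (hξ : ξ ∈ frontier F.Ω)
    (hs : ξ ∈ p.sector) : ξ ∈ F.σ '' Icc 0 1 := by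
  rw [h.Ω_frontier] at hξ
  rcases hξ with (hξ | hξ) | hξ
  · exact hξ
  · have := hs.1
    rw [h.opposite_eq hξ] at this
    exact absurd this (lt_irrefl _)
  · have := hs.2
    rw [h.reflection_eq hξ] at this
    exact absurd this (lt_irrefl _)

/-- Near a boundary point off the shock the 3-sector fills the sector. -/
theorem exists_ball (h : IsGlobalRR G ρ₁ p I F) {w : Plane} (hw : w ∈ frontier F.Ω)
    (hS : w ∉ F.σ '' Icc 0 1) : ∃ ε > 0, Metric.ball w ε ∩ p.sector ⊆ F.Ω := by
  obtain ⟨ε, hε, hb⟩ := Metric.isOpen_iff.1 h.isCompact_shock.isClosed.isOpen_compl w hS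
  refine ⟨ε, hε, ?_⟩
  have hconv : Convex ℝ (Metric.ball w ε ∩ p.sector) := (convex_ball w ε).inter p.convex_sector
  have hne : (Metric.ball w ε ∩ p.sector ∩ F.Ω).Nonempty := by
    obtain ⟨y, hy, hyΩ⟩ := mem_closure_iff.1 (frontier_subset_closure hw) _ Metric.isOpen_ball
      (Metric.mem_ball_self hε)
    exact ⟨y, ⟨hy, h.Ω_sector hyΩ⟩, hyΩ⟩
  have hpre := hconv.isPreconnected
  by_contra hcon
  obtain ⟨x, hx, hxΩ⟩ := not_subset.1 hcon
  -- Inside the sector the frontier consists of shock points only, and the ball avoids these. The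
  -- convex set is thus covered by `Ω` and the exterior of its closure, and connectedness excludes
  -- the exterior.
  have hdisj : ∀ y ∈ Metric.ball w ε ∩ p.sector, y ∉ F.Ω → y ∈ (closure F.Ω)ᶜ := by
    intro y hy hyΩ hycl
    have hf : y ∈ frontier F.Ω := by
      rw [h.Ω_open.frontier_eq]
      exact ⟨hycl, hyΩ⟩
    exact hb hy.1 (h.frontier_inter_sector hf hy.2)
  obtain ⟨z, -, hz1, hz2⟩ := hpre F.Ω (closure F.Ω)ᶜ h.Ω_open isClosed_closure.isOpen_compl
    (fun y hy => by
      by_cases hyΩ : y ∈ F.Ω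
      · exact Or.inl hyΩ
      · exact Or.inr (hdisj y hy hyΩ))
    hne ⟨x, hx, hdisj x hx hxΩ⟩
  exact hz2 (subset_closure hz1)

theorem closedSector_mem (h : IsGlobalRR G ρ₁ p I F) {w : Plane} (hw : w ∈ frontier F.Ω)
    (hS : w ∉ F.σ '' Icc 0 1) : ∃ ε > 0, Metric.ball w ε ∩ p.sector ⊆ F.Ω ∧
      Metric.ball w ε ∩ p.closedSector ⊆ closure (Metric.ball w ε ∩ p.sector) := by
  obtain ⟨ε, hε, hb⟩ := h.exists_ball hw hS
  refine ⟨ε, hε, hb, fun x hx => ?_⟩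
  exact Metric.isOpen_ball.inter_closure
    ⟨hx.1, p.closedSector_subset_closure h.incident.one_add_cos_pos hx.2⟩

/-- The potential is differentiable up to the walls. -/
theorem hasFDerivWithinAt_wall (h : IsGlobalRR G ρ₁ p I F) {w : Plane} (hw : w ∈ frontier F.Ω)
    (hS : w ∉ F.σ '' Icc 0 1) :
    HasFDerivWithinAt F.ψ (innerSL ℝ (F.v w)) p.closedSector w := by
  obtain ⟨ε, hε, hb, hc⟩ := h.closedSector_mem hw hS
  set C := Metric.ball w ε ∩ p.sector with hC
  have hwcl := frontier_subset_closure hw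
  have hcl : closure C ⊆ closure F.Ω := closure_mono hb
  have hopen : IsOpen C := Metric.isOpen_ball.inter p.isOpen_sector
  have hder : HasFDerivWithinAt F.ψ (innerSL ℝ (F.v w)) (closure C) w := by
    -- The convex piece of the sector allows the gradient `v`, continuous up to the wall, to be
    -- taken to the limit.
    apply hasFDerivWithinAt_closure_of_tendsto_fderiv
    · intro y hy
      exact (h.ψ_gradient y (hb hy)).differentiableAt.differentiableWithinAt
    · exact (convex_ball w ε).inter p.convex_sector
    · exact hopen
    · intro y hy
      exact (h.ψ_continuous y (hcl hy)).mono (hb.trans subset_closure)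
    · have h1 : Tendsto F.v (𝓝[C] w) (𝓝 (F.v w)) :=
        (h.v_continuous w hwcl).mono (hb.trans subset_closure)
      have h2 := ((innerSL ℝ (E := Plane)).continuous.tendsto (F.v w)).comp h1
      refine h2.congr' ?_
      filter_upwards [self_mem_nhdsWithin] with y hy
      rw [(h.ψ_gradient y (hb hy)).hasFDerivAt.fderiv]
      rfl
  refine hder.mono_of_mem_nhdsWithin ?_
  exact mem_of_superset (inter_mem_nhdsWithin _ (Metric.ball_mem_nhds w hε))
    (fun x hx => hc ⟨hx.2, hx.1⟩)

/-- A positive derivative in a direction pointing into the sector excludes a maximum. -/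
theorem exists_gt_of_wall (h : IsGlobalRR G ρ₁ p I F) {w d b : Plane} {ε : ℝ}
    (hw : w ∈ frontier F.Ω) (hS : w ∉ F.σ '' Icc 0 1)
    (hd : ∀ᶠ t in 𝓝[>] (0 : ℝ), w + t • d ∈ p.closedSector)
    (hpos : 0 < dot (F.v w) d + ε * (2 * dot (w - b) d)) :
    ∃ y ∈ closure F.Ω, F.ψ w + ε * ‖w - b‖ ^ 2 < F.ψ y + ε * ‖y - b‖ ^ 2 := by
  obtain ⟨η, hη, hηs⟩ := mem_nhdsGT_iff_exists_Ioo_subset.1 hd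
  have hwc := h.closure_subset (frontier_subset_closure hw)
  have hline : HasDerivAt (fun t : ℝ => w + t • d) d 0 := by
    simpa using ((hasDerivAt_id (0 : ℝ)).smul_const d).const_add w
  have hmaps : MapsTo (fun t : ℝ => w + t • d) (Ico 0 η) p.closedSector := by
    intro t ht
    rcases ht.1.eq_or_lt with rfl | h0
    · simpa using hwc
    · exact hηs ⟨h0, ht.2⟩
  have h0 : HasFDerivWithinAt F.ψ (innerSL ℝ (F.v w)) p.closedSector (w + (0 : ℝ) • d) := by
    simpa using h.hasFDerivWithinAt_wall hw hS
  have d1 := h0.comp_hasDerivWithinAt (0 : ℝ) (hline.hasDerivWithinAt (s := Ico 0 η)) hmaps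
  have d2 := ((hline.sub_const b).norm_sq.const_mul ε).hasDerivWithinAt (s := Ico 0 η)
  have d3 := d1.add d2
  rw [hasDerivWithinAt_iff_tendsto_slope] at d3
  have hset : Ico 0 η \ {0} = Ioo 0 η := by
    ext t
    simp only [Set.mem_sdiff, mem_Ico, mem_singleton_iff, mem_Ioo]
    constructor
    · rintro ⟨⟨h1, h2⟩, h3⟩
      exact ⟨lt_of_le_of_ne h1 (Ne.symm h3), h2⟩
    · rintro ⟨h1, h2⟩
      exact ⟨⟨h1.le, h2⟩, h1.ne'⟩
  rw [hset, nhdsWithin_Ioo_eq_nhdsGT hη] at d3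
  have hev := d3.eventually_const_lt (show (0 : ℝ) < _ by
    simpa [dot] using hpos)
  obtain ⟨ε', hε', hb, hc⟩ := h.closedSector_mem hw hS
  have hsub : Metric.ball w ε' ∩ p.closedSector ⊆ closure F.Ω := hc.trans (closure_mono hb)
  have hball : ∀ᶠ t in 𝓝[>] (0 : ℝ), w + t • d ∈ Metric.ball w ε' := by
    have : Tendsto (fun t : ℝ => w + t • d) (𝓝[>] 0) (𝓝 w) := by
      simpa using hline.continuousAt.tendsto.mono_left nhdsWithin_le_nhds
    exact this.eventually (Metric.ball_mem_nhds w hε')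
  obtain ⟨t, ht1, ht2, ht3, ht4⟩ := (hev.and (hball.and (hd.and self_mem_nhdsWithin))).exists
  have ht0 : 0 < t := ht4
  refine ⟨w + t • d, hsub ⟨ht2, ht3⟩, ?_⟩
  rw [slope_def_field, sub_zero] at ht1
  have := (div_pos_iff_of_pos_right ht0).1 ht1
  simp at this
  linarith

theorem eq_of_continuousOn {f : Plane → ℝ} {s : Set Plane} {x : Plane} {c : ℝ}
    (hf : ContinuousOn f (closure F.Ω)) (hs : s ⊆ closure F.Ω) (hx : x ∈ closure s)
    (hxΩ : x ∈ closure F.Ω) (hc : ∀ y ∈ s, f y = c) : f x = c := by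
  have h1 : Tendsto f (𝓝[s] x) (𝓝 (f x)) := (hf x hxΩ).mono hs
  have : (𝓝[s] x).NeBot := mem_closure_iff_nhdsWithin_neBot.1 hx
  have h2 : Tendsto f (𝓝[s] x) (𝓝 c) :=
    tendsto_const_nhds.congr' (by filter_upwards [self_mem_nhdsWithin] with y hy using (hc y hy).symm)
  exact tendsto_nhds_unique h1 h2

theorem slip_opposite_closed (h : IsGlobalRR G ρ₁ p I F) {ξ : Plane}
    (hξ : ξ ∈ segment ℝ (F.σ 1) 0) : F.v ξ 1 = 0 := by
  have hsub := h.opposite_subset.trans frontier_subset_closure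
  refine eq_of_continuousOn (f := fun ξ => F.v ξ 1)
    ((continuous_apply_plane 1).comp_continuousOn h.v_continuous)
    ((openSegment_subset_segment ℝ _ _).trans hsub) ?_ (hsub hξ) h.slip_opposite
  exact segment_subset_closure_openSegment hξ

theorem slip_reflection_closed (h : IsGlobalRR G ρ₁ p I F) {ξ : Plane}
    (hξ : ξ ∈ segment ℝ 0 I.ξR) : dot (F.v ξ) p.wallNormal = 0 := by
  have hsub := h.reflection_subset.trans frontier_subset_closure
  refine eq_of_continuousOn (f := fun ξ => dot (F.v ξ) p.wallNormal)
    ((continuous_dot_left _).comp_continuousOn h.v_continuous)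
    ((openSegment_subset_segment ℝ _ _).trans hsub) ?_ (hsub hξ) h.slip_reflection
  exact segment_subset_closure_openSegment hξ

/-- The two slip conditions extend by continuity to the corner, where the wall normals are
independent because `sin θ ≠ 0`. -/
theorem v_corner (h : IsGlobalRR G ρ₁ p I F) : F.v 0 = 0 := by
  have h1 := h.slip_opposite_closed (right_mem_segment ℝ _ _)
  have h2 := h.slip_reflection_closed (left_mem_segment ℝ _ _)
  rw [dot_eq, h1, Params.wallNormal_zero, zero_mul, add_zero] at h2
  apply plane_ext
  · exact (mul_eq_zero.1 h2).resolve_right (by simpa using h.incident.sin_pos.ne')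
  · exact h1

/-- The potential attains its maximum on the reflected shock. -/
theorem exists_shock_ge (h : IsGlobalRR G ρ₁ p I F) {ξ : Plane} (hξ : ξ ∈ closure F.Ω) :
    ∃ s ∈ Icc (0 : ℝ) 1, F.ψ ξ ≤ F.ψ (F.σ s) := by
  by_contra hcon
  push Not at hcon
  have hσ := h.shock_C1.continuousOn
  have hne : (Icc (0 : ℝ) 1).Nonempty := ⟨0, by simp⟩
  have hpos := h.incident.one_add_cos_pos
  -- This center makes `‖y - b‖ ^ 2` strictly increasing from either wall into the sector, and from
  -- the corner along `inward`; slip alone only gives a vanishing derivative of `ψ`.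
  set b := -p.inward with hb
  obtain ⟨s₀, hs₀, hmax⟩ := isCompact_Icc.exists_isMaxOn hne
    (h.ψ_continuous.comp hσ fun s hs => h.shock_subset hs)
  obtain ⟨s₁, hs₁, hmax₁⟩ := isCompact_Icc.exists_isMaxOn hne
    (show ContinuousOn (fun s => ‖F.σ s - b‖ ^ 2) (Icc 0 1) by fun_prop)
  set B := ‖F.σ s₁ - b‖ ^ 2 with hB
  have hB0 : 0 ≤ B := by positivity
  have hgap : 0 < F.ψ ξ - F.ψ (F.σ s₀) := by linarith [hcon s₀ hs₀]
  -- So small that the added quadratic cannot raise the values on the shock to that at `ξ`; the `1`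
  -- only avoids division by zero.
  set ε := (F.ψ ξ - F.ψ (F.σ s₀)) / (B + 1) with hε
  have hε0 : 0 < ε := by positivity
  have hεB : ε * B < F.ψ ξ - F.ψ (F.σ s₀) := by
    rw [hε, div_mul_eq_mul_div, div_lt_iff₀ (by linarith)]
    nlinarith
  obtain ⟨w, hw, hwmax⟩ := h.isCompact_closure.exists_isMaxOn ⟨ξ, hξ⟩
    (show ContinuousOn (fun y => F.ψ y + ε * ‖y - b‖ ^ 2) (closure F.Ω) from
      h.ψ_continuous.add (by fun_prop))
  have hwS : w ∉ F.σ '' Icc 0 1 := by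
    rintro ⟨s, hs, rfl⟩
    have h1 := hwmax hξ
    have h2 := hmax hs
    have h3 := hmax₁ hs
    simp only [mem_ofPred_eq, Function.comp] at h1 h2 h3
    have h4 : 0 ≤ ε * ‖ξ - b‖ ^ 2 := by positivity
    have h5 : ε * ‖F.σ s - b‖ ^ 2 ≤ ε * B := by gcongr
    linarith
  have hwΩ : w ∉ F.Ω := by
    intro hwΩ
    apply h.not_isLocalMax hwΩ b hε0
    filter_upwards [h.Ω_open.mem_nhds hwΩ] with y hy
    exact hwmax (subset_closure hy)
  have hwf : w ∈ frontier F.Ω := by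
    rw [h.Ω_open.frontier_eq]
    exact ⟨hw, hwΩ⟩
  have hwall : ∀ d : Plane, (∀ᶠ t in 𝓝[>] (0 : ℝ), w + t • d ∈ p.closedSector) →
      dot (F.v w) d = 0 → 0 < dot (w - b) d → False := by
    intro d hd hv hdb
    obtain ⟨y, hy, hlt⟩ := h.exists_gt_of_wall (b := b) (ε := ε) hwf hwS hd (by
      rw [hv, zero_add]
      positivity)
    exact absurd (hwmax hy) (not_le.2 hlt)
  have hwc := h.closure_subset hw
  have hin := p.inward_one
  have hdin := p.dot_inward
  -- The maximum lies on the reflection wall, on the opposite wall or at the corner. The inward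
  -- derivative of `ψ` vanishes in all three cases, at the corner because `v` does.
  by_cases hy0 : 0 < w 1
  · have hwr : w ∈ segment ℝ 0 I.ξR := by
      have := hwf
      rw [h.Ω_frontier] at this
      rcases this with (h1 | h1) | h1
      · exact absurd h1 hwS
      · rw [h.opposite_eq h1] at hy0
        exact absurd hy0 (lt_irrefl _)
      · exact h1
    refine hwall p.wallNormal ?_ (h.slip_reflection_closed hwr) ?_
    · have : Tendsto (fun t : ℝ => (w + t • p.wallNormal) 1) (𝓝[>] 0) (𝓝 (w 1)) := by
        have hc : Continuous fun t : ℝ => (w + t • p.wallNormal) 1 := by fun_prop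
        simpa using (hc.tendsto 0).mono_left nhdsWithin_le_nhds
      filter_upwards [this.eventually_const_lt hy0, self_mem_nhdsWithin] with t ht (ht0 : 0 < t)
      refine ⟨ht.le, ?_⟩
      rw [dot_add_left, dot_smul_left', h.reflection_eq hwr, zero_add]
      have : dot p.wallNormal p.wallNormal = 1 := by
        simp [dot_eq]
        linear_combination Real.sin_sq_add_cos_sq p.θ
      rw [this]
      linarith
    · rw [hb, sub_neg_eq_add, dot_add_left, h.reflection_eq hwr, hdin]
      linarith
  · have hw1 : w 1 = 0 := le_antisymm (not_lt.1 hy0) hwc.1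
    by_cases hN0 : 0 < dot w p.wallNormal
    · have hwr : w ∈ segment ℝ (F.σ 1) 0 := by
        have := hwf
        rw [h.Ω_frontier] at this
        rcases this with (h1 | h1) | h1
        · exact absurd h1 hwS
        · exact h1
        · rw [h.reflection_eq h1] at hN0
          exact absurd hN0 (lt_irrefl _)
      refine hwall !₂[0, 1] ?_ ?_ ?_
      · have : Tendsto (fun t : ℝ => dot (w + t • (!₂[0, 1] : Plane)) p.wallNormal) (𝓝[>] 0)
            (𝓝 (dot w p.wallNormal)) := by
          have hc : Continuous fun t : ℝ => dot (w + t • (!₂[0, 1] : Plane)) p.wallNormal := by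
            have := continuous_dot_left p.wallNormal
            exact this.comp (by fun_prop)
          simpa using (hc.tendsto 0).mono_left nhdsWithin_le_nhds
        filter_upwards [this.eventually_const_lt hN0, self_mem_nhdsWithin] with t ht (ht0 : 0 < t)
        refine ⟨?_, ht.le⟩
        simp [hw1, ht0.le]
      · simp [dot_eq, h.slip_opposite_closed hwr]
      · simp [dot_eq, hb, hw1, hin, hpos]
    · have hN : dot w p.wallNormal = 0 := le_antisymm (not_lt.1 hN0) hwc.2
      have hw0 : w = 0 := by
        rw [dot_eq, hw1, Params.wallNormal_zero, zero_mul, add_zero] at hN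
        apply plane_ext
        · exact (mul_eq_zero.1 hN).resolve_right (by simpa using h.incident.sin_pos.ne')
        · exact hw1
      refine hwall p.inward ?_ ?_ ?_
      · filter_upwards [self_mem_nhdsWithin] with t (ht0 : 0 < t)
        refine ⟨?_, ?_⟩
        · simp only [PiLp.add_apply, PiLp.smul_apply, smul_eq_mul, hw1, hin]
          positivity
        · rw [dot_add_left, dot_smul_left', hN, hdin]
          positivity
      · rw [hw0, h.v_corner]
        simp [dot_eq]
      · rw [hb, hw0, zero_sub, neg_neg]
        have : 0 < p.inward 1 := by rw [hin]; exact hpos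
        rw [dot_eq]
        exact add_pos_of_nonneg_of_pos (mul_self_nonneg _) (mul_pos this this)

end IsGlobalRR

/-! ## Nonexistence of global regular reflection -/

namespace IsGlobalRR

variable {G : Gas} {ρ₁ : ℝ} {p : Params} {I : Incident} {F : ReflectedFlow}

/-- The potential increases in directions of positive velocity. -/
theorem exists_gt_of_direction (h : IsGlobalRR G ρ₁ p I F) {P d : Plane} {η : ℝ}
    (hP : P ∈ closure F.Ω) (hη : 0 < η)
    (hd : ∀ t ∈ Ioo (0 : ℝ) η, P + t • d ∈ closure F.Ω ∧
      HasDerivAt (fun x : ℝ => F.ψ (P + x • d)) (dot (F.v (P + t • d)) d) t)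
    (hpos : 0 < dot (F.v P) d) : ∃ y ∈ closure F.Ω, F.ψ P < F.ψ y := by
  have hmaps : MapsTo (fun t : ℝ => P + t • d) (Ico 0 η) (closure F.Ω) := by
    intro t ht
    rcases ht.1.eq_or_lt with rfl | h0
    · simpa using hP
    · exact (hd t ⟨h0, ht.2⟩).1
  have hline : ContinuousOn (fun t : ℝ => P + t • d) (Ico 0 η) := by fun_prop
  have hψ : ContinuousOn (fun t : ℝ => F.ψ (P + t • d)) (Ico 0 η) :=
    h.ψ_continuous.comp hline hmaps
  have hv : ContinuousOn (fun t : ℝ => dot (F.v (P + t • d)) d) (Ico 0 η) :=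
    (continuous_dot_left d).comp_continuousOn (h.v_continuous.comp hline hmaps)
  -- Differentiability is known only for `t > 0`; continuity of `v` carries positivity from `P` to
  -- nearby points of the ray.
  have hv0 : Tendsto (fun t : ℝ => dot (F.v (P + t • d)) d) (𝓝[>] 0) (𝓝 (dot (F.v P) d)) := by
    have := (hv 0 ⟨le_rfl, hη⟩).mono (Ioo_subset_Ico_self)
    rw [ContinuousWithinAt, nhdsWithin_Ioo_eq_nhdsGT hη] at this
    simpa using this
  obtain ⟨u, hu, hub⟩ := mem_nhdsGT_iff_exists_Ioo_subset.1 (hv0.eventually_const_lt hpos)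
  obtain ⟨t, ht⟩ : ∃ t, t ∈ Ioo 0 (min u η) := nonempty_Ioo.2 (lt_min hu hη)
  have htη : t < η := ht.2.trans_le (min_le_right _ _)
  have htu : t < u := ht.2.trans_le (min_le_left _ _)
  have hm : StrictMonoOn (fun t : ℝ => F.ψ (P + t • d)) (Icc 0 t) := by
    apply strictMonoOn_of_deriv_pos (convex_Icc 0 t)
    · exact hψ.mono fun x hx => ⟨hx.1, hx.2.trans_lt htη⟩
    · intro x hx
      rw [interior_Icc] at hx
      rw [(hd x ⟨hx.1, hx.2.trans htη⟩).2.deriv]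
      exact hub ⟨hx.1, hx.2.trans htu⟩
  have := hm (left_mem_Icc.2 ht.1.le) (right_mem_Icc.2 ht.1.le) ht.1
  refine ⟨_, (hd t ⟨ht.1, htη⟩).1, ?_⟩
  simpa using this

theorem hasDerivAt_line (P d : Plane) (t : ℝ) : HasDerivAt (fun x : ℝ => P + x • d) d t := by
  simpa using ((hasDerivAt_id t).smul_const d).const_add P

/-- The potential increases along a wall in the direction of positive velocity. -/
theorem exists_gt_of_wall_direction (h : IsGlobalRR G ρ₁ p I F) {P d : Plane} {η : ℝ}
    (hP : P ∈ closure F.Ω) (hη : 0 < η)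
    (hd : ∀ t ∈ Ioo (0 : ℝ) η, P + t • d ∈ frontier F.Ω ∧ P + t • d ∉ F.σ '' Icc 0 1)
    (hpos : 0 < dot (F.v P) d) : ∃ y ∈ closure F.Ω, F.ψ P < F.ψ y := by
  refine h.exists_gt_of_direction hP hη (fun t ht => ?_) hpos
  obtain ⟨h1, h2⟩ := hd t ht
  refine ⟨frontier_subset_closure h1, ?_⟩
  have hmaps : MapsTo (fun x : ℝ => P + x • d) (Ioo 0 η) p.closedSector := fun x hx =>
    h.closure_subset (frontier_subset_closure (hd x hx).1)
  have := (h.hasFDerivWithinAt_wall h1 h2).comp_hasDerivWithinAt t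
    (hasDerivAt_line P d t).hasDerivWithinAt hmaps
  exact this.hasDerivAt (Ioo_mem_nhds ht.1 ht.2)

/-! ### Position of the reflected shock and the state behind it -/

theorem σ_zero_one_pos (h : IsGlobalRR G ρ₁ p I F) {s : ℝ} (hs : s ∈ Ico (0 : ℝ) 1) :
    0 < F.σ s 1 := by
  rcases hs.1.eq_or_lt with rfl | h0
  · rw [h.shock_start]
    exact h.incident.ξR_one_pos
  · exact (h.shock_inside s ⟨h0, hs.2⟩).1

theorem dot_σ_pos (h : IsGlobalRR G ρ₁ p I F) {s : ℝ} (hs : s ∈ Ioc (0 : ℝ) 1) :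
    0 < dot (F.σ s) p.wallNormal := by
  rcases hs.2.eq_or_lt with rfl | h0
  · obtain ⟨a, ha, he⟩ := h.shock_end
    have := h.incident.sin_pos
    simp [he, dot_eq]
    positivity
  · exact (h.shock_inside s ⟨hs.1, h0⟩).2

theorem hasDerivWithinAt_σ (h : IsGlobalRR G ρ₁ p I F) {s : ℝ} (hs : s ∈ Icc (0 : ℝ) 1) :
    HasDerivWithinAt F.σ (F.tangent s) (Icc 0 1) s :=
  ((h.shock_C1.differentiableOn (by norm_num)) s hs).hasDerivWithinAt

theorem hasDerivAt_σ (h : IsGlobalRR G ρ₁ p I F) {s : ℝ} (hs : s ∈ Ioo (0 : ℝ) 1) :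
    HasDerivAt F.σ (F.tangent s) s :=
  (h.hasDerivWithinAt_σ ⟨hs.1.le, hs.2.le⟩).hasDerivAt (Icc_mem_nhds hs.1 hs.2)

theorem hasDerivAt_coord {f : ℝ → Plane} {f' : Plane} {s : ℝ} (hf : HasDerivAt f f' s) (i : Fin 2) :
    HasDerivAt (fun s => f s i) (f' i) s := by
  have := (EuclideanSpace.proj i : Plane →L[ℝ] ℝ).hasFDerivAt.comp_hasDerivAt s hf
  exact this

/-- The reflected shock stays to the left of the point with the velocity of the 2-sector. -/
theorem σ_zero_lt (h : IsGlobalRR G ρ₁ p I F) (hR : I.ξR 0 < 0) {s : ℝ}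
    (hs : s ∈ Icc (0 : ℝ) 1) : F.σ s 0 < I.v₂ 0 := by
  have hv := h.incident.v₂_zero_pos
  rcases hs.2.eq_or_lt with rfl | h1
  · obtain ⟨a, ha, he⟩ := h.shock_end
    simp only [he, vec_zero]
    linarith
  have hcont := h.shock_C1.continuousOn
  have hpos : ∀ x ∈ Icc 0 s, 0 < F.σ x 1 := fun x hx =>
    h.σ_zero_one_pos ⟨hx.1, hx.2.trans_lt h1⟩
  have hc : ∀ i : Fin 2, ContinuousOn (fun x => F.σ x i) (Icc 0 s) := fun i =>
    (continuous_apply_plane i).comp_continuousOn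
      (hcont.mono fun x hx => ⟨hx.1, hx.2.trans h1.le⟩)
  -- By `shock_upstream` the shock turns in one sense around the point `(v₂ 0, 0)`. The quotient, a
  -- cotangent of the polar angle about that point, starts negative at the reflection point and
  -- decreases.
  have hanti : AntitoneOn (fun x => (F.σ x 0 - I.v₂ 0) / F.σ x 1) (Icc 0 s) := by
    have hder : ∀ x ∈ Ioo 0 s, HasDerivAt (fun x => (F.σ x 0 - I.v₂ 0) / F.σ x 1)
        ((F.tangent x 0 * F.σ x 1 - (F.σ x 0 - I.v₂ 0) * F.tangent x 1) / F.σ x 1 ^ 2) x := by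
      intro x hx
      have d := h.hasDerivAt_σ ⟨hx.1, hx.2.trans h1⟩
      exact ((hasDerivAt_coord d 0).sub_const _).fun_div (hasDerivAt_coord d 1)
        (hpos x ⟨hx.1.le, hx.2.le⟩).ne'
    apply antitoneOn_of_deriv_nonpos (convex_Icc 0 s)
    · exact ((hc 0).sub continuousOn_const).div (hc 1) fun x hx => (hpos x hx).ne'
    · intro x hx
      rw [interior_Icc] at hx
      exact (hder x hx).differentiableAt.differentiableWithinAt
    · intro x hx
      rw [interior_Icc] at hx
      rw [(hder x hx).deriv]
      have hup := h.shock_upstream x ⟨hx.1.le, (hx.2.trans h1).le⟩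
      simp only [ReflectedFlow.normal, dot_eq, rot_zero, rot_one, PiLp.sub_apply,
        h.incident.v₂_slip] at hup
      apply div_nonpos_of_nonpos_of_nonneg _ (by positivity)
      linarith
  have h0 := hanti (left_mem_Icc.2 hs.1) (right_mem_Icc.2 hs.1) hs.1
  simp only at h0
  rw [h.shock_start] at h0
  have hneg : (I.ξR 0 - I.v₂ 0) / I.ξR 1 < 0 :=
    div_neg_of_neg_of_pos (by linarith) h.incident.ξR_one_pos
  have := h0.trans_lt hneg
  by_contra hcon
  push Not at hcon
  have h2 := hpos s (right_mem_Icc.2 hs.1)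
  have : 0 ≤ (F.σ s 0 - I.v₂ 0) / F.σ s 1 := div_nonneg (by linarith) h2.le
  linarith

/-- Continuity of `ψ` across the shock, combined with Bernoulli's law on both sides. -/
theorem bernoulli_σ (h : IsGlobalRR G ρ₁ p I F) {s : ℝ} (hs : s ∈ Icc (0 : ℝ) 1) :
    G.enthalpy I.ρ₂ + ‖I.v₂ - F.σ s‖ ^ 2 / 2 =
      G.enthalpy (F.ρ (F.σ s)) + ‖F.z (F.σ s)‖ ^ 2 / 2 := by
  have h1 := h.bernoulli _ (h.shock_subset hs)
  rw [h.shock_potential s hs, constPotential] at h1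
  have h2 : ‖I.v₂ - F.σ s‖ ^ 2 = ‖I.v₂‖ ^ 2 - 2 * dot I.v₂ (F.σ s) + ‖F.σ s‖ ^ 2 :=
    norm_sub_sq_real _ _
  rw [h2]
  linarith

/-- The flow at the reflection point is a local regular reflection. -/
theorem isReflected (h : IsGlobalRR G ρ₁ p I F) :
    ∃ n, IsReflected G p I n (F.ρ I.ξR) (F.v I.ξR) := by
  have hs : (0 : ℝ) ∈ Icc (0 : ℝ) 1 := by simp
  have hslip := h.slip_reflection_closed (right_mem_segment ℝ _ _)
  have ht0 := h.shock_regular 0 hs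
  have hm := h.shock_mass 0 hs
  have ht := h.shock_tangential 0 hs
  have hu := h.shock_upstream 0 hs
  have ha := h.shock_admissible 0 hs
  have hb := h.bernoulli_σ hs
  have hρ := h.ρ_pos _ (h.shock_subset hs)
  rw [h.shock_start] at hm ht hu ha hb hρ
  set t := F.tangent 0 with htdef
  have hn : F.normal 0 = rot t := rfl
  rw [hn] at hm hu ha
  have hz : F.z I.ξR = F.v I.ξR - I.ξR := rfl
  rw [hz] at hm ht ha hb
  have htpos : 0 < ‖t‖ := norm_pos_iff.2 ht0
  have htt := norm_sq_eq t
  have hrn : ‖rot t‖ = ‖t‖ := by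
    have : ‖rot t‖ ^ 2 = ‖t‖ ^ 2 := by
      rw [norm_sq_eq, norm_sq_eq, rot_zero, rot_one]
      ring
    exact (pow_left_inj₀ (norm_nonneg _) (norm_nonneg _) two_ne_zero).1 this
  have hdn : ∀ x : Plane, dot x (‖t‖⁻¹ • rot t) = ‖t‖⁻¹ * dot x (rot t) := fun x =>
    real_inner_smul_right _ _ _
  have hinv : 0 < ‖t‖⁻¹ := by positivity
  -- With zero strength `v₂` would persist behind the shock, but `v₂` points to the right and so
  -- violates slip on the reflection wall.
  have hstrict : dot (F.v I.ξR - I.ξR) (rot t) < dot (I.v₂ - I.ξR) (rot t) := by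
    refine lt_of_le_of_ne ha fun he => ?_
    have hv : F.v I.ξR = I.v₂ := by
      simp only [dot_eq, PiLp.sub_apply, rot_zero, rot_one] at he ht
      have hne : ‖t‖ ^ 2 ≠ 0 := by positivity
      rw [htt] at hne
      apply plane_ext
      · apply mul_left_cancel₀ hne
        linear_combination (-t 1) * he - t 0 * ht
      · apply mul_left_cancel₀ hne
        linear_combination t 0 * he - t 1 * ht
    rw [hv, dot_eq, h.incident.v₂_slip, Params.wallNormal_zero] at hslip
    have := mul_pos h.incident.v₂_zero_pos h.incident.sin_pos
    linarith
  refine ⟨‖t‖⁻¹ • rot t, ⟨⟨?_, hρ, ?_, ?_, ?_, ?_, hb⟩, hslip⟩⟩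
  · rw [norm_smul, norm_inv, norm_norm, hrn, inv_mul_cancel₀ htpos.ne']
  · rw [hdn]
    positivity
  · rw [hdn, hdn]
    gcongr
  · rw [hdn, hdn]
    linear_combination ‖t‖⁻¹ * hm
  · simp only [dot_eq, PiLp.smul_apply, smul_eq_mul, rot_zero, rot_one, PiLp.sub_apply] at ht ⊢
    linear_combination (-‖t‖⁻¹) * ht

/-- Where the shock is vertical and not to the left of the reflection point, the gas behind it
moves to the right. -/
theorem v_zero_pos_of_vertical (h : IsGlobalRR G ρ₁ p I F) (hR : I.ξR 0 < 0)
    (hw : WeakVerticalShock G I) {s : ℝ} (hs : s ∈ Icc (0 : ℝ) 1) (ht : F.tangent s 0 = 0)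
    (hx : I.ξR 0 ≤ F.σ s 0) : F.tangent s 1 < 0 ∧ 0 < F.v (F.σ s) 0 := by
  have hlt := h.σ_zero_lt hR hs
  have hm := h.shock_mass s hs
  have htan := h.shock_tangential s hs
  have hu := h.shock_upstream s hs
  have ha := h.shock_admissible s hs
  have hb := h.bernoulli_σ hs
  have hρ := h.ρ_pos _ (h.shock_subset hs)
  have hv := h.incident.v₂_zero_pos
  have hg : 0 < G.γ - 1 := by linarith [G.one_lt_γ]
  rw [norm_sq_eq, norm_sq_eq] at hb
  simp only [ReflectedFlow.normal, ReflectedFlow.z, dot_eq, rot_zero, rot_one, PiLp.sub_apply,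
    h.incident.v₂_slip, ht, mul_zero, add_zero, zero_add] at hm htan hu ha hb
  have ht1 : F.tangent s 1 < 0 := by
    by_contra hcon
    push Not at hcon
    nlinarith
  refine ⟨ht1, ?_⟩
  set D := I.v₂ 0 - F.σ s 0 with hD
  set w := F.v (F.σ s) 0 - F.σ s 0 with hwdef
  have hD0 : 0 < D := by rw [hD]; linarith
  have htan' := mul_right_cancel₀ ht1.ne htan
  rw [← htan'] at hb
  have hm' : I.ρ₂ * D = F.ρ (F.σ s) * w := by
    apply mul_right_cancel₀ (neg_ne_zero.2 ht1.ne)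
    linear_combination hm
  have hwD : w ≤ D := le_of_mul_le_mul_right ha (neg_pos.2 ht1)
  have hv0 : F.v (F.σ s) 0 = I.v₂ 0 - (D - w) := by rw [hD, hwdef]; ring
  rw [hv0]
  -- Admissibility permits zero strength, where the velocity stays `v₂`.
  rcases hwD.eq_or_lt with heq | hlt'
  · rw [heq]
    linarith
  obtain ⟨hr, hw0, hDr, hws⟩ := normal_speeds (G := G) h.incident.ρ₂_pos hρ hD0 hlt' hm'
    (by linarith)
  obtain ⟨r, hr1, hr2, hr3⟩ := hw
  have hC : 0 < G.soundSpeed I.ρ₂ ^ 2 := by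
    have := G.soundSpeed_pos h.incident.ρ₂_pos
    positivity
  set q := F.ρ (F.σ s) / I.ρ₂ with hq
  -- A shock further to the right meets a smaller upstream normal speed, hence has a smaller density
  -- ratio and velocity drop than the comparison shock of ratio `r`.
  have hDle : D ^ 2 ≤ (I.v₂ - I.ξR) 0 ^ 2 := by
    have : D ≤ (I.v₂ - I.ξR) 0 := by
      simp only [PiLp.sub_apply]
      linarith
    gcongr
  have hqr : q < r := by
    have h1 : D ^ 2 = G.soundSpeed I.ρ₂ ^ 2 * (q ^ 2 * downstreamSq (G.γ - 1) q) := by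
      rw [hDr, mul_pow, hws]
      ring
    have h2 := (h1 ▸ hDle).trans_lt hr2
    exact ((strictMonoOn_upstreamSq hg).lt_iff_lt hr hr1).1 (lt_of_mul_lt_mul_left h2 hC.le)
  have h3 : (D - w) ^ 2 < I.v₂ 0 ^ 2 := by
    refine lt_trans ?_ hr3
    have h4 : (D - w) ^ 2 = G.soundSpeed I.ρ₂ ^ 2 * ((q - 1) ^ 2 * downstreamSq (G.γ - 1) q) := by
      rw [hDr]
      linear_combination (q - 1) ^ 2 * hws
    rw [h4]
    exact mul_lt_mul_of_pos_left (strictMonoOn_strengthSq hg hr hr1 hqr) hC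
  have h5 := lt_of_pow_lt_pow_left₀ 2 hv.le h3
  linarith

/-- There is no global regular reflection if the gas at the reflection point moves along the wall
towards the corner while a vertical shock there is too weak to stop the gas of the 2-sector. -/
theorem false_of_weakVerticalShock (h : IsGlobalRR G ρ₁ p I F) (hR : I.ξR 0 < 0)
    (hw : WeakVerticalShock G I)
    (hq : ∀ n ρ v, IsReflected G p I n ρ v → ∃ q, ‖I.ξR‖ < q ∧ v - I.ξR = -(q • p.wallDir)) :
    False := by
  have hσ := h.shock_C1.continuousOn
  have hv := h.incident.v₂_zero_pos
  obtain ⟨s, hs, hmax⟩ := isCompact_Icc.exists_isMaxOn (⟨0, by simp⟩ : (Icc (0 : ℝ) 1).Nonempty)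
    ((continuous_apply_plane 0).comp_continuousOn hσ)
  have hmax' : ∀ x ∈ Icc (0 : ℝ) 1, F.σ x 0 ≤ F.σ s 0 := fun x hx => hmax hx
  -- On the shock `ψ` is affine with gradient `(v₂ 0, 0)` and `0 < v₂ 0`, so the rightmost point `σ
  -- s` maximizes it.
  have hbound : ∀ y ∈ closure F.Ω, F.ψ y ≤ F.ψ (F.σ s) := by
    intro y hy
    obtain ⟨x, hx, hle⟩ := h.exists_shock_ge hy
    refine hle.trans ?_
    rw [h.shock_potential x hx, h.shock_potential s hs]
    simp only [constPotential, dot_eq, h.incident.v₂_slip]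
    have := mul_le_mul_of_nonneg_left (hmax' x hx) hv.le
    linarith
  suffices hgt : ∃ y ∈ closure F.Ω, F.ψ (F.σ s) < F.ψ y by
    obtain ⟨y, hy, hlt⟩ := hgt
    exact absurd (hbound y hy) (not_le.2 hlt)
  have hPcl := h.shock_subset hs
  rcases hs.1.eq_or_lt with h0 | h0
  · subst h0
    rw [h.shock_start] at hPcl ⊢
    obtain ⟨n, hn⟩ := h.isReflected
    obtain ⟨q, hqlt, hqv⟩ := hq _ _ _ hn
    have hξ := h.incident.ξR_eq_norm_smul
    have hpos : 0 < ‖I.ξR‖ := norm_pos_iff.2 (by rintro h0; simp [h0] at hR)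
    refine h.exists_gt_of_wall_direction (d := -p.wallDir) hPcl hpos ?_ ?_
    · intro t ht
      have hmem : I.ξR + t • -p.wallDir ∈ segment ℝ 0 I.ξR := by
        refine ⟨t / ‖I.ξR‖, 1 - t / ‖I.ξR‖, div_nonneg ht.1.le hpos.le, ?_, by ring, ?_⟩
        · rw [sub_nonneg, div_le_one hpos]
          exact ht.2.le
        · rw [smul_zero, zero_add, sub_smul, one_smul, smul_neg, ← sub_eq_add_neg]
          congr 1
          conv_lhs => rw [hξ, smul_smul, norm_smul, p.norm_wallDir, mul_one, norm_norm,
            div_mul_cancel₀ _ hpos.ne']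
      refine ⟨h.reflection_subset hmem, ?_⟩
      rintro ⟨x, hx, he⟩
      rcases hx.1.eq_or_lt with hx0 | hx0
      · subst hx0
        rw [h.shock_start] at he
        have h1 : t • p.wallDir = 0 := by
          have : I.ξR + t • p.wallDir = I.ξR + 0 := by
            conv_lhs => rw [he]
            rw [smul_neg, neg_add_cancel_right, add_zero]
          exact add_left_cancel this
        have h2 : ‖t • p.wallDir‖ = 0 := by rw [h1, norm_zero]
        rw [norm_smul, p.norm_wallDir, mul_one, norm_eq_zero] at h2
        exact ht.1.ne' h2
      · have h1 := h.dot_σ_pos ⟨hx0, hx.2⟩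
        rw [he, h.reflection_eq hmem] at h1
        exact lt_irrefl _ h1
    -- Relative to the reflection point the gas moves faster than `‖I.ξR‖` in the direction of the
    -- corner, so it does so relative to the corner as well.
    · have h1 : F.v I.ξR = (‖I.ξR‖ - q) • p.wallDir := by
        rw [sub_smul, ← hξ, sub_eq_add_neg, ← hqv]
        abel
      have h2 := norm_sq_eq p.wallDir
      rw [p.norm_wallDir] at h2
      rw [h1, dot_smul_left']
      have h3 : dot p.wallDir (-p.wallDir) = -1 := by
        simp only [dot_eq, PiLp.neg_apply]
        linarith
      rw [h3]
      linarith
  -- At an interior maximum of the abscissa the tangent is vertical; at the endpoint the right angle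
  -- with the wall supplies this.
  have htan : F.tangent s 0 = 0 := by
    rcases hs.2.eq_or_lt with h1 | h1
    · rw [h1]
      exact h.shock_right_angle
    · have hloc : IsLocalMax (fun x => F.σ x 0) s := by
        filter_upwards [Icc_mem_nhds h0 h1] with x hx using hmax' x hx
      exact hloc.hasDerivAt_eq_zero (hasDerivAt_coord (h.hasDerivAt_σ ⟨h0, h1⟩) 0)
  have hx : I.ξR 0 ≤ F.σ s 0 := by
    rw [← h.shock_start]
    exact hmax' 0 (by simp)
  obtain ⟨ht1, hv0⟩ := h.v_zero_pos_of_vertical hR hw hs htan hx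
  have hnormal : F.normal s = !₂[-(F.tangent s 1), 0] := by
    apply plane_ext
    · simp [ReflectedFlow.normal]
    · simp [ReflectedFlow.normal, htan]
  have hdpos : 0 < dot (F.v (F.σ s)) (F.normal s) := by
    rw [hnormal, dot_eq]
    have := mul_pos hv0 (neg_pos.2 ht1)
    simpa using this
  -- At the endpoint the normal runs along the opposite wall, where `ψ` is differentiable from the
  -- wall lemma; at inner points it enters `Ω` by `Ω_downstream`.
  rcases hs.2.eq_or_lt with h1 | h1
  · subst h1
    obtain ⟨a, ha, he⟩ := h.shock_end
    refine h.exists_gt_of_wall_direction (η := a / -(F.tangent 1 1)) hPcl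
      (div_pos ha (neg_pos.2 ht1)) ?_ hdpos
    intro t ht
    have hk : 0 < t * -(F.tangent 1 1) := mul_pos ht.1 (neg_pos.2 ht1)
    have hk2 : t * -(F.tangent 1 1) < a := (lt_div_iff₀ (neg_pos.2 ht1)).1 ht.2
    have hpt : F.σ 1 + t • F.normal 1 = !₂[-a + t * -(F.tangent 1 1), 0] := by
      rw [he, hnormal]
      apply plane_ext <;> simp
    have hmem : F.σ 1 + t • F.normal 1 ∈ segment ℝ (F.σ 1) 0 := by
      refine ⟨1 - t * -(F.tangent 1 1) / a, t * -(F.tangent 1 1) / a, ?_, by positivity, by ring, ?_⟩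
      · rw [sub_nonneg, div_le_one ha]
        exact hk2.le
      · rw [hpt, he]
        apply plane_ext
        · simp
          field_simp
          ring
        · simp
    refine ⟨h.opposite_subset hmem, ?_⟩
    rintro ⟨x, hx, hxe⟩
    rcases hx.2.eq_or_lt with hx1 | hx1
    · subst hx1
      rw [hpt, he] at hxe
      have := congrArg (fun y : Plane => y 0) hxe
      simp only [Matrix.cons_val_zero] at this
      linarith
    · have h2 := h.σ_zero_one_pos ⟨hx.1, hx1⟩
      rw [hxe, h.opposite_eq hmem] at h2
      exact lt_irrefl _ h2
  · obtain ⟨η, hη, hηs⟩ := mem_nhdsGT_iff_exists_Ioo_subset.1 (h.Ω_downstream s ⟨h0, h1⟩)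
    refine h.exists_gt_of_direction hPcl hη (fun t ht => ?_) hdpos
    have hmem : F.σ s + t • F.normal s ∈ F.Ω := hηs ht
    have hder := (h.ψ_gradient _ hmem).hasFDerivAt.comp_hasDerivAt t
      (hasDerivAt_line (F.σ s) (F.normal s) t)
    exact ⟨subset_closure hmem, hder⟩

end IsGlobalRR

/-! ## Instability of strong-type trivial reflection -/

section instability

variable {G : Gas} {ρ₁ : ℝ} {p : Params}

/-- In a strong-type trivial reflection the gas behind the reflected shock is at rest. -/
theorem HasStrongTypeTrivialRR.exists_rest (h : HasStrongTypeTrivialRR G ρ₁ p) :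
    ∃ I n ρ₃, IsIncident G ρ₁ p I ∧ IsStrongType G p I n ρ₃ 0 := by
  obtain ⟨I, F, hF, -, n, ρ₃, v₃, hst, hconst⟩ := h
  have h0 : (0 : Plane) ∈ closure F.Ω :=
    frontier_subset_closure (hF.reflection_subset (left_mem_segment ℝ _ _))
  have hv : v₃ = 0 := by
    rw [← (hconst 0 h0).2]
    exact hF.v_corner
  subst hv
  exact ⟨I, n, ρ₃, hF.incident, hst⟩

/-- The unperturbed shock is exactly perpendicular to the opposite wall, so every rotation by `δ >
0` violates the angle condition. Weak and strong shocks at the reflection point persist by rotation;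
only the global flow is lost. -/
theorem eventually_unstable (hρ₁ : 0 < ρ₁) (hα : 0 < p.α) (hs : HasStrongTypeTrivialRR G ρ₁ p)
    (hw : HasTransonicWeakLocalRR G ρ₁ p) : ∀ᶠ δ in 𝓝[>] (0 : ℝ),
      HasTransonicWeakLocalRR G ρ₁ (p.perturb δ) ∧ ¬ AngleCondition G ρ₁ (p.perturb δ) ∧
        ¬ HasGlobalRR G ρ₁ (p.perturb δ) := by
  obtain ⟨I, n, ρ₃, hI, hst⟩ := hs.exists_rest
  obtain ⟨hn, ⟨D, h, a, R, T⟩, hq⟩ := hst.restingReflection hρ₁ hI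
  obtain ⟨I', hI', nw, ρw, vw, hweak, hlt⟩ := hw
  obtain rfl := hI.unique hρ₁ hI'
  have hpi := Real.pi_pos
  filter_upwards [T.eventually_perturb hρ₁ hI, T.eventually_rotate_neg, Ioo_mem_nhdsGT hα,
    Ioo_mem_nhdsGT hpi] with δ h1 h2 h3 h4
  obtain ⟨J, hJ⟩ := hI.exists_perturb h3.1.le h3.2.le h2
  refine ⟨⟨J, hJ, _, _, _, hweak.perturb hρ₁ hI hJ, ?_⟩, ?_, ?_⟩
  · rwa [add_sub_cancel_left, norm_rotate]
  · intro hang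
    have h5 := hang J hJ _ _ _ (hst.perturb hρ₁ hI hJ)
    have h6 : 0 ≤ Real.cos (InnerProductGeometry.angle (rot (rotate δ n)) (!₂[1, 0] : Plane)) :=
      Real.cos_nonneg_of_neg_pi_div_two_le_of_le
        (by linarith [InnerProductGeometry.angle_nonneg (rot (rotate δ n)) (!₂[1, 0] : Plane)]) h5
    -- As `n = (1, 0)`, the rotated tangent is `(-sin δ, cos δ)`, at an obtuse angle to the wall.
    have h7 : dot (rot (rotate δ n)) !₂[1, 0] = -Real.sin δ := by
      simp [hn, dot_eq]
    have h8 := Real.sin_pos_of_pos_of_lt_pi h4.1 h4.2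
    have h9 : 0 ≤ dot (rot (rotate δ n)) !₂[1, 0] := by
      rw [dot, ← InnerProductGeometry.cos_angle_mul_norm_mul_norm]
      positivity
    linarith
  · rintro ⟨K, F, hF⟩
    obtain ⟨k1, k2, k3⟩ := h1 K hF.incident
    refine hF.false_of_weakVerticalShock k2 k3 fun n' ρ' v' hr => ?_
    obtain ⟨q, hq1, hq2⟩ := hq δ K n' ρ' v' hF.incident hr
    exact ⟨q, k1.trans_le hq1, hq2⟩

theorem not_structurallyStable_of_eventually
    (h : ∀ᶠ δ in 𝓝[>] (0 : ℝ),
      HasTransonicWeakLocalRR G ρ₁ (p.perturb δ) ∧ ¬ AngleCondition G ρ₁ (p.perturb δ) ∧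
        ¬ HasGlobalRR G ρ₁ (p.perturb δ)) : ¬ StructurallyStable G ρ₁ p := by
  rintro ⟨ε, hε, hstab⟩
  obtain ⟨δ, ⟨⟨J, hJ, n, ρ₃, v₃, hw, -⟩, -, hno⟩, hδ⟩ := (h.and (Ioo_mem_nhdsGT hε)).exists
  have habs : |δ| < ε := by rw [abs_of_pos hδ.1]; exact hδ.2
  refine hno (hstab _ ?_ ?_ ?_ ⟨J, hJ, n, ρ₃, v₃, hw.1⟩)
  · simpa [Params.perturb] using hε
  · simpa [Params.perturb] using habs
  · simpa [Params.perturb] using habs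

end instability

/-! ## The triangle between a vertical shock and the walls -/

/-- The open triangle with corners `(-a, 0)`, `0` and `(-a, h)`. -/
def triangle (a h : ℝ) : Set Plane := {ξ | -a < ξ 0 ∧ 0 < ξ 1 ∧ h * ξ 0 + a * ξ 1 < 0}

/-- The closed triangle with corners `(-a, 0)`, `0` and `(-a, h)`. -/
def closedTriangle (a h : ℝ) : Set Plane := {ξ | -a ≤ ξ 0 ∧ 0 ≤ ξ 1 ∧ h * ξ 0 + a * ξ 1 ≤ 0}

section triangle

variable {a h : ℝ}

theorem isOpen_triangle : IsOpen (triangle a h) :=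
  (isOpen_lt continuous_const (continuous_apply_plane 0)).inter
    ((isOpen_lt continuous_const (continuous_apply_plane 1)).inter
      (isOpen_lt ((continuous_const.mul (continuous_apply_plane 0)).add
        (continuous_const.mul (continuous_apply_plane 1))) continuous_const))

theorem isClosed_closedTriangle : IsClosed (closedTriangle a h) :=
  (isClosed_le continuous_const (continuous_apply_plane 0)).inter
    ((isClosed_le continuous_const (continuous_apply_plane 1)).inter
      (isClosed_le ((continuous_const.mul (continuous_apply_plane 0)).add
        (continuous_const.mul (continuous_apply_plane 1))) continuous_const))

theorem triangle_subset : triangle a h ⊆ closedTriangle a h :=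
  fun _ hx => ⟨hx.1.le, hx.2.1.le, hx.2.2.le⟩

theorem centroid_mem_triangle (ha : 0 < a) (hh : 0 < h) :
    (!₂[-(2 * a / 3), h / 3] : Plane) ∈ triangle a h := by
  have := mul_pos ha hh
  refine ⟨?_, ?_, ?_⟩
  · rw [vec_zero]; linarith
  · rw [vec_one]; linarith
  · rw [vec_zero, vec_one]; linarith

theorem combo_mem_triangle {x y : Plane} (hx : x ∈ closedTriangle a h) (hy : y ∈ triangle a h)
    {s t : ℝ} (hs : 0 ≤ s) (ht : 0 < t) (hst : s + t = 1) : s • x + t • y ∈ triangle a h := by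
  obtain ⟨x1, x2, x3⟩ := hx
  obtain ⟨y1, y2, y3⟩ := hy
  refine ⟨?_, ?_, ?_⟩
  · simp only [PiLp.add_apply, PiLp.smul_apply, smul_eq_mul]
    have e : s * a + t * a = a := by rw [← add_mul, hst, one_mul]
    have := mul_nonneg hs (sub_nonneg.2 x1)
    have := mul_pos ht (sub_pos.2 y1)
    linarith
  · simp only [PiLp.add_apply, PiLp.smul_apply, smul_eq_mul]
    have := mul_nonneg hs x2
    have := mul_pos ht y2
    linarith
  · simp only [PiLp.add_apply, PiLp.smul_apply, smul_eq_mul]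
    nlinarith

theorem convex_triangle : Convex ℝ (triangle a h) := by
  intro x hx y hy s t hs ht hst
  rcases ht.eq_or_lt with rfl | ht
  · have : s = 1 := by linarith
    subst this
    simpa using hx
  · exact combo_mem_triangle (triangle_subset hx) hy hs ht hst

theorem closure_triangle (ha : 0 < a) (hh : 0 < h) :
    closure (triangle a h) = closedTriangle a h := by
  refine subset_antisymm (closure_minimal triangle_subset isClosed_closedTriangle) fun x hx => ?_
  set y : Plane := !₂[-(2 * a / 3), h / 3]
  have hc : Tendsto (fun t : ℝ => (1 - t) • x + t • y) (𝓝[>] 0) (𝓝 x) := by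
    have : Continuous fun t : ℝ => (1 - t) • x + t • y := by fun_prop
    simpa using (this.tendsto 0).mono_left nhdsWithin_le_nhds
  refine mem_closure_of_tendsto hc ?_
  filter_upwards [Ioo_mem_nhdsGT one_pos] with t ht
  exact combo_mem_triangle hx (centroid_mem_triangle ha hh) (by linarith [ht.2]) ht.1 (by ring)

/-- With gas at rest `z = -ξ`, so the pseudo-speed is bounded by that at the reflection point and
ellipticity need only be checked there. -/
theorem norm_sq_lt_of_mem_triangle (ha : 0 < a) (hh : 0 < h) {ξ : Plane}
    (hξ : ξ ∈ triangle a h) : ‖ξ‖ ^ 2 < a ^ 2 + h ^ 2 := by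
  obtain ⟨h1, h2, h3⟩ := hξ
  have hx : ξ 0 < 0 := by
    by_contra hcon
    push Not at hcon
    nlinarith [mul_nonneg hh.le hcon, mul_pos ha h2]
  have hy : ξ 1 < h := by
    by_contra hcon
    push Not at hcon
    nlinarith
  rw [norm_sq_eq]
  nlinarith

theorem vertical_segment_eq : segment ℝ (!₂[-a, h] : Plane) !₂[-a, 0] =
    {ξ | ξ 0 = -a ∧ ∃ s ∈ Icc (0 : ℝ) 1, ξ 1 = h - s * h} := by
  rw [segment_eq_image']
  ext ξ
  constructor
  · rintro ⟨s, hs, rfl⟩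
    refine ⟨by simp, s, hs, by simp; ring⟩
  · rintro ⟨h0, s, hs, h1⟩
    refine ⟨s, hs, ?_⟩
    apply plane_ext
    · simp [h0]
    · simp [h1]
      ring

theorem frontier_triangle (ha : 0 < a) (hh : 0 < h) : frontier (triangle a h) =
    segment ℝ (!₂[-a, h] : Plane) !₂[-a, 0] ∪ segment ℝ !₂[-a, 0] 0 ∪ segment ℝ 0 !₂[-a, h] := by
  have hah := mul_pos ha hh
  rw [isOpen_triangle.frontier_eq, closure_triangle ha hh, vertical_segment_eq]
  ext ξ
  constructor
  · rintro ⟨⟨h1, h2, h3⟩, hn⟩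
    by_cases e1 : -a < ξ 0
    · by_cases e2 : 0 < ξ 1
      · have e3 : h * ξ 0 + a * ξ 1 = 0 := by
          by_contra hcon
          exact hn ⟨e1, e2, lt_of_le_of_ne h3 hcon⟩
        refine Or.inr ⟨1 + ξ 0 / a, -(ξ 0) / a, ?_, ?_, by ring, ?_⟩
        · rw [← neg_le_iff_add_nonneg', le_div_iff₀ ha]
          linarith
        · apply div_nonneg _ ha.le
          nlinarith
        · apply plane_ext
          · simp
            field_simp
          · simp
            field_simp
            linarith
      · have e3 : ξ 1 = 0 := le_antisymm (not_lt.1 e2) h2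
        have e4 : ξ 0 ≤ 0 := by
          rw [e3] at h3
          nlinarith
        refine Or.inl (Or.inr ⟨-(ξ 0) / a, 1 + ξ 0 / a, ?_, ?_, by ring, ?_⟩)
        · exact div_nonneg (by linarith) ha.le
        · rw [← neg_le_iff_add_nonneg', le_div_iff₀ ha]
          linarith
        · apply plane_ext
          · simp
            field_simp
          · simp [e3]
    · have e3 : ξ 0 = -a := le_antisymm (not_lt.1 e1) h1
      have e4 : ξ 1 ≤ h := by
        rw [e3] at h3
        nlinarith
      refine Or.inl (Or.inl ⟨e3, 1 - ξ 1 / h, ⟨?_, ?_⟩, ?_⟩)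
      · rw [sub_nonneg, div_le_one hh]
        exact e4
      · have : 0 ≤ ξ 1 / h := div_nonneg h2 hh.le
        linarith
      · field_simp
        ring
  · rintro ((⟨h0, s, hs, h1⟩ | ⟨s, t, hs, ht, hst, rfl⟩) | ⟨s, t, hs, ht, hst, rfl⟩)
    · refine ⟨⟨by rw [h0], ?_, ?_⟩, fun hm => ?_⟩
      · rw [h1]
        nlinarith [hs.2]
      · rw [h0, h1]
        nlinarith [mul_nonneg hs.1 hah.le]
      · have := hm.1
        rw [h0] at this
        exact lt_irrefl _ this
    · have ht' : t = 1 - s := by linarith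
      refine ⟨⟨?_, ?_, ?_⟩, fun hm => ?_⟩
      · simp
        nlinarith
      · simp
      · simp
        nlinarith [mul_nonneg hs hah.le]
      · have := hm.2.1
        simp at this
    · have hs' : s = 1 - t := by linarith
      refine ⟨⟨?_, ?_, ?_⟩, fun hm => ?_⟩
      · simp
        nlinarith
      · simp
        positivity
      · simp
        nlinarith
      · have := hm.2.2
        simp at this
        nlinarith

end triangle

/-! ## Construction of trivial reflections -/

/-- The flow at rest in the triangle behind a vertical reflected shock. -/
def restFlow (G : Gas) (a h ρ₃ : ℝ) : ReflectedFlow where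
  σ s := !₂[-a, h] + s • (!₂[-a, 0] - !₂[-a, h])
  Ω := triangle a h
  ψ _ := -G.enthalpy ρ₃
  v _ := 0
  ρ _ := ρ₃

section restFlow

variable {G : Gas} {a h ρ₃ : ℝ}

theorem restFlow_σ_zero (s : ℝ) : (restFlow G a h ρ₃).σ s 0 = -a := by simp [restFlow]

theorem restFlow_σ_one (s : ℝ) : (restFlow G a h ρ₃).σ s 1 = h - s * h := by
  simp [restFlow]
  ring

theorem restFlow_tangent {s : ℝ} (hs : s ∈ Icc (0 : ℝ) 1) :
    (restFlow G a h ρ₃).tangent s = !₂[0, -h] := by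
  have hd : HasDerivAt (restFlow G a h ρ₃).σ (!₂[-a, 0] - !₂[-a, h]) s :=
    IsGlobalRR.hasDerivAt_line _ _ s
  rw [ReflectedFlow.tangent,
    hd.hasDerivWithinAt.derivWithin (uniqueDiffOn_Icc one_pos s hs)]
  apply plane_ext <;> simp

theorem restFlow_image : (restFlow G a h ρ₃).σ '' Icc 0 1 =
    segment ℝ (!₂[-a, h] : Plane) !₂[-a, 0] := (segment_eq_image' ℝ _ _).symm

theorem restFlow_end : (restFlow G a h ρ₃).σ 1 = !₂[-a, 0] := by
  apply plane_ext
  · simp [restFlow_σ_zero]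
  · simp [restFlow_σ_one]

theorem restFlow_divergence (ξ : Plane) :
    divergence (fun η => (restFlow G a h ρ₃).ρ η • (restFlow G a h ρ₃).z η) ξ = -(2 * ρ₃) := by
  have hd : HasFDerivAt (fun η : Plane => (restFlow G a h ρ₃).ρ η • (restFlow G a h ρ₃).z η)
      (ρ₃ • (0 - ContinuousLinearMap.id ℝ Plane)) ξ :=
    (((hasFDerivAt_const (0 : Plane) ξ).sub (hasFDerivAt_id ξ)).const_smul ρ₃)
  rw [divergence, hd.fderiv, Fin.sum_univ_two]
  simp
  ring

/-- Regular reflection with a vertical reflected shock and gas at rest behind it. -/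
theorem isGlobalRR_restFlow {ρ₁ D R : ℝ} {p : Params} {I : Incident} (hI : IsIncident G ρ₁ p I)
    (hα : 0 < Real.cos p.α) (ha : 0 < a) (hh : 0 < h) (hR : 1 < R) (hD : D = R * a)
    (hξ : I.ξR = !₂[-a, h]) (hv : I.v₂ = !₂[D - a, 0])
    (hb : G.enthalpy I.ρ₂ + D ^ 2 / 2 = G.enthalpy (R * I.ρ₂) + a ^ 2 / 2)
    (hc : a ^ 2 + h ^ 2 < G.soundSpeed (R * I.ρ₂) ^ 2) :
    IsGlobalRR G ρ₁ p I (restFlow G a h (R * I.ρ₂)) := by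
  have hρ := hI.ρ₂_pos
  have hρ₃ : 0 < R * I.ρ₂ := by positivity
  have hc3 := G.soundSpeed_pos hρ₃
  have haD : a < D := by rw [hD]; nlinarith
  have hr : 0 < ‖I.ξR‖ := norm_pos_iff.2 (by
    rw [hξ]
    intro h0
    have := congrArg (fun x : Plane => x 1) h0
    simp at this
    exact hh.ne' this)
  have e0 : -a = ‖I.ξR‖ * Real.cos p.θ := by
    have := congrArg (fun x : Plane => x 0) hI.ξR_eq_norm_smul
    conv_lhs at this => rw [hξ]
    simpa using this
  have e1 : h = ‖I.ξR‖ * Real.sin p.θ := by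
    have := congrArg (fun x : Plane => x 1) hI.ξR_eq_norm_smul
    conv_lhs at this => rw [hξ]
    simpa using this
  have hN : ∀ ξ : Plane, ‖I.ξR‖ * dot ξ p.wallNormal = -(h * ξ 0 + a * ξ 1) := by
    intro ξ
    simp only [dot_eq, Params.wallNormal_zero, Params.wallNormal_one]
    linear_combination ξ 0 * e1 - ξ 1 * e0
  have hsector : ∀ ξ : Plane, 0 < ξ 1 → h * ξ 0 + a * ξ 1 < 0 → ξ ∈ p.sector := by
    intro ξ h1 h2
    refine ⟨h1, ?_⟩
    have : 0 < ‖I.ξR‖ * dot ξ p.wallNormal := by rw [hN]; linarith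
    exact (mul_pos_iff_of_pos_left hr).1 this
  have hnormal : ∀ s ∈ Icc (0 : ℝ) 1, (restFlow G a h (R * I.ρ₂)).normal s = !₂[h, 0] := by
    intro s hs
    rw [ReflectedFlow.normal, restFlow_tangent hs]
    apply plane_ext <;> simp
  have hz : ∀ ξ, (restFlow G a h (R * I.ρ₂)).z ξ = -ξ := fun ξ => zero_sub ξ
  have hσ0 := fun s => restFlow_σ_zero (G := G) (a := a) (h := h) (ρ₃ := R * I.ρ₂) s
  have hσ1 := fun s => restFlow_σ_one (G := G) (a := a) (h := h) (ρ₃ := R * I.ρ₂) s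
  have hv0 : I.v₂ 0 = D - a := by simp [hv]
  have hv1 : I.v₂ 1 = 0 := by simp [hv]
  exact
  { incident := hI
    shock_C1 := by
      have : ContDiff ℝ 1 (restFlow G a h (R * I.ρ₂)).σ := by
        unfold restFlow
        fun_prop
      exact this.contDiffOn
    shock_regular := by
      intro s hs h0
      rw [restFlow_tangent hs] at h0
      have := congrArg (fun x : Plane => x 1) h0
      simp at this
      exact hh.ne' this
    shock_simple := by
      intro s _ t _ hst
      have := congrArg (fun x : Plane => x 1) hst
      simp only [hσ1] at this
      exact mul_right_cancel₀ hh.ne' (by linarith)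
    shock_start := by
      rw [hξ]
      apply plane_ext
      · simp [hσ0]
      · simp [hσ1]
    shock_inside := by
      intro s hs
      apply hsector
      · rw [hσ1]
        nlinarith [hs.2]
      · rw [hσ0, hσ1]
        nlinarith [mul_pos ha hh, mul_pos hs.1 (mul_pos ha hh)]
    shock_end := ⟨a, ha, restFlow_end⟩
    shock_right_angle := by
      rw [restFlow_tangent (by simp)]
      simp
    shock_incident := by
      rintro s hs ⟨l, hl, he⟩
      have k0 := congrArg (fun x : Plane => x 0) he
      have k1 := congrArg (fun x : Plane => x 1) he
      simp only [hσ0, hσ1, hξ, Params.incidentDir] at k0 k1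
      simp at k0 k1
      -- The reflected shock is vertical and the incident one is not, so equal abscissas mean `l =
      -- 0`.
      rcases k0 with k0 | k0
      · rw [k0, zero_mul] at k1
        have := mul_pos hs.1 hh
        linarith
      · exact hα.ne' k0
    Ω_open := isOpen_triangle
    Ω_connected := convex_triangle.isConnected ⟨_, centroid_mem_triangle ha hh⟩
    Ω_bounded := by
      refine (Metric.isBounded_ball (x := (0 : Plane)) (r := a + h)).subset fun ξ hξ => ?_
      rw [mem_ball_zero_iff]
      have h1 := norm_sq_lt_of_mem_triangle ha hh hξ
      have h2 : ‖ξ‖ ^ 2 < (a + h) ^ 2 := by nlinarith [mul_pos ha hh]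
      exact lt_of_pow_lt_pow_left₀ 2 (by positivity) h2
    Ω_sector := fun ξ hξ => hsector ξ hξ.2.1 hξ.2.2
    Ω_frontier := by
      rw [restFlow_image, restFlow_end, hξ]
      exact frontier_triangle ha hh
    Ω_downstream := by
      intro s hs
      have hpos : 0 < a * s / h := div_pos (mul_pos ha hs.1) hh
      filter_upwards [Ioo_mem_nhdsGT hpos] with t ht
      have h2 := (lt_div_iff₀ hh).1 ht.2
      rw [hnormal s ⟨hs.1.le, hs.2.le⟩]
      refine ⟨?_, ?_, ?_⟩
      · simp [hσ0]
        exact mul_pos ht.1 hh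
      · simp [hσ1]
        nlinarith [hs.2]
      · simp [hσ0, hσ1]
        nlinarith
    ψ_continuous := continuousOn_const
    v_continuous := continuousOn_const
    ρ_continuous := continuousOn_const
    ρ_pos := fun _ _ => hρ₃
    ψ_C2 := contDiffOn_const
    ψ_gradient := fun ξ _ => hasGradientAt_const ξ _
    bernoulli := by
      intro ξ _
      rw [hz, norm_neg]
      simp only [restFlow]
      ring
    potential_flow := by
      intro ξ _
      rw [restFlow_divergence]
      simp [restFlow]
    elliptic := by
      intro ξ hξ
      rw [hz, norm_neg]
      exact lt_of_pow_lt_pow_left₀ 2 hc3.le ((norm_sq_lt_of_mem_triangle ha hh hξ).trans hc)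
    slip_opposite := fun ξ _ => rfl
    slip_reflection := by
      intro ξ _
      simp [restFlow, dot_eq]
    shock_potential := by
      intro s _
      rw [constPotential, dot_eq, norm_sq_eq, hv0, hv1, hσ0]
      simp only [restFlow]
      linear_combination hb
    shock_mass := by
      intro s hs
      rw [hnormal s hs, hz]
      simp [dot_eq, hv0, restFlow]
      rw [hD]
      ring
    shock_tangential := by
      intro s hs
      rw [restFlow_tangent hs, hz]
      simp [dot_eq, hσ1, hv1]
    shock_upstream := by
      intro s hs
      rw [hnormal s hs]
      simp [dot_eq, hσ0, hv0]
      exact mul_pos (by linarith) hh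
    shock_admissible := by
      intro s hs
      rw [hnormal s hs, hz]
      simp [dot_eq, hσ0, hv0]
      nlinarith }

end restFlow

/-! ## Parameters of unstable trivial reflections -/

/-- The vertical shock from `(-a, h)` is of strong type and there is a transonic weak-type one:
the polar is positive at a subsonic speed `q` above the speed of the gas at rest. -/
structure WeakShockBound (g C D h a q : ℝ) : Prop where
  lt_q : √(a ^ 2 + h ^ 2) < q
  q_lt : q < (D * a + h ^ 2) / √(a ^ 2 + h ^ 2)
  subsonic : q ^ 2 < C + g * (D ^ 2 + h ^ 2 - q ^ 2) / 2
  polar_pos : 0 < polar g C (D ^ 2 + h ^ 2) ((D * a + h ^ 2) / √(a ^ 2 + h ^ 2)) q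

/-- Bernoulli's law in the normal direction, giving the squared sound speed of the gas at rest. -/
theorem sonic_resting {g C D a R : ℝ} (hg : 0 < g) (hR : 1 < R) (hD : D = R * a)
    (ha2 : a ^ 2 = C * downstreamSq g R) : C + g * (D ^ 2 - a ^ 2) / 2 = C * R ^ g := by
  have h2 : R ^ 2 - 1 ≠ 0 := by nlinarith
  rw [hD, mul_pow, ha2, downstreamSq]
  field_simp
  ring

theorem resting_bounds {D a h : ℝ} (ha : 0 < a) (hh : 0 < h) (haD : a < D) :
    0 < √(a ^ 2 + h ^ 2) ∧ √(a ^ 2 + h ^ 2) ^ 2 = a ^ 2 + h ^ 2 ∧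
      √(a ^ 2 + h ^ 2) < (D * a + h ^ 2) / √(a ^ 2 + h ^ 2) ∧
      ((D * a + h ^ 2) / √(a ^ 2 + h ^ 2)) ^ 2 ≤ D ^ 2 + h ^ 2 := by
  have hr : 0 < √(a ^ 2 + h ^ 2) := by positivity
  have hr2 : √(a ^ 2 + h ^ 2) ^ 2 = a ^ 2 + h ^ 2 := Real.sq_sqrt (by positivity)
  refine ⟨hr, hr2, ?_, ?_⟩
  · rw [lt_div_iff₀ hr, ← sq, hr2]
    nlinarith
  · rw [div_pow, div_le_iff₀ (by positivity), hr2]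
    nlinarith [sq_nonneg (D * h - a * h)]

/-- The state at rest is a zero of the polar. -/
theorem polar_resting {g C D h a R : ℝ} (hg : 0 < g) (hC : 0 < C) (hR : 1 < R) (ha : 0 < a)
    (hh : 0 < h) (hD : D = R * a) (ha2 : a ^ 2 = C * downstreamSq g R) :
    polar g C (D ^ 2 + h ^ 2) ((D * a + h ^ 2) / √(a ^ 2 + h ^ 2)) √(a ^ 2 + h ^ 2) = 0 := by
  have haD : a < D := by rw [hD]; nlinarith
  obtain ⟨hr, hr2, hrm, hmZ⟩ := resting_bounds ha hh haD
  rw [polar_eq_zero_iff hg hC hmZ hr hrm]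
  set r := √(a ^ 2 + h ^ 2)
  have e1 : C + g * (D ^ 2 + h ^ 2 - r ^ 2) / 2 = C * R ^ g := by
    rw [← sonic_resting hg hR hD ha2, hr2]
    ring
  rw [e1, mul_div_cancel_left₀ _ hC.ne', ← Real.rpow_mul (by linarith), mul_one_div_cancel hg.ne',
    Real.rpow_one, mul_sub, mul_div_cancel₀ _ hr.ne', ← sq, hr2, hD]
  ring

/-- The angle `θ` is the polar angle of `(-a, h)`. The bounds on `α + θ` follow from the signs of
its cosine and sine; the sine is positive by `eq1` and `a < D`. -/
theorem exists_wall_angle {a h α D W : ℝ} (ha : 0 < a) (hh : 0 < h) (hα : 0 < α)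
    (hα' : α < Real.pi / 2) (haD : a < D) (hW : 0 < W)
    (eq1 : h * Real.cos α - D * Real.sin α = W) :
    ∃ θ, 0 < θ ∧ Real.cos θ = -(a / √(a ^ 2 + h ^ 2)) ∧ Real.sin θ = h / √(a ^ 2 + h ^ 2) ∧
      Real.pi / 2 < α + θ ∧ α + θ < Real.pi := by
  obtain ⟨hr, hr2, -, -⟩ := resting_bounds ha hh haD
  have hcos : 0 < Real.cos α := Real.cos_pos_of_mem_Ioo ⟨by linarith, hα'⟩
  have hsin : 0 < Real.sin α := Real.sin_pos_of_pos_of_lt_pi hα (by linarith)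
  have hpi := Real.pi_pos
  set r := √(a ^ 2 + h ^ 2) with hrdef
  have har : a / r < 1 := by
    rw [div_lt_one hr]
    have : 0 < h ^ 2 := by positivity
    exact lt_of_pow_lt_pow_left₀ 2 hr.le (by linarith)
  have har0 : 0 < a / r := by positivity
  set θ := Real.arccos (-(a / r)) with hθ
  have hcθ : Real.cos θ = -(a / r) := Real.cos_arccos (by linarith) (by linarith)
  have hsθ : Real.sin θ = h / r := by
    rw [hθ, Real.sin_arccos, neg_sq, div_pow, hr2]
    have : 1 - a ^ 2 / (a ^ 2 + h ^ 2) = (h / r) ^ 2 := by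
      rw [div_pow, hr2]
      field_simp
      ring
    rw [this, Real.sqrt_sq (by positivity)]
  have hθ0 : 0 < θ := Real.arccos_pos.2 (by linarith)
  have hθπ : θ ≤ Real.pi := Real.arccos_le_pi _
  refine ⟨θ, hθ0, hcθ, hsθ, ?_, ?_⟩
  · by_contra hcon
    push Not at hcon
    have h1 : 0 ≤ Real.cos (α + θ) :=
      Real.cos_nonneg_of_neg_pi_div_two_le_of_le (by linarith) hcon
    have h2 : Real.cos (α + θ) = -((a * Real.cos α + h * Real.sin α) / r) := by
      rw [Real.cos_add, hcθ, hsθ]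
      ring
    have h3 : 0 < (a * Real.cos α + h * Real.sin α) / r := by positivity
    linarith
  · by_contra hcon
    push Not at hcon
    have h1 : Real.sin (α + θ - Real.pi) = -Real.sin (α + θ) := Real.sin_sub_pi _
    have h2 : 0 ≤ Real.sin (α + θ - Real.pi) :=
      Real.sin_nonneg_of_nonneg_of_le_pi (by linarith) (by linarith)
    have h3 : Real.sin (α + θ) = (h * Real.cos α - a * Real.sin α) / r := by
      rw [Real.sin_add, hcθ, hsθ]
      ring
    have h4 : 0 < (h * Real.cos α - a * Real.sin α) / r := by
      apply div_pos _ hr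
      have := mul_lt_mul_of_pos_right haD hsin
      linarith
    linarith

/-- A strong-type vertical shock is transonic. -/
theorem subsonic_of_strong {a D h c : ℝ} (ha : 0 < a) (hD : 0 < D) (hh : 0 < h) (hc : 0 < c)
    (hs : h ^ 2 * (c + a * D) ≤ a * D * (c - a ^ 2)) : a ^ 2 + h ^ 2 < c := by
  have h1 : 0 < a * D := by positivity
  have h2 : 0 < h ^ 2 * c := by positivity
  have h3 : h ^ 2 * (a * D) < (c - a ^ 2) * (a * D) := by linarith
  have := lt_of_mul_lt_mul_right h3 h1.le
  linarith

/-- The incident shock of a trivial reflection, in terms of its equations. -/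
theorem exists_isIncident_of_eqs {G : Gas} {ρ₁ b α a D h W : ℝ} (hρ₁ : 0 < ρ₁)
    (hb : 1 < b) (hα : 0 < α) (hα' : α < Real.pi / 2) (ha : 0 < a) (hh : 0 < h) (haD : a < D)
    (hW : 0 < W) (hW2 : W ^ 2 = G.soundSpeed ρ₁ ^ 2 * downstreamSq (G.γ - 1) b)
    (eq1 : h * Real.cos α - D * Real.sin α = W)
    (eq2 : (b - 1) * W * (h * Real.sin α + a * Real.cos α) = (D - a) * h) :
    ∃ p I, p.α = α ∧ IsIncident G ρ₁ p I ∧ I.ξR = !₂[-a, h] ∧ I.ρ₂ = b * ρ₁ ∧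
      I.v₂ = !₂[D - a, 0] := by
  obtain ⟨θ, hθ0, hcθ, hsθ, hacute, hsum⟩ := exists_wall_angle ha hh hα hα' haD hW eq1
  obtain ⟨hr, hr2, -, -⟩ := resting_bounds ha hh haD
  have hc1 := G.soundSpeed_pos hρ₁
  set r := √(a ^ 2 + h ^ 2) with hrdef
  set κ := (b - 1) * W with hκ
  -- Chosen to match the vertical component of the upstream pseudo-velocity `(D, -h) + κ • n`; the
  -- horizontal one then matches by `eq2`, which says that this vector is parallel to the reflection
  -- wall.
  set M := (h + κ * Real.cos α) / (Real.sin θ * G.soundSpeed ρ₁) with hM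
  have hMc : M * G.soundSpeed ρ₁ = (h + κ * Real.cos α) * r / h := by
    rw [hM, hsθ]
    field_simp
  have hz1 : -(M * G.soundSpeed ρ₁) • (!₂[-(a / r), h / r] : Plane) =
      !₂[D - κ * Real.sin α, -(h + κ * Real.cos α)] := by
    apply plane_ext
    · rw [PiLp.smul_apply, hMc, vec_zero, vec_zero, smul_eq_mul]
      field_simp
      linarith
    · rw [PiLp.smul_apply, hMc, vec_one, vec_one, smul_eq_mul]
      field_simp
  have hz2 : (!₂[D - a, 0] : Plane) - !₂[-a, h] = !₂[D, -h] := by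
    apply plane_ext <;> simp
  have hκ0 : 0 < κ := mul_pos (by linarith) hW
  have hwd : ∀ p : Params, p.θ = θ → p.wallDir = !₂[-(a / r), h / r] := by
    intro p hp
    apply plane_ext
    · rw [Params.wallDir_zero, hp, hcθ, vec_zero]
    · rw [Params.wallDir_one, hp, hsθ, vec_one]
  have hn1 : ∀ p : Params, p.α = α →
      dot !₂[D - κ * Real.sin α, -(h + κ * Real.cos α)] p.incidentNormal = b * W := by
    intro p hp
    rw [dot_eq, Params.incidentNormal_zero, Params.incidentNormal_one, vec_zero, vec_one, hp]
    linear_combination eq1 + κ * Real.sin_sq_add_cos_sq α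
  have hn2 : ∀ p : Params, p.α = α → dot !₂[D, -h] p.incidentNormal = W := by
    intro p hp
    rw [dot_eq, Params.incidentNormal_zero, Params.incidentNormal_one, vec_zero, vec_one, hp]
    linear_combination eq1
  have h1 := normal_speeds_bernoulli hρ₁ hb hW2
  refine ⟨⟨M, α, θ⟩, ⟨!₂[-a, h], !₂[-a, h] + !₂[D - κ * Real.sin α, -(h + κ * Real.cos α)],
    b * ρ₁, !₂[D - a, 0]⟩, rfl, ⟨hα.le, hθ0, hacute, hsum, ⟨r, hr, ?_⟩, ?_, rfl, ?_⟩, rfl, rfl, rfl⟩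
  · rw [hwd _ rfl]
    apply plane_ext
    · simp
      field_simp
    · simp
      field_simp
  · rw [hwd _ rfl]
    simp only [add_sub_cancel_left]
    exact hz1.symm
  · simp only [add_sub_cancel_left]
    rw [hz2]
    refine ⟨?_, by positivity, ?_, ?_, ?_, ?_, ?_⟩
    · have : ‖(⟨M, α, θ⟩ : Params).incidentNormal‖ ^ 2 = 1 := by
        rw [norm_sq_eq]
        simp
      exact (pow_eq_one_iff_of_nonneg (norm_nonneg _) two_ne_zero).1 this
    · rw [hn1 _ rfl]; positivity
    · rw [hn1 _ rfl, hn2 _ rfl]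
      exact lt_mul_of_one_lt_left hW hb
    · rw [hn1 _ rfl, hn2 _ rfl]; ring
    · simp [dot_eq]
      ring
    · rw [norm_sq_eq, norm_sq_eq, vec_zero, vec_one, vec_zero, vec_one]
      have h2 : (D - κ * Real.sin α) ^ 2 + (-(h + κ * Real.cos α)) ^ 2 =
          D ^ 2 + (-h) ^ 2 + (b * W) ^ 2 - W ^ 2 := by
        linear_combination 2 * κ * eq1 + κ ^ 2 * Real.sin_sq_add_cos_sq α
      linarith

/-- A vertical reflected shock with gas at rest behind it. -/
theorem isReflected_rest {G : Gas} {ρ₁ a D h R : ℝ} {p : Params} {I : Incident}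
    (hI : IsIncident G ρ₁ p I) (ha : 0 < a) (hR : 1 < R) (hD : D = R * a)
    (hξ : I.ξR = !₂[-a, h]) (hv : I.v₂ = !₂[D - a, 0])
    (hb : G.enthalpy I.ρ₂ + D ^ 2 / 2 = G.enthalpy (R * I.ρ₂) + a ^ 2 / 2) :
    IsReflected G p I !₂[1, 0] (R * I.ρ₂) 0 := by
  have hρ₂ := hI.ρ₂_pos
  have haD : a < D := by rw [hD]; nlinarith
  refine ⟨?_, by simp [dot_eq]⟩
  have e1 : I.v₂ - I.ξR = !₂[D, -h] := by rw [hξ, hv]; apply plane_ext <;> simp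
  have e2 : 0 - I.ξR = !₂[a, -h] := by rw [hξ]; apply plane_ext <;> simp
  rw [e1, e2]
  refine ⟨?_, by positivity, ?_, ?_, ?_, ?_, ?_⟩
  · have : ‖(!₂[1, 0] : Plane)‖ ^ 2 = 1 := by rw [norm_sq_eq]; simp
    exact (pow_eq_one_iff_of_nonneg (norm_nonneg _) two_ne_zero).1 this
  · simpa [dot_eq] using ha.trans haD
  · simpa [dot_eq] using haD
  · simp [dot_eq]
    rw [hD]
    ring
  · simp [dot_eq]
  · rw [norm_sq_eq, norm_sq_eq, vec_zero, vec_one, vec_zero, vec_one]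
    linarith

/-- The equations provide the incident shock and the resting flow; `hs` makes the slope of the polar
negative there, and `hq` makes the polar positive at a larger subsonic speed. The zero in between is
the weak-type shock. -/
theorem exists_params_of_eqs {G : Gas} {ρ₁ b R α a D h W q : ℝ} (hρ₁ : 0 < ρ₁)
    (hb : 1 < b) (hR : 1 < R) (hα : 0 < α) (hα' : α < Real.pi / 2) (ha : 0 < a) (hh : 0 < h)
    (hW : 0 < W) (hW2 : W ^ 2 = G.soundSpeed ρ₁ ^ 2 * downstreamSq (G.γ - 1) b)
    (ha2 : a ^ 2 = G.soundSpeed (b * ρ₁) ^ 2 * downstreamSq (G.γ - 1) R) (hD : D = R * a)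
    (eq1 : h * Real.cos α - D * Real.sin α = W)
    (eq2 : (b - 1) * W * (h * Real.sin α + a * Real.cos α) = (D - a) * h)
    (hs : h ^ 2 * (G.soundSpeed (b * ρ₁) ^ 2 * R ^ (G.γ - 1) + a * D) <
      a * D * (G.soundSpeed (b * ρ₁) ^ 2 * R ^ (G.γ - 1) - a ^ 2))
    (hq : WeakShockBound (G.γ - 1) (G.soundSpeed (b * ρ₁) ^ 2) D h a q) :
    ∃ p : Params, 0 < p.α ∧ HasStrongTypeTrivialRR G ρ₁ p ∧ HasTransonicWeakLocalRR G ρ₁ p := by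
  have hg : 0 < G.γ - 1 := by linarith [G.one_lt_γ]
  have haD : a < D := by rw [hD]; nlinarith
  obtain ⟨p, I, hpα, hI, hξ, hρ, hv⟩ :=
    exists_isIncident_of_eqs hρ₁ hb hα hα' ha hh haD hW hW2 eq1 eq2
  rw [← hρ] at ha2 hs hq
  have hρ₂ := hI.ρ₂_pos
  have hρ₃ : 0 < R * I.ρ₂ := by positivity
  obtain ⟨hr, hr2, hrm, hmZ⟩ := resting_bounds ha hh haD
  have hC0 : 0 < G.soundSpeed I.ρ₂ ^ 2 := by have := G.soundSpeed_pos hρ₂; positivity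
  have hcos : 0 < Real.cos p.α := by
    rw [hpα]
    exact Real.cos_pos_of_mem_Ioo ⟨by linarith, hα'⟩
  have hzero := polar_resting hg hC0 hR ha hh hD ha2
  have hson := sonic_resting hg hR hD ha2
  obtain ⟨hq1, hq2, hq3, hq4⟩ := hq
  have hc3 : G.soundSpeed (R * I.ρ₂) ^ 2 = G.soundSpeed I.ρ₂ ^ 2 * R ^ (G.γ - 1) := by
    rw [G.soundSpeed_sq_eq hρ₂ hρ₃, mul_div_cancel_right₀ _ hρ₂.ne']
  have hbern := normal_speeds_bernoulli hρ₂ hR ha2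
  rw [← hD] at hbern
  have hc3pos : 0 < G.soundSpeed I.ρ₂ ^ 2 * R ^ (G.γ - 1) := by positivity
  have hsonic : a ^ 2 + h ^ 2 < G.soundSpeed (R * I.ρ₂) ^ 2 := by
    rw [hc3]
    exact subsonic_of_strong ha (ha.trans haD) hh hc3pos hs.le
  have hglob := isGlobalRR_restFlow hI hcos ha hh hR hD hξ hv hbern hsonic
  have hstrong := isReflected_rest hI ha hR hD hξ hv hbern
  have e1 : I.v₂ - I.ξR = !₂[D, -h] := by rw [hξ, hv]; apply plane_ext <;> simp
  have hnr : ‖I.ξR‖ = √(a ^ 2 + h ^ 2) := by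
    have h1 : ‖I.ξR‖ ^ 2 = √(a ^ 2 + h ^ 2) ^ 2 := by
      rw [hr2, norm_sq_eq, hξ]
      simp
    exact (pow_left_inj₀ (norm_nonneg _) hr.le two_ne_zero).1 h1
  have hm : -dot (I.v₂ - I.ξR) p.wallDir = (D * a + h ^ 2) / √(a ^ 2 + h ^ 2) := by
    have h1 : dot (I.v₂ - I.ξR) I.ξR = √(a ^ 2 + h ^ 2) * dot (I.v₂ - I.ξR) p.wallDir := by
      have h3 : ∀ x : Plane, dot x I.ξR = ‖I.ξR‖ * dot x p.wallDir := fun x =>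
        (congrArg (inner ℝ x) hI.ξR_eq_norm_smul).trans (real_inner_smul_right _ _ _)
      rw [h3, hnr]
    have h2 : dot (I.v₂ - I.ξR) I.ξR = -(D * a + h ^ 2) := by
      rw [e1, hξ, dot_eq, vec_zero, vec_zero, vec_one, vec_one]
      ring
    rw [eq_div_iff hr.ne']
    linarith
  have hZ : ‖I.v₂ - I.ξR‖ ^ 2 = D ^ 2 + h ^ 2 := by
    rw [norm_sq_eq, e1, vec_zero, vec_one]
    ring
  set r := √(a ^ 2 + h ^ 2) with hrdef
  have hce : G.soundSpeed I.ρ₂ ^ 2 + (G.γ - 1) * (D ^ 2 + h ^ 2 - r ^ 2) / 2 =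
      G.soundSpeed I.ρ₂ ^ 2 * R ^ (G.γ - 1) := by
    rw [← hson, hr2]
    ring
  have hneg := (polarDeriv_neg_iff ha haD hr hr2 hc3pos hce).2 hs
  obtain ⟨x, hx, hx0⟩ := exists_polar_eq_zero hg hC0 hmZ hr hq1 hq2 hzero hneg hq4
  obtain ⟨n, ρw, hsh, hcw⟩ := exists_isShock_of_polar (G := G) (z := I.v₂ - I.ξR) hρ₂
    p.norm_wallDir (hr.trans hx.1) (by rw [hm]; exact hx.2.trans hq2) (by rw [hm, hZ]; exact hx0)
  have hwz : I.ξR + -(x • p.wallDir) - I.ξR = -(x • p.wallDir) := add_sub_cancel_left _ _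
  have hweak : IsReflected G p I n ρw (I.ξR + -(x • p.wallDir)) := by
    refine ⟨by rwa [hwz], ?_⟩
    rw [dot_add_left, hI.dot_ξR, ← neg_smul, dot_smul_left', p.dot_wallDir_wallNormal]
    ring
  have hnw : ‖I.ξR + -(x • p.wallDir) - I.ξR‖ = x := by
    rw [hwz, norm_neg, norm_smul, p.norm_wallDir, mul_one, Real.norm_eq_abs,
      abs_of_pos (hr.trans hx.1)]
  have hlt : ‖0 - I.ξR‖ < ‖I.ξR + -(x • p.wallDir) - I.ξR‖ := by
    rw [zero_sub, norm_neg, hnr, hnw]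
    exact hx.1
  refine ⟨p, by rwa [hpα], ⟨I, _, hglob, ?_, !₂[1, 0], _, 0, ⟨hstrong, _, _, _, hweak, hlt⟩,
    fun _ _ => ⟨rfl, rfl⟩⟩, I, hI, n, ρw, _, ⟨hweak, _, _, _, hstrong, hlt⟩, ?_⟩
  · rw [restFlow_image, restFlow_end, hξ]
  · rw [hnw]
    apply lt_of_pow_lt_pow_left₀ 2 (G.soundSpeed_pos hsh.density_pos).le
    rw [hcw, hZ]
    -- Along the polar the squared sound speed grows as the speed decreases, so subsonicity at `q`
    -- passes to the smaller `x`.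
    have h1 : x ^ 2 < q ^ 2 := pow_lt_pow_left₀ hx.2 (hr.trans hx.1).le two_ne_zero
    have h2 : (G.γ - 1) * (D ^ 2 + h ^ 2 - q ^ 2) < (G.γ - 1) * (D ^ 2 + h ^ 2 - x ^ 2) := by
      gcongr
    linarith

/-! ### The borderline between strong and weak type at `α = 0` -/

/-- Where this is positive, vertical reflected shocks of parallel incident ones are of strong
type. -/
def strongExcess (g b : ℝ) : ℝ :=
  b * b ^ g * (b ^ g - downstreamSq g b) - (b ^ g + b * downstreamSq g b)

theorem continuousAt_downstreamSq {g R : ℝ} (hR : 1 < R) :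
    ContinuousAt (downstreamSq g) R := by
  have h1 : R ^ 2 - 1 ≠ 0 := by nlinarith
  have h2 : ContinuousAt (fun x : ℝ => x ^ g) R :=
    Real.continuousAt_rpow_const _ _ (Or.inl (by linarith))
  exact continuousAt_const.mul ((h2.sub continuousAt_const).div (by fun_prop) h1)

theorem continuousAt_strongExcess {g b : ℝ} (hb : 1 < b) : ContinuousAt (strongExcess g) b := by
  have h1 := continuousAt_downstreamSq (g := g) hb
  have h2 : ContinuousAt (fun x : ℝ => x ^ g) b :=
    Real.continuousAt_rpow_const _ _ (Or.inl (by linarith))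
  exact ((continuousAt_id.mul h2).mul (h2.sub h1)).sub (h2.add (continuousAt_id.mul h1))

/-- Multiplication by `b ^ 2 - 1` removes the singularity at `b = 1`; the product `S` vanishes there
with derivative `-4`. -/
theorem exists_strongExcess_neg {g : ℝ} (hg : 0 < g) : ∃ b > 1, strongExcess g b < 0 := by
  set S : ℝ → ℝ := fun b => b * b ^ g * (b ^ g * (b ^ 2 - 1) - 2 / g * (b ^ g - 1)) -
    (b ^ g * (b ^ 2 - 1) + b * (2 / g * (b ^ g - 1))) with hS
  have hd : HasDerivAt S (-4) 1 := by
    have i := hasDerivAt_id (1 : ℝ)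
    have hy : HasDerivAt (fun x : ℝ => x ^ g) (g * 1 ^ (g - 1)) 1 :=
      Real.hasDerivAt_rpow_const (Or.inl one_ne_zero)
    have h2 := (i.pow 2).sub_const 1
    have h3 := (hy.sub_const 1).const_mul (2 / g)
    have := ((i.mul hy).mul ((hy.mul h2).sub h3)).sub ((hy.mul h2).add (i.mul h3))
    refine this.congr_deriv ?_
    simp
    field_simp
    norm_num
  have h1 : S 1 = 0 := by simp [hS]
  have hev : Tendsto (slope S 1) (𝓝[>] 1) (𝓝 (-4)) :=
    (hasDerivAt_iff_tendsto_slope.1 hd).mono_left (nhdsWithin_mono 1 fun x hx => ne_of_gt hx)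
  obtain ⟨b, hb, hb1 : 1 < b⟩ :=
    ((hev.eventually_lt_const (show (-4 : ℝ) < 0 by norm_num)).and
      (self_mem_nhdsWithin : Ioi (1 : ℝ) ∈ 𝓝[>] (1 : ℝ))).exists
  refine ⟨b, hb1, ?_⟩
  rw [slope_def_field, h1, sub_zero] at hb
  have hb0 : 0 < b - 1 := by linarith
  have hSb : S b < 0 := by
    by_contra hcon
    exact hb.not_ge (div_nonneg (not_lt.1 hcon) hb0.le)
  have h2 : 0 < b ^ 2 - 1 := by nlinarith
  have e : strongExcess g b * (b ^ 2 - 1) = S b := by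
    simp only [hS, strongExcess, downstreamSq]
    field_simp
  by_contra hcon
  have := mul_nonneg (not_lt.1 hcon) h2.le
  linarith

/-- For `b ≥ 2 + 4 / g` one has `b * downstreamSq g b ≤ b ^ g / 2`, and the term quadratic in `b ^
g` dominates. -/
theorem exists_strongExcess_pos {g : ℝ} (hg : 0 < g) (x : ℝ) :
    ∃ b > 1, x ≤ b ∧ 0 < strongExcess g b := by
  set b := max x (2 + 4 / g) with hb
  have hbg : 2 + 4 / g ≤ b := le_max_right _ _
  have hg4 : 0 < 4 / g := by positivity
  have hb2 : 2 ≤ b := by linarith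
  have hb1 : 1 < b := by linarith
  have hy : 1 < b ^ g := Real.one_lt_rpow hb1 hg
  set y := b ^ g with hydef
  have hden : 4 / g * b ≤ b ^ 2 - 1 := by nlinarith
  have hω : b * downstreamSq g b ≤ y / 2 := by
    have h1 : 0 < b ^ 2 - 1 := lt_of_lt_of_le (by positivity) hden
    rw [downstreamSq, ← hydef, ← mul_div_assoc, ← mul_div_assoc, div_le_iff₀ h1]
    have h2 : y / 2 * (4 / g * b) ≤ y / 2 * (b ^ 2 - 1) := by gcongr
    have h3 : b * (2 / g * (y - 1)) = y / 2 * (4 / g * b) - b * (2 / g) := by ring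
    have h4 : 0 < b * (2 / g) := by positivity
    linarith
  have hω0 := downstreamSq_pos hg hb1
  refine ⟨b, hb1, le_max_left _ _, ?_⟩
  rw [strongExcess, ← hydef]
  have h5 : b * y * (y - downstreamSq g b) = y * (b * y - b * downstreamSq g b) := by ring
  have h6 : 2 * y ≤ b * y := by gcongr
  have h7 : y * (2 * y - y / 2) ≤ y * (b * y - b * downstreamSq g b) := by gcongr
  have h8 : y * 1 < y * y := by gcongr
  linarith

/-- A zero of `strongExcess` that is a limit of points where it is positive. -/
theorem exists_strongExcess_eq_zero {g : ℝ} (hg : 0 < g) :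
    ∃ b > 1, strongExcess g b = 0 ∧ ∀ᶠ x in 𝓝[>] b, 0 < strongExcess g x := by
  obtain ⟨b₀, hb₀, h0⟩ := exists_strongExcess_neg hg
  obtain ⟨b₁, -, h01, h1⟩ := exists_strongExcess_pos hg b₀
  have hcont : ContinuousOn (strongExcess g) (Icc b₀ b₁) := fun x hx =>
    (continuousAt_strongExcess (hb₀.trans_le hx.1)).continuousWithinAt
  set K := Icc b₀ b₁ ∩ strongExcess g ⁻¹' Iic 0 with hK
  have hKc : IsCompact K :=
    isCompact_Icc.of_isClosed_subset (hcont.preimage_isClosed_of_isClosed isClosed_Icc isClosed_Iic)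
      inter_subset_left
  have hne : K.Nonempty := ⟨b₀, ⟨le_rfl, h01⟩, h0.le⟩
  -- The last point in the interval where `strongExcess` is nonpositive; this choice ensures
  -- positivity immediately to its right, which an arbitrary zero would not.
  obtain ⟨c, hc, hmax⟩ := hKc.exists_isGreatest hne
  have hcle : strongExcess g c ≤ 0 := hc.2
  have hc1 : 1 < c := hb₀.trans_le hc.1.1
  have hlt : c < b₁ := lt_of_le_of_ne hc.1.2 (by rintro rfl; linarith)
  have hpos : ∀ᶠ x in 𝓝[>] c, 0 < strongExcess g x := by
    filter_upwards [Ioo_mem_nhdsGT hlt] with x hx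
    by_contra hcon
    exact hx.1.not_ge (hmax ⟨⟨hc.1.1.trans hx.1.le, hx.2.le⟩, not_lt.1 hcon⟩)
  refine ⟨c, hc1, le_antisymm hcle ?_, hpos⟩
  exact ge_of_tendsto ((continuousAt_strongExcess hc1).tendsto.mono_left nhdsWithin_le_nhds)
    (hpos.mono fun x hx => hx.le)

/-- At the borderline of strong-type shocks, the polar is positive at larger speeds. -/
theorem exists_weakShockBound {g C D h a R : ℝ} (hg : 0 < g) (hC : 0 < C) (hR : 1 < R)
    (ha : 0 < a) (hh : 0 < h) (hD : D = R * a) (ha2 : a ^ 2 = C * downstreamSq g R)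
    (hs : h ^ 2 * (C * R ^ g + a * D) = a * D * (C * R ^ g - a ^ 2)) :
    ∃ q, WeakShockBound g C D h a q := by
  have haD : a < D := by rw [hD]; nlinarith
  obtain ⟨hr, hr2, hrm, hmZ⟩ := resting_bounds ha hh haD
  have hzero := polar_resting hg hC hR ha hh hD ha2
  have hc3 : 0 < C * R ^ g := by positivity
  have hson := sonic_resting hg hR hD ha2
  have hsub := subsonic_of_strong ha (ha.trans haD) hh hc3 hs.le
  set r := √(a ^ 2 + h ^ 2) with hrdef
  set m := (D * a + h ^ 2) / r with hm
  have hce : C + g * (D ^ 2 + h ^ 2 - r ^ 2) / 2 = C * R ^ g := by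
    rw [← hson, hr2]
    ring
  -- Equality in the strong-type condition means zero slope at the resting state, so by convexity
  -- the polar increases from there. The resting state is subsonic, hence so are slightly larger
  -- speeds.
  have hd : polarDeriv g C (D ^ 2 + h ^ 2) m r = 0 := by
    have h1 := polarDeriv_resting ha haD hr hr2 hc3 hce
    have h2 : a * D * (C * R ^ g) * r ≠ 0 := by
      have := ha.trans haD
      positivity
    rw [hs, sub_self] at h1
    exact (mul_eq_zero.1 h1).resolve_right h2
  have hev : ∀ᶠ q in 𝓝[>] r, q ^ 2 < C + g * (D ^ 2 + h ^ 2 - q ^ 2) / 2 := by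
    apply Filter.Eventually.filter_mono nhdsWithin_le_nhds
    apply ContinuousAt.eventually_lt (by fun_prop) (by fun_prop)
    rw [hce, hr2]
    exact hsub
  obtain ⟨q, hq, hqm⟩ := (hev.and (Ioo_mem_nhdsGT hrm)).exists
  refine ⟨q, hqm.1, hqm.2, hq, ?_⟩
  have hmono : StrictMonoOn (polar g C (D ^ 2 + h ^ 2) m) (Icc r q) := by
    apply strictMonoOn_of_deriv_pos (convex_Icc _ _)
    · exact (continuousOn_polar hg hC hmZ).mono fun x hx =>
        ⟨hr.trans_le hx.1, hx.2.trans_lt hqm.2⟩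
    · intro x hx
      rw [interior_Icc] at hx
      rw [(hasDerivAt_polar hg hC hmZ (hr.trans hx.1) (hx.2.trans hqm.2)).deriv, ← hd]
      exact polarDeriv_lt hg hC hmZ hr hx.1 (hx.2.trans hqm.2)
  have := hmono ⟨le_rfl, hqm.1.le⟩ ⟨hqm.1.le, le_rfl⟩ hqm.1
  linarith

/-- All four conditions are strict inequalities between continuous quantities, for a fixed speed
`q`. -/
theorem WeakShockBound.eventually {X : Type*} [TopologicalSpace X] {x₀ : X} {C D h a : X → ℝ}
    {g q : ℝ} (hg : 0 < g) (hC : ContinuousAt C x₀) (hD : ContinuousAt D x₀)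
    (hh : ContinuousAt h x₀) (ha : ContinuousAt a x₀) (hC0 : 0 < C x₀) (hh0 : 0 < h x₀)
    (ha0 : 0 < a x₀) (haD : a x₀ < D x₀)
    (hw : WeakShockBound g (C x₀) (D x₀) (h x₀) (a x₀) q) :
    ∀ᶠ x in 𝓝 x₀, WeakShockBound g (C x) (D x) (h x) (a x) q := by
  obtain ⟨hr, hr2, hrm, hmZ⟩ := resting_bounds ha0 hh0 haD
  obtain ⟨h1, h2, h3, h4⟩ := hw
  obtain ⟨p1, p2⟩ := polar_pos_aux hg hC0 hmZ (hr.trans h1) h2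
  have cr : ContinuousAt (fun x => √(a x ^ 2 + h x ^ 2)) x₀ := by fun_prop
  have cm : ContinuousAt (fun x => (D x * a x + h x ^ 2) / √(a x ^ 2 + h x ^ 2)) x₀ :=
    ContinuousAt.div (by fun_prop) cr hr.ne'
  have cZ : ContinuousAt (fun x => D x ^ 2 + h x ^ 2) x₀ := by fun_prop
  have cc : ContinuousAt (fun x => C x + g * (D x ^ 2 + h x ^ 2 - q ^ 2) / 2) x₀ := by fun_prop
  have cp : ContinuousAt (fun x => polar g (C x) (D x ^ 2 + h x ^ 2)
      ((D x * a x + h x ^ 2) / √(a x ^ 2 + h x ^ 2)) q) x₀ :=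
    ((((cZ.sub (continuousAt_const.mul cm)).log p1.ne').sub continuousAt_const).sub
      ((cm.sub continuousAt_const).log (sub_pos.2 h2).ne')).sub
      (((cc.log p2.ne').sub (hC.log hC0.ne')).div_const g)
  filter_upwards [cr.eventually_lt_const h1, cm.eventually_const_lt h2,
    cc.eventually_const_lt h3, cp.eventually_const_lt h4] with x e1 e2 e3 e4
  exact ⟨e1, e2, e3, e4⟩

/-! ### Solving for the two density ratios and the incident angle -/

/-- The normal speed behind a shock of density ratio `R`, with `C` the square of the upstream sound
speed. -/
def restSpeed (g C R : ℝ) : ℝ := √(C * downstreamSq g R)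

/-- Distance from the reflection point to the vertical axis, for the density ratios `x.1` and
`x.2.1` of the incident and the reflected shock. -/
def pointDist (g C : ℝ) (x : ℝ × ℝ × ℝ) : ℝ := restSpeed g (C * x.1 ^ g) x.2.1

/-- Horizontal pseudo-speed of the 2-sector at the reflection point. -/
def pointSpeed (g C : ℝ) (x : ℝ × ℝ × ℝ) : ℝ := x.2.1 * pointDist g C x

/-- Height of the reflection point, where `x.2.2` is the angle of the incident shock. -/
def pointHeight (g C : ℝ) (x : ℝ × ℝ × ℝ) : ℝ :=
  (restSpeed g C x.1 + pointSpeed g C x * Real.sin x.2.2) / Real.cos x.2.2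

theorem restSpeed_sq {g C R : ℝ} (hg : 0 < g) (hC : 0 < C) (hR : 1 < R) :
    0 < restSpeed g C R ∧ restSpeed g C R ^ 2 = C * downstreamSq g R := by
  have h := mul_pos hC (downstreamSq_pos hg hR)
  exact ⟨Real.sqrt_pos.2 h, Real.sq_sqrt h.le⟩

section

variable {g C : ℝ} {x : ℝ × ℝ × ℝ}

theorem continuousAt_fst_rpow (h1 : 1 < x.1) :
    ContinuousAt (fun y : ℝ × ℝ × ℝ => C * y.1 ^ g) x :=
  continuousAt_const.mul (continuousAt_fst.rpow_const (Or.inl (by linarith)))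

theorem continuousAt_pointDist (h1 : 1 < x.1) (h2 : 1 < x.2.1) :
    ContinuousAt (pointDist g C) x :=
  ((continuousAt_fst_rpow h1).mul (ContinuousAt.comp (f := fun y : ℝ × ℝ × ℝ => y.2.1)
    (continuousAt_downstreamSq h2) (by fun_prop))).sqrt

theorem continuousAt_pointSpeed (h1 : 1 < x.1) (h2 : 1 < x.2.1) :
    ContinuousAt (pointSpeed g C) x :=
  ContinuousAt.mul (by fun_prop) (continuousAt_pointDist h1 h2)

theorem continuousAt_restSpeed_fst (h1 : 1 < x.1) :
    ContinuousAt (fun y : ℝ × ℝ × ℝ => restSpeed g C y.1) x :=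
  (continuousAt_const.mul (ContinuousAt.comp (f := fun y : ℝ × ℝ × ℝ => y.1)
    (continuousAt_downstreamSq h1) (by fun_prop))).sqrt

theorem continuousAt_pointHeight (h1 : 1 < x.1) (h2 : 1 < x.2.1) (h3 : Real.cos x.2.2 ≠ 0) :
    ContinuousAt (pointHeight g C) x :=
  ((continuousAt_restSpeed_fst h1).add ((continuousAt_pointSpeed h1 h2).mul (by fun_prop))).div
    (by fun_prop) h3

end

/-- Positive if and only if the vertical shock is of strong type. -/
def strongGap (g C : ℝ) (x : ℝ × ℝ × ℝ) : ℝ :=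
  pointDist g C x * pointSpeed g C x * (C * x.1 ^ g * x.2.1 ^ g - pointDist g C x ^ 2) -
    pointHeight g C x ^ 2 * (C * x.1 ^ g * x.2.1 ^ g + pointDist g C x * pointSpeed g C x)

/-- The bound for the shocks determined by `x`. -/
def WeakShockBoundAt (g C q : ℝ) (x : ℝ × ℝ × ℝ) : Prop :=
  WeakShockBound g (C * x.1 ^ g) (pointSpeed g C x) (pointHeight g C x) (pointDist g C x) q

/-- Vanishes if and only if the two shocks fit the walls. -/
def closingGap (g C : ℝ) (x : ℝ × ℝ × ℝ) : ℝ :=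
  (x.1 - 1) * restSpeed g C x.1 *
      (pointHeight g C x * Real.sin x.2.2 + pointDist g C x * Real.cos x.2.2) -
    (pointSpeed g C x - pointDist g C x) * pointHeight g C x

section

variable {g C b R : ℝ}

theorem pointHeight_zero : pointHeight g C (b, R, 0) = restSpeed g C b := by
  simp [pointHeight]

/-- At `α = 0` the height is the downstream speed of the incident shock, and a positive factor
splits off from the strong-type inequality. -/
theorem strongGap_diag (hg : 0 < g) (hC : 0 < C) (hb : 1 < b) :
    strongGap g C (b, b, 0) = C ^ 2 * downstreamSq g b * b ^ g * strongExcess g b := by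
  have h1 := (restSpeed_sq hg hC hb).2
  have h2 := (restSpeed_sq hg (show 0 < C * b ^ g by positivity) hb).2
  rw [strongGap, pointHeight_zero, h1, pointSpeed, pointDist, h2, strongExcess]
  simp only
  linear_combination (b * (C * b ^ g * b ^ g - C * b ^ g * downstreamSq g b) -
    b * C * downstreamSq g b) * h2

/-- At `α = 0` the shocks fit the walls only if their density ratios agree, and the gap changes sign
across `R = b`. -/
theorem closingGap_zero : closingGap g C (b, R, 0) =
    restSpeed g C b * pointDist g C (b, R, 0) * (b - R) := by
  rw [closingGap, pointHeight_zero, pointSpeed]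
  simp only [Real.sin_zero, Real.cos_zero]
  ring

theorem continuousAt_strongGap {x : ℝ × ℝ × ℝ} (h1 : 1 < x.1) (h2 : 1 < x.2.1)
    (h3 : Real.cos x.2.2 ≠ 0) : ContinuousAt (strongGap g C) x := by
  have ca := continuousAt_pointDist (g := g) (C := C) h1 h2
  have cD := continuousAt_pointSpeed (g := g) (C := C) h1 h2
  have ch := continuousAt_pointHeight (g := g) (C := C) h1 h2 h3
  have cc : ContinuousAt (fun y : ℝ × ℝ × ℝ => C * y.1 ^ g * y.2.1 ^ g) x :=
    (continuousAt_fst_rpow h1).mul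
      (ContinuousAt.rpow_const (by fun_prop) (Or.inl (by linarith)))
  exact ((ca.mul cD).mul (cc.sub (ca.pow 2))).sub ((ch.pow 2).mul (cc.add (ca.mul cD)))

theorem continuousAt_closingGap {x : ℝ × ℝ × ℝ} (h1 : 1 < x.1) (h2 : 1 < x.2.1)
    (h3 : Real.cos x.2.2 ≠ 0) : ContinuousAt (closingGap g C) x := by
  have ca := continuousAt_pointDist (g := g) (C := C) h1 h2
  have cD := continuousAt_pointSpeed (g := g) (C := C) h1 h2
  have ch := continuousAt_pointHeight (g := g) (C := C) h1 h2 h3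
  have cW := continuousAt_restSpeed_fst (g := g) (C := C) h1
  exact ((ContinuousAt.mul (by fun_prop) cW).mul ((ch.mul (by fun_prop)).add
    (ca.mul (by fun_prop)))).sub ((cD.sub ca).mul ch)

theorem pointDist_pos (hg : 0 < g) (hC : 0 < C) {x : ℝ × ℝ × ℝ} (h1 : 1 < x.1) (h2 : 1 < x.2.1) :
    0 < pointDist g C x :=
  (restSpeed_sq hg (by have := zero_lt_one.trans h1; positivity) h2).1

theorem pointDist_lt_pointSpeed (hg : 0 < g) (hC : 0 < C) {x : ℝ × ℝ × ℝ} (h1 : 1 < x.1)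
    (h2 : 1 < x.2.1) : pointDist g C x < pointSpeed g C x :=
  lt_mul_of_one_lt_left (pointDist_pos hg hC h1 h2) h2

/-- For suitable parallel shocks of equal density ratio, and all nearby ones, the reflected shock is
of strong type with a transonic weak-type companion. -/
theorem exists_eventually_weakShockBoundAt (hg : 0 < g) (hC : 0 < C) :
    ∃ b > 1, ∃ q, ∀ᶠ x in 𝓝 ((b, b, 0) : ℝ × ℝ × ℝ),
      WeakShockBoundAt g C q x ∧ 0 < strongGap g C x := by
  obtain ⟨c, hc, hzero, hpos⟩ := exists_strongExcess_eq_zero hg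
  have hCc : 0 < C * c ^ g := by positivity
  have hcos : Real.cos ((c, c, 0) : ℝ × ℝ × ℝ).2.2 ≠ 0 := by simp
  have ha := pointDist_pos hg hC (x := (c, c, 0)) hc hc
  have haD := pointDist_lt_pointSpeed hg hC (x := (c, c, 0)) hc hc
  have hh : 0 < pointHeight g C (c, c, 0) := by
    rw [pointHeight_zero]
    exact (restSpeed_sq hg hC hc).1
  have hgap := strongGap_diag hg hC hc
  rw [hzero, mul_zero, strongGap, sub_eq_zero] at hgap
  obtain ⟨q, hq⟩ := exists_weakShockBound hg hCc hc ha hh rfl (restSpeed_sq hg hCc hc).2 hgap.symm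
  have hev : ∀ᶠ x in 𝓝 ((c, c, 0) : ℝ × ℝ × ℝ), WeakShockBoundAt g C q x :=
    WeakShockBound.eventually hg (C := fun x : ℝ × ℝ × ℝ => C * x.1 ^ g)
      (continuousAt_fst_rpow hc) (continuousAt_pointSpeed hc hc)
      (continuousAt_pointHeight hc hc hcos) (continuousAt_pointDist hc hc) hCc hh ha haD hq
  have hdiag : Tendsto (fun b : ℝ => ((b, b, 0) : ℝ × ℝ × ℝ)) (𝓝[>] c) (𝓝 (c, c, 0)) :=
    (show Continuous fun b : ℝ => ((b, b, 0) : ℝ × ℝ × ℝ) by fun_prop).continuousAt.mono_left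
      nhdsWithin_le_nhds
  -- Slightly to the right of the borderline `c` the shock is strictly of strong type, while the
  -- open bound for the weak-type companion persists.
  obtain ⟨b, ⟨hb1, hb2⟩, hb3⟩ := ((hdiag.eventually hev.eventually_nhds).and hpos |>.and
    (self_mem_nhdsWithin : Ioi c ∈ 𝓝[>] c)).exists
  have hb : 1 < b := hc.trans hb3
  refine ⟨b, hb, q, hb1.and ?_⟩
  apply (continuousAt_strongGap hb hb (by simp)).eventually_const_lt
  rw [strongGap_diag hg hC hb]
  have := downstreamSq_pos hg hb
  positivity

/-- The opposite signs of the gap at `R = b ± η` for `α = 0` survive for small `α > 0`, so it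
vanishes in between. A solution with `α > 0` is needed because the perturbation lowers `α`. -/
theorem exists_closingGap_eq_zero (hg : 0 < g) (hC : 0 < C) (hb : 1 < b)
    {P : ℝ × ℝ × ℝ → Prop} (hP : ∀ᶠ x in 𝓝 ((b, b, 0) : ℝ × ℝ × ℝ), P x) :
    ∃ R α, 1 < R ∧ 0 < α ∧ α < Real.pi / 2 ∧ closingGap g C (b, R, α) = 0 ∧ P (b, R, α) := by
  have hP' : ∀ᶠ y in 𝓝 ((b, 0) : ℝ × ℝ), P (b, y) :=
    (show Continuous fun y : ℝ × ℝ => (b, y) by fun_prop).continuousAt.eventually hP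
  rw [nhds_prod_eq, eventually_prod_iff] at hP'
  obtain ⟨p, hp, p', hp', hpp⟩ := hP'
  obtain ⟨ε, hε, hball⟩ := Metric.eventually_nhds_iff.1 (hp.and (lt_mem_nhds hb))
  set η := ε / 2 with hη
  have hη0 : 0 < η := by positivity
  have hin : ∀ R ∈ Icc (b - η) (b + η), p R ∧ 1 < R := by
    intro R hR
    apply hball
    rw [Real.dist_eq, abs_lt]
    constructor <;> linarith [hR.1, hR.2]
  have hW := (restSpeed_sq hg hC hb).1
  have hm : b - η ∈ Icc (b - η) (b + η) := ⟨le_rfl, by linarith⟩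
  have hM : b + η ∈ Icc (b - η) (b + η) := ⟨by linarith, le_rfl⟩
  have hcont : ∀ R, 1 < R → ContinuousAt (fun α : ℝ => closingGap g C (b, R, α)) 0 := fun R hR =>
    ContinuousAt.comp (f := fun α : ℝ => ((b, R, α) : ℝ × ℝ × ℝ))
      (continuousAt_closingGap hb hR (by simp)) (by fun_prop)
  have e1 : ∀ᶠ α : ℝ in 𝓝 0, 0 < closingGap g C (b, b - η, α) := by
    apply (hcont _ (hin _ hm).2).eventually_const_lt
    beta_reduce
    rw [closingGap_zero, sub_sub_cancel]
    have := pointDist_pos hg hC (x := (b, b - η, 0)) hb (hin _ hm).2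
    positivity
  have e2 : ∀ᶠ α : ℝ in 𝓝 0, closingGap g C (b, b + η, α) < 0 := by
    apply (hcont _ (hin _ hM).2).eventually_lt_const
    beta_reduce
    rw [closingGap_zero]
    have := pointDist_pos hg hC (x := (b, b + η, 0)) hb (hin _ hM).2
    exact mul_neg_of_pos_of_neg (by positivity) (by linarith)
  have hpi : 0 < Real.pi / 2 := by positivity
  obtain ⟨α, ⟨⟨h1, h2⟩, h3⟩, hα⟩ := ((((e1.and e2).and hp').filter_mono nhdsWithin_le_nhds).and
    (Ioo_mem_nhdsGT hpi)).exists
  have hcos : Real.cos α ≠ 0 := (Real.cos_pos_of_mem_Ioo ⟨by linarith [hα.1], hα.2⟩).ne'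
  have hc : ContinuousOn (fun R : ℝ => closingGap g C (b, R, α)) (Icc (b - η) (b + η)) :=
    fun R hR => (ContinuousAt.comp (f := fun R : ℝ => ((b, R, α) : ℝ × ℝ × ℝ))
      (continuousAt_closingGap hb (hin R hR).2 hcos) (by fun_prop)).continuousWithinAt
  obtain ⟨R, hR, h0⟩ := intermediate_value_Icc' (hm.2) hc ⟨h2.le, h1.le⟩
  exact ⟨R, α, (hin R hR).2, hα.1, hα.2, h0, hpp (hin R hR).1 h3⟩

end

/-- Strong-type trivial reflections with a transonic local weak-type companion exist. -/
theorem exists_params (G : Gas) {ρ₁ : ℝ} (hρ₁ : 0 < ρ₁) :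
    ∃ p : Params, 0 < p.α ∧ HasStrongTypeTrivialRR G ρ₁ p ∧ HasTransonicWeakLocalRR G ρ₁ p := by
  have hg : 0 < G.γ - 1 := by linarith [G.one_lt_γ]
  have hC : 0 < G.soundSpeed ρ₁ ^ 2 := by have := G.soundSpeed_pos hρ₁; positivity
  obtain ⟨b, hb, q, hev⟩ := exists_eventually_weakShockBoundAt hg hC
  obtain ⟨R, α, hR, hα, hα', hclose, hq, hs⟩ := exists_closingGap_eq_zero hg hC hb hev
  have hCb : G.soundSpeed (b * ρ₁) ^ 2 = G.soundSpeed ρ₁ ^ 2 * b ^ (G.γ - 1) := by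
    rw [G.soundSpeed_sq_eq hρ₁ (by positivity), mul_div_cancel_right₀ _ hρ₁.ne']
  have hCb0 : 0 < G.soundSpeed ρ₁ ^ 2 * b ^ (G.γ - 1) := by positivity
  obtain ⟨hW, hW2⟩ := restSpeed_sq hg hC hb
  have ha := pointDist_pos hg hC (x := (b, R, α)) hb hR
  have haD := pointDist_lt_pointSpeed hg hC (x := (b, R, α)) hb hR
  have hcos : 0 < Real.cos α := Real.cos_pos_of_mem_Ioo ⟨by linarith, hα'⟩
  have hsin : 0 < Real.sin α := Real.sin_pos_of_pos_of_lt_pi hα (by linarith)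
  have hh : 0 < pointHeight (G.γ - 1) (G.soundSpeed ρ₁ ^ 2) (b, R, α) := by
    have := ha.trans haD
    rw [pointHeight]
    positivity
  refine exists_params_of_eqs hρ₁ hb hR hα hα' ha hh hW hW2 ?_ rfl ?_ (sub_eq_zero.1 hclose) ?_ ?_
    (q := q)
  · rw [hCb]
    exact (restSpeed_sq hg hCb0 hR).2
  · exact sub_eq_iff_eq_add.2 (div_mul_cancel₀ _ hcos.ne')
  · rw [hCb]
    exact sub_pos.1 hs
  · rw [hCb]
    exact hq

end RegularReflection

end

/-! ### The main theorem -/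

open RegularReflection in
theorem mainTheorem3 (G : Gas) (ρ₁ : ℝ) (hρ₁ : 0 < ρ₁) :
    (∀ p : Params, 0 < p.α → HasStrongTypeTrivialRR G ρ₁ p → HasTransonicWeakLocalRR G ρ₁ p →
      (∃ δ₀ > 0, ∀ δ : ℝ, 0 < δ → δ < δ₀ →
        HasTransonicWeakLocalRR G ρ₁ (p.perturb δ) ∧
        ¬ AngleCondition G ρ₁ (p.perturb δ) ∧
        ¬ HasGlobalRR G ρ₁ (p.perturb δ)) ∧
      ¬ StructurallyStable G ρ₁ p) ∧
    (∃ p : Params, 0 < p.α ∧ HasStrongTypeTrivialRR G ρ₁ p ∧ HasTransonicWeakLocalRR G ρ₁ p ∧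
      ¬ StructurallyStable G ρ₁ p) := by
  refine ⟨fun p hα hs hw => ?_, ?_⟩
  · have h := eventually_unstable hρ₁ hα hs hw
    refine ⟨?_, not_structurallyStable_of_eventually h⟩
    obtain ⟨δ₀, hδ₀, hsub⟩ := mem_nhdsGT_iff_exists_Ioo_subset.1 h
    exact ⟨δ₀, hδ₀, fun δ h1 h2 => hsub ⟨h1, h2⟩⟩
  · obtain ⟨p, hα, hs, hw⟩ := exists_params G hρ₁
    exact ⟨p, hα, hs, hw, not_structurallyStable_of_eventually (eventually_unstable hρ₁ hα hs hw)⟩
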